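/- Let $\xi(s)=\tfrac12\pi^{-s/2}\,\Gamma(s/2)\,s(s-1)\,\zeta(s)$ be Riemann's (entire) xi function, let $f(z)=\xi(1/2+z)$, and let $T_m(z)=\sum_{k=0}^{m}\frac{f^{(k)}(0)}{k!}z^k$ be its Maclaurin polynomials. For all sufficiently large $n$ there is a unique real $\lambda=\lambda(n)>1/2$ with $$2-\frac{\lambda}{n}\,\frac{f'(\lambda)}{f(\lambda)}=0 ,$$ and $\lambda(n)\to\infty$ as $n\to\infty$. For such $n$ and $\lambda=\lambda(n)$ define $e^{n\phi_\lambda(z)}=\dfrac{z^{2n}f(\lambda)}{f(\lambda z)}$, so that $$\left|e^{\phi_\lambda(z)}\right|=\left|\frac{z^{2n}f(\lambda)}{f(\lambda z)}\right|^{1/n}\in[0,\infty],$$ with value $+\infty$ where $f(\lambda z)=0$, and define the ($n$-dependent) regions $$\Omega_n=\{z\in\mathbb C: |\Re z|<1,\ |e^{\phi_\lambda(z)}|<1\},\qquad \mho_{-,n}=\{z\in\mathbb C: |\Re z|>1,\ |e^{\phi_\lambda(z)}|<1\},\qquad \mho_{+,n}=\{z\in\mathbb C: |e^{\phi_\lambda(z)}|>1\}.$$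 Let $z\in\mathbb C$ be fixed. 1. If $z\in\Omega_n$ for all sufficiently large $n$, then $\displaystyle\lim_{n\to\infty}\left|\frac{T_{2n}(\lambda(n) z)}{\xi(1/2+\lambda(n) z)}-1\right|=0$. 2. If $z\in\mho_{-,n}$ for all sufficiently large $n$, then $\displaystyle\lim_{n\to\infty}\left|\frac{T_{2n}(\lambda(n) z)}{\xi(1/2+\lambda(n) z)}\right|=0$. 3. If $z\in\mho_{+,n}$ for all sufficiently large $n$, then $\displaystyle\lim_{n\to\infty}\left|\frac{T_{2n}(\lambda(n) z)}{\xi(1/2+\lambda(n) z)}\right|=\infty$, where $|a/0|=\infty$ for $a\neq0$. -/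

import Mathlib

open Filter Topology
open scoped ENNReal Nat

noncomputable section

/-- The Riemann xi function `ξ(s) = (1/2) π^(-s/2) Γ(s/2) s (s-1) ζ(s)` as an entire function.
The closed form below fills in the removable singularities of the product formula; see
`XiTaylor.xi_eq` for the agreement with the product formula and `XiTaylor.differentiable_xi`. -/
def XiTaylor.xi (s : ℂ) : ℂ :=
  (1 / 2) * (s * (s - 1) * completedRiemannZeta₀ s + 1)

theorem XiTaylor.differentiable_xi : Differentiable ℂ XiTaylor.xi := by
  unfold XiTaylor.xi
  have := differentiable_completedZeta₀
  fun_prop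

/-- The product formula for `ξ`, away from the poles of its factors. -/
theorem XiTaylor.xi_eq {s : ℂ} (h0 : s ≠ 0) (h1 : s ≠ 1) (hG : ∀ m : ℕ, s / 2 ≠ -m) :
    XiTaylor.xi s =
      (1 / 2) * (Real.pi : ℂ) ^ (-s / 2) * Complex.Gamma (s / 2) * s * (s - 1) *
        riemannZeta s := by
  have h1' : 1 - s ≠ 0 := sub_ne_zero.mpr (Ne.symm h1)
  have hpi : (Real.pi : ℂ) ^ (-s / 2) ≠ 0 := by
    rw [Ne, Complex.cpow_eq_zero_iff]
    exact fun h => Complex.ofReal_ne_zero.mpr Real.pi_ne_zero h.1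
  have hGa : Complex.Gamma (s / 2) ≠ 0 := Complex.Gamma_ne_zero hG
  rw [riemannZeta_def_of_ne_zero h0, completedRiemannZeta_eq, Complex.Gammaℝ_def, XiTaylor.xi]
  field_simp
  ring

/-- The centred function `f(z) = ξ(1/2 + z)`. -/
def XiTaylor.f (z : ℂ) : ℂ := XiTaylor.xi (1 / 2 + z)

/-- `T m z`: the Maclaurin polynomial of `f` of degree (at most) `m`, evaluated at `z`. -/
def XiTaylor.T (m : ℕ) (z : ℂ) : ℂ :=
  ∑ k ∈ Finset.range (m + 1), iteratedDeriv k XiTaylor.f 0 / (k ! : ℂ) * z ^ k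

/-- `lam` is an admissible scaling parameter for `n`: `lam > 1/2`, and the phase has a critical
point at `z = 1`, that is, `2 - (lam / n) * (log f)'(lam) = 0`. -/
def XiTaylor.IsScale (n : ℕ) (lam : ℝ) : Prop :=
  1 / 2 < lam ∧ 2 - (lam : ℂ) / (n : ℂ) * logDeriv XiTaylor.f (lam : ℂ) = 0

/-- The modulus `|e^{φ_lam(z)}|`, where `e^{n φ_lam(z)} = z^(2n) f(lam) / f(lam z)`.
It is the `n`-th root of `|z^(2n) f(lam)| / |f(lam z)|`, with value `∞` at the zeros of
`z ↦ f(lam z)`, which are poles of `e^{n φ_lam}`. -/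
def XiTaylor.expPhase (n : ℕ) (lam : ℝ) (z : ℂ) : ℝ≥0∞ :=
  (‖z ^ (2 * n) * XiTaylor.f (lam : ℂ)‖ₑ / ‖XiTaylor.f ((lam : ℂ) * z)‖ₑ) ^ (1 / (n : ℝ))

/-- `Ω`: the set where `|Re z| < 1` and `|e^φ| < 1`. -/
def XiTaylor.Omega (n : ℕ) (lam : ℝ) : Set ℂ :=
  {z | |z.re| < 1 ∧ XiTaylor.expPhase n lam z < 1}

/-- `℧₋`: the set where `|Re z| > 1` and `|e^φ| < 1`. -/
def XiTaylor.MhoMinus (n : ℕ) (lam : ℝ) : Set ℂ :=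
  {z | 1 < |z.re| ∧ XiTaylor.expPhase n lam z < 1}

/-- `℧₊`: the set where `|e^φ| > 1`. -/
def XiTaylor.MhoPlus (n : ℕ) (lam : ℝ) : Set ℂ :=
  {z | 1 < XiTaylor.expPhase n lam z}

end

/-! Cauchy's formula on the circle of radius λe^{-1/n} gives T_{2n}(λz) = [|z| < 1] f(λz) + z^{2n}
f(λ) J_n(z), where J_n is `remainderRatio` (`eventually_T_eq`). The scale equation says that
log(f(λe^τ) e^{-2nτ}) is critical at τ = 0. Its second derivative W = `phaseCurv` there is
comparable to n. The saddle point method then shows that √W J_n(z) tends to a multiple of z²/(1 -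
z²), nonzero for z ≠ 0 (`tendsto_remainderRatio`). Thus J_n tends to 0, but only polynomially in λ.

Where |e^φ| < 1, division by f(λz) leaves a remainder of modulus at most |J_n|. This settles the
first two limits once |z| is compared with 1. In ℧₋ one has |z| ≥ |Re z| > 1. In Ω, |z| ≥ 1 is
impossible, since |Re z| < 1 makes f(λz) exponentially smaller than f(λ).

In ℧₊ the dominance |e^{nφ}| > 1 must beat the polynomial loss in J_n, so it has to be upgraded to
|e^{nφ}| ≥ e^{cλ} (`exists_growth`). Off the imaginary axis Stirling gives log|e^{nφ}| = λ((A/2) log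
λ + B + o(1)). The sign of A decides, and when A = 0 the constant B is nonnegative and vanishes only
at z = 1 (`eq_one_of_phase_eq_zero`), which is not in ℧₊. At iy with log y > -1 the dominance is
superexponential. For log y ≤ -1 membership for all large n is impossible
(`not_eventually_norm_f_imag_le`): f would be tiny at all the points iλ_n y. About 30 log t of these
lie within distance 24 of 3/2 + it, and a Jensen-type interpolation (`norm_center_le_of_nodes`)
would make f too small at that point, where ζ is bounded below.

The analytic input is elementary. Euler's product compares |Γ(s)| with Γ(Re s), and |(s - 1)ζ(s)|
has at most polynomial growth. Log-convexity of the completed zeta function turns asymptotics of log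
f into asymptotics of f'/f (`tendsto_deriv_of_convexOn`), hence gives existence and uniqueness of λ.
Borel–Carathéodory and the Schwarz lemma supply the cubic error term at the saddle. -/

namespace XiTaylor

/-! ### Stirling bounds for |Γ|. -/

/-- The summand `log |σ + v + i t| - log (σ + v)` in the Euler product for `|Γ|`. -/
noncomputable def gammaLogTerm (t v : ℝ) : ℝ := Real.log (1 + t ^ 2 / v ^ 2) / 2

/-- The integral of `gammaLogTerm t` over `(v, ∞)`. -/
noncomputable def gammaDecay (t v : ℝ) : ℝ :=
  t * Real.arctan (t / v) - v / 2 * Real.log (1 + t ^ 2 / v ^ 2)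

lemma hasDerivAt_gammaDecay (t : ℝ) {v : ℝ} (hv : 0 < v) :
    HasDerivAt (gammaDecay t) (-gammaLogTerm t v) v := by
  have h1 : HasDerivAt (fun v : ℝ => t / v) (-t / v ^ 2) v := by
    simpa [div_eq_mul_inv] using (hasDerivAt_inv hv.ne').const_mul t
  have h2 : HasDerivAt (fun v : ℝ => 1 + t ^ 2 / v ^ 2) (-2 * t ^ 2 / v ^ 3) v := by
    have := ((h1.pow 2).const_add 1)
    convert! this using 1
    · ext x; simp [div_pow]
    · norm_num; field_simp
  have hpos : 0 < 1 + t ^ 2 / v ^ 2 := by positivity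
  have h3 := (h1.arctan.const_mul t).sub (((hasDerivAt_id v).div_const 2).mul (h2.log hpos.ne'))
  convert! h3 using 1
  simp only [gammaLogTerm, id]
  have : 0 < v ^ 2 + t ^ 2 := by positivity
  field_simp
  ring

lemma gammaLogTerm_nonneg (t v : ℝ) : 0 ≤ gammaLogTerm t v := by
  unfold gammaLogTerm
  have : (0 : ℝ) ≤ t ^ 2 / v ^ 2 := by positivity
  have := Real.log_nonneg (by linarith : (1 : ℝ) ≤ 1 + t ^ 2 / v ^ 2)
  linarith

lemma gammaLogTerm_anti (t : ℝ) {v w : ℝ} (hv : 0 < v) (hvw : v ≤ w) :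
    gammaLogTerm t w ≤ gammaLogTerm t v := by
  unfold gammaLogTerm
  gcongr

/-- By the mean value theorem the increment is a value of the decreasing function `gammaLogTerm t`
inside the unit interval; this is one step of the integral test. -/
lemma gammaDecay_step (t : ℝ) {v : ℝ} (hv : 0 < v) :
    gammaLogTerm t (v + 1) ≤ gammaDecay t v - gammaDecay t (v + 1) ∧
      gammaDecay t v - gammaDecay t (v + 1) ≤ gammaLogTerm t v := by
  obtain ⟨c, hc, h⟩ := exists_hasDerivAt_eq_slope (gammaDecay t) (fun v => -gammaLogTerm t v)
    (by linarith : v < v + 1)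
    (fun x hx => (hasDerivAt_gammaDecay t (hv.trans_le hx.1)).continuousAt.continuousWithinAt)
    (fun x hx => hasDerivAt_gammaDecay t (hv.trans hx.1))
  have h' : gammaDecay t v - gammaDecay t (v + 1) = gammaLogTerm t c := by
    simp at h; linarith
  rw [h']
  exact ⟨gammaLogTerm_anti t (hv.trans hc.1) hc.2.le, gammaLogTerm_anti t hv hc.1.le⟩

lemma arctan_le_self_of_nonneg {x : ℝ} (hx : 0 ≤ x) : Real.arctan x ≤ x := by
  by_cases h : Real.pi / 2 ≤ x
  · exact (Real.arctan_lt_pi_div_two x).le.trans h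
  · push Not at h
    rw [← Real.arctan_tan (by linarith [Real.pi_pos]) h]
    rcases hx.eq_or_lt with rfl | h0
    · simp
    · have h1 := Real.lt_tan h0 h
      have := Real.arctan_lt_pi_div_two x
      have h2 : Real.arctan x ≤ Real.arctan (Real.tan x) := Real.arctan_strictMono.monotone h1.le
      rw [Real.arctan_tan (by linarith [Real.pi_pos]) h] at h2 ⊢
      exact h2

lemma gammaDecay_le (t : ℝ) {v : ℝ} (hv : 0 < v) : gammaDecay t v ≤ t ^ 2 / v := by
  have h1 : t * Real.arctan (t / v) ≤ t ^ 2 / v := by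
    rcases le_total 0 t with ht | ht
    · have := arctan_le_self_of_nonneg (div_nonneg ht hv.le)
      calc t * Real.arctan (t / v) ≤ t * (t / v) := by gcongr
        _ = _ := by ring
    · have := arctan_le_self_of_nonneg (div_nonneg (neg_nonneg.2 ht) hv.le)
      have h2 : Real.arctan (t / v) = -Real.arctan (-t / v) := by
        rw [← Real.arctan_neg]; congr 1; ring
      rw [h2]
      calc t * -Real.arctan (-t / v) = (-t) * Real.arctan (-t / v) := by ring
        _ ≤ (-t) * (-t / v) := by gcongr; linarith
        _ = _ := by ring
  have h2 : 0 ≤ v / 2 * Real.log (1 + t ^ 2 / v ^ 2) := by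
    have := gammaLogTerm_nonneg t v
    unfold gammaLogTerm at this
    have := mul_nonneg hv.le this
    linarith
  unfold gammaDecay; linarith

lemma neg_le_gammaDecay (t : ℝ) {v : ℝ} (hv : 0 < v) : -(t ^ 2 / v) ≤ gammaDecay t v := by
  have h1 : 0 ≤ t * Real.arctan (t / v) := by
    rcases le_total 0 t with ht | ht
    · exact mul_nonneg ht (Real.arctan_nonneg.2 (div_nonneg ht hv.le))
    · refine mul_nonneg_of_nonpos_of_nonpos ht ?_
      have : Real.arctan (t / v) ≤ Real.arctan 0 :=
        Real.arctan_strictMono.monotone (div_nonpos_of_nonpos_of_nonneg ht hv.le)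
      simpa using this
  have h2 : v / 2 * Real.log (1 + t ^ 2 / v ^ 2) ≤ t ^ 2 / v := by
    have := Real.log_le_sub_one_of_pos (by positivity : 0 < 1 + t ^ 2 / v ^ 2)
    calc v / 2 * Real.log (1 + t ^ 2 / v ^ 2) ≤ v / 2 * (1 + t ^ 2 / v ^ 2 - 1) := by gcongr
      _ = (t ^ 2 / v) / 2 := by field_simp; ring
      _ ≤ _ := by have : 0 ≤ t ^ 2 / v := by positivity
                  linarith
  unfold gammaDecay; linarith

lemma sum_gammaLogTerm_bounds (t : ℝ) {σ : ℝ} (hσ : 0 < σ) (n : ℕ) :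
    gammaDecay t σ - gammaDecay t (σ + n) ≤ ∑ j ∈ Finset.range n, gammaLogTerm t (σ + j) ∧
    ∑ j ∈ Finset.range (n + 1), gammaLogTerm t (σ + j) ≤
      gammaLogTerm t σ + gammaDecay t σ - gammaDecay t (σ + n) := by
  induction n with
  | zero => simp
  | succ n ih =>
    have h := gammaDecay_step t (by positivity : 0 < σ + n)
    rw [Finset.sum_range_succ, Finset.sum_range_succ _ (n + 1)]
    push_cast at *
    rw [← add_assoc] at *
    constructor <;> linarith [ih.1, ih.2, h.1, h.2]

lemma tendsto_gammaDecay (t σ : ℝ) (hσ : 0 < σ) :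
    Tendsto (fun n : ℕ => gammaDecay t (σ + n)) atTop (𝓝 0) := by
  have h : Tendsto (fun n : ℕ => t ^ 2 / (σ + n)) atTop (𝓝 0) :=
    tendsto_const_nhds.div_atTop (tendsto_atTop_add_const_left _ _ tendsto_natCast_atTop_atTop)
  refine tendsto_of_tendsto_of_tendsto_of_le_of_le (by simpa using h.neg) h (fun n => ?_)
    (fun n => ?_)
  · exact neg_le_gammaDecay t (by positivity)
  · exact gammaDecay_le t (by positivity)

lemma gammaDecay_nonneg (t : ℝ) {σ : ℝ} (hσ : 0 < σ) : 0 ≤ gammaDecay t σ := by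
  refine le_of_tendsto' (tendsto_gammaDecay t σ hσ) (fun n => ?_)
  induction n with
  | zero => simp
  | succ n ih =>
    have h := gammaDecay_step t (by positivity : 0 < σ + n)
    have h2 := gammaLogTerm_nonneg t (σ + n + 1)
    push_cast; rw [← add_assoc]; linarith

lemma norm_eq_mul_exp_gammaLogTerm {s : ℂ} (hs : 0 < s.re) :
    ‖s‖ = s.re * Real.exp (gammaLogTerm s.im s.re) := by
  unfold gammaLogTerm
  have h : 0 < 1 + s.im ^ 2 / s.re ^ 2 := by positivity
  rw [← Real.log_sqrt h.le, Real.exp_log (Real.sqrt_pos.2 h), Complex.norm_eq_sqrt_sq_add_sq]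
  have h2 : s.re ^ 2 + s.im ^ 2 = s.re ^ 2 * (1 + s.im ^ 2 / s.re ^ 2) := by field_simp
  rw [h2, Real.sqrt_mul (by positivity), Real.sqrt_sq hs.le]

/-- In Euler's product the imaginary part of s affects only the moduli of the factors s + j, each of
which is its real part times exp of `gammaLogTerm`. -/
lemma norm_GammaSeq {s : ℂ} (hs : 0 < s.re) {n : ℕ} (hn : n ≠ 0) :
    ‖Complex.GammaSeq s n‖ = Real.GammaSeq s.re n *
      Real.exp (-∑ j ∈ Finset.range (n + 1), gammaLogTerm s.im (s.re + j)) := by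
  unfold Complex.GammaSeq Real.GammaSeq
  have h : ∀ j ∈ Finset.range (n + 1),
      ‖s + j‖ = (s.re + j) * Real.exp (gammaLogTerm s.im (s.re + j)) := by
    intro j _
    have := norm_eq_mul_exp_gammaLogTerm (s := s + j) (by simp; positivity)
    simpa using this
  rw [norm_div, norm_mul, norm_prod, Finset.prod_congr rfl h, Finset.prod_mul_distrib,
    ← Real.exp_sum, Real.exp_neg, Complex.norm_natCast_cpow_of_pos (Nat.pos_of_ne_zero hn)]
  simp only [Complex.norm_natCast]
  rw [← div_div, ← div_eq_mul_inv]

/-- Upper Stirling-type bound for `|Γ|` in terms of `Γ` on the real axis. -/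
theorem norm_Gamma_le {s : ℂ} (hs : 0 < s.re) :
    ‖Complex.Gamma s‖ ≤ Real.Gamma s.re * Real.exp (-gammaDecay s.im s.re) := by
  have h1 := (Complex.GammaSeq_tendsto_Gamma s).norm
  have h2 : Tendsto (fun n : ℕ => Real.GammaSeq s.re n *
      Real.exp (-(gammaDecay s.im s.re - gammaDecay s.im (s.re + 1 + n)))) atTop
      (𝓝 (Real.Gamma s.re * Real.exp (-gammaDecay s.im s.re))) := by
    have := (tendsto_gammaDecay s.im (s.re + 1) (by linarith)).const_sub (gammaDecay s.im s.re)
    rw [sub_zero] at this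
    exact (Real.GammaSeq_tendsto_Gamma _).mul ((Real.continuous_exp.tendsto _).comp this.neg)
  refine le_of_tendsto_of_tendsto h1 h2 ?_
  filter_upwards [eventually_ne_atTop 0] with n hn
  rw [norm_GammaSeq hs hn]
  have h3 := (sum_gammaLogTerm_bounds s.im hs (n + 1)).1
  have : 0 ≤ Real.GammaSeq s.re n := by
    unfold Real.GammaSeq
    have : 0 ≤ ∏ j ∈ Finset.range (n + 1), (s.re + j) :=
      Finset.prod_nonneg fun j _ => by positivity
    positivity
  gcongr
  push_cast at h3
  rwa [add_assoc, add_comm (1 : ℝ)]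

/-- Lower Stirling-type bound for `|Γ|` in terms of `Γ` on the real axis. -/
theorem le_norm_Gamma {s : ℂ} (hs : 0 < s.re) :
    Real.Gamma s.re * (s.re / ‖s‖) * Real.exp (-gammaDecay s.im s.re) ≤ ‖Complex.Gamma s‖ := by
  have h1 := (Complex.GammaSeq_tendsto_Gamma s).norm
  have h2 : Tendsto (fun n : ℕ => Real.GammaSeq s.re n *
      Real.exp (-(gammaLogTerm s.im s.re + gammaDecay s.im s.re - gammaDecay s.im (s.re + n))))
      atTop (𝓝 (Real.Gamma s.re *
        Real.exp (-(gammaLogTerm s.im s.re + gammaDecay s.im s.re)))) := by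
    have := (tendsto_gammaDecay s.im s.re hs).const_sub
      (gammaLogTerm s.im s.re + gammaDecay s.im s.re)
    rw [sub_zero] at this
    exact (Real.GammaSeq_tendsto_Gamma _).mul ((Real.continuous_exp.tendsto _).comp this.neg)
  -- The factor Re s/|s| in the lower bound is the j = 0 term of the sum, which the integral test
  -- leaves over.
  have h4 : s.re / ‖s‖ = Real.exp (-gammaLogTerm s.im s.re) := by
    rw [norm_eq_mul_exp_gammaLogTerm hs, Real.exp_neg, ← div_div, div_self hs.ne', one_div]
  rw [h4, mul_assoc, ← Real.exp_add, ← neg_add]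
  refine le_of_tendsto_of_tendsto h2 h1 ?_
  filter_upwards [eventually_ne_atTop 0] with n hn
  rw [norm_GammaSeq hs hn]
  have h3 := (sum_gammaLogTerm_bounds s.im hs n).2
  have : 0 ≤ Real.GammaSeq s.re n := by
    unfold Real.GammaSeq
    have : 0 ≤ ∏ j ∈ Finset.range (n + 1), (s.re + j) :=
      Finset.prod_nonneg fun j _ => by positivity
    positivity
  gcongr

/-- Stirling's sequence is antitone, so it is bounded by its first value e/√2. -/
lemma log_factorial_le {n : ℕ} (hn : n ≠ 0) :
    Real.log (n ! : ℝ) ≤ n * Real.log n - n + Real.log n + 1 := by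
  obtain ⟨m, rfl⟩ := Nat.exists_eq_succ_of_ne_zero hn
  have h := Stirling.stirlingSeq'_antitone (Nat.zero_le m)
  have h' : Real.log (Stirling.stirlingSeq (m + 1)) ≤ Real.log (Stirling.stirlingSeq 1) :=
    Real.log_le_log (Stirling.stirlingSeq'_pos m) h
  rw [Stirling.log_stirlingSeq_formula, Stirling.stirlingSeq_one,
    Real.log_div (Real.exp_ne_zero _) (by positivity), Real.log_exp,
    Real.log_sqrt (by norm_num), Real.log_div (by positivity) (Real.exp_ne_zero _),
    Real.log_exp, Real.log_mul (by norm_num) (by positivity)] at h'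
  have h0 : 0 ≤ Real.log ((m + 1 : ℕ) : ℝ) := Real.log_natCast_nonneg _
  simp only [Nat.succ_eq_add_one]
  nlinarith

lemma mul_log_sub_self_mono {a b : ℝ} (ha : 1 ≤ a) (hab : a ≤ b) :
    a * Real.log a - a ≤ b * Real.log b - b := by
  have hb : 0 < b := by linarith
  have h1 : Real.log (a / b) ≤ a / b - 1 := Real.log_le_sub_one_of_pos (by positivity)
  rw [Real.log_div (by positivity) (by positivity)] at h1
  have h2 : b * Real.log a - b * Real.log b ≤ a - b := by
    have := mul_le_mul_of_nonneg_left h1 hb.le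
    have h3 : b * (a / b - 1) = a - b := by field_simp
    linarith
  have h0 := Real.log_nonneg ha
  nlinarith

lemma mul_log_sub_self_step {x : ℝ} (hx : 2 ≤ x) :
    x * Real.log x - x - Real.log x ≤ (x - 1) * Real.log (x - 1) - (x - 1) := by
  have h1 : Real.log (x / (x - 1)) ≤ x / (x - 1) - 1 :=
    Real.log_le_sub_one_of_pos (div_pos (by linarith) (by linarith))
  have hx1 : 0 < x - 1 := by linarith
  rw [Real.log_div (by positivity) (by positivity)] at h1
  have := mul_le_mul_of_nonneg_left h1 hx1.le
  have h3 : (x - 1) * (x / (x - 1) - 1) = 1 := by field_simp; ring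
  nlinarith

/-- Stirling's approximation of `log Γ` on the real axis, with logarithmic error. -/
theorem abs_log_Gamma_sub_le {x : ℝ} (hx : 2 ≤ x) :
    |Real.log (Real.Gamma x) - (x * Real.log x - x)| ≤ 2 * Real.log x + 1 := by
  set n := ⌊x⌋₊ with hn
  have hn2 : 2 ≤ n := Nat.le_floor (by exact_mod_cast hx)
  have hnx : (n : ℝ) ≤ x := Nat.floor_le (by linarith)
  have hxn : x < n + 1 := Nat.lt_floor_add_one x
  have hn2' : (2 : ℝ) ≤ n := by exact_mod_cast hn2
  have hlx : 0 ≤ Real.log x := Real.log_nonneg (by linarith)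
  have hln : Real.log n ≤ Real.log x := Real.log_le_log (by linarith) hnx
  have hln0 : 0 ≤ Real.log n := Real.log_natCast_nonneg _
  have hmono := Real.Gamma_strictMonoOn_Ici.monotoneOn
  -- Monotonicity of Γ on [2, ∞) traps Γ(x) between (n-1)! and n! with n = ⌊x⌋. The rounding costs
  -- only multiples of log x, covered by the error term.
  have hG1 : Real.Gamma n ≤ Real.Gamma x := hmono hn2' hx hnx
  have hG2 : Real.Gamma x ≤ Real.Gamma (n + 1) :=
    hmono hx (show (2 : ℝ) ≤ n + 1 by linarith) hxn.le
  have e1 : Real.Gamma (n + 1) = n * Real.Gamma n := Real.Gamma_add_one (by linarith)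
  rw [Real.Gamma_nat_eq_factorial] at hG2 e1
  have p0 : 0 < Real.Gamma n := Real.Gamma_pos_of_pos (by linarith)
  have p1 : 0 < Real.Gamma x := Real.Gamma_pos_of_pos (by linarith)
  have l1 := Real.log_le_log p0 hG1
  have l2 := Real.log_le_log p1 hG2
  have l3 : Real.log (n ! : ℝ) = Real.log n + Real.log (Real.Gamma n) := by
    rw [e1, Real.log_mul (by linarith) p0.ne']
  have u := log_factorial_le (by lia : n ≠ 0)
  have l := Stirling.le_log_factorial_stirling (by lia : n ≠ 0)
  have lpi : 0 ≤ Real.log (2 * Real.pi) := Real.log_nonneg (by linarith [Real.pi_gt_three])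
  have m1 := mul_log_sub_self_mono (by linarith : (1 : ℝ) ≤ n) hnx
  have m2 := mul_log_sub_self_mono (by linarith : (1 : ℝ) ≤ x - 1) (by linarith : x - 1 ≤ n)
  have m3 := mul_log_sub_self_step hx
  rw [abs_le]
  constructor <;> linarith

/-! ### Growth, lower bound and log-convexity of ζ. -/

lemma hasDerivAt_ofReal_cpow' (c : ℂ) {x : ℝ} (hx : 0 < x) :
    HasDerivAt (fun y : ℝ => (y : ℂ) ^ c) (c * (x : ℂ) ^ (c - 1)) x := by
  have h := (hasDerivAt_id (x : ℂ)).cpow_const (c := c) (Or.inl (by simpa using hx))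
  simpa using h.comp_ofReal

/-- The general term of a series for `(s - 1) ζ(s) - 1` converging for `Re s > 0`. -/
noncomputable def zetaTerm (n : ℕ) (s : ℂ) : ℂ :=
  (s - 1) * ((n + 1 : ℝ) : ℂ) ^ (-s) - ((n + 1 : ℝ) : ℂ) ^ (1 - s) + ((n + 2 : ℝ) : ℂ) ^ (1 - s)

/-- With a = n + 1 the term equals (s - 1) ∫_a^{a+1} (a^{-s} - x^{-s}) dx, the error of replacing an
integral by a sum. Two applications of the mean value inequality gain the extra power of a that
gives convergence for all Re s > 0. -/
lemma norm_zetaTerm_le (n : ℕ) {s : ℂ} (hs : 0 < s.re) :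
    ‖zetaTerm n s‖ ≤ ‖s - 1‖ * ‖s‖ * (n + 1 : ℝ) ^ (-s.re - 1) := by
  set a : ℝ := n + 1 with ha
  have ha0 : 0 < a := by positivity
  have key : ∀ x ∈ Set.Icc a (a + 1),
      ‖(x : ℂ) ^ (-s) - (a : ℂ) ^ (-s)‖ ≤ ‖s‖ * a ^ (-s.re - 1) := by
    intro x hx
    have := (convex_Icc a (a + 1)).norm_image_sub_le_of_norm_hasDerivWithin_le
      (f := fun y : ℝ => (y : ℂ) ^ (-s)) (f' := fun y : ℝ => -s * (y : ℂ) ^ (-s - 1))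
      (C := ‖s‖ * a ^ (-s.re - 1))
      (fun y hy => (hasDerivAt_ofReal_cpow' (-s) (ha0.trans_le hy.1)).hasDerivWithinAt)
      (fun y hy => by
        rw [norm_mul, norm_neg, Complex.norm_cpow_eq_rpow_re_of_pos (ha0.trans_le hy.1)]
        simp only [Complex.sub_re, Complex.neg_re, Complex.one_re]
        exact mul_le_mul_of_nonneg_left
          (Real.rpow_le_rpow_of_nonpos ha0 hy.1 (by linarith)) (norm_nonneg _))
      (Set.left_mem_Icc.2 (by linarith)) hx
    refine this.trans ?_
    have h1 : ‖x - a‖ ≤ 1 := by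
      rw [Real.norm_eq_abs, abs_le]; constructor <;> linarith [hx.1, hx.2]
    exact mul_le_of_le_one_right (by positivity) h1
  have := (convex_Icc a (a + 1)).norm_image_sub_le_of_norm_hasDerivWithin_le
      (f := fun y : ℝ => (s - 1) * (a : ℂ) ^ (-s) * ((y : ℂ) - a) + (y : ℂ) ^ (1 - s))
      (f' := fun y : ℝ => (s - 1) * (a : ℂ) ^ (-s) + (1 - s) * (y : ℂ) ^ (1 - s - 1))
      (C := ‖s - 1‖ * (‖s‖ * a ^ (-s.re - 1)))
      (fun y hy => by
        have h1 := hasDerivAt_ofReal_cpow' (1 - s) (ha0.trans_le hy.1)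
        have h2 : HasDerivAt (fun y : ℝ => (y : ℂ) - a) 1 y :=
          ((hasDerivAt_id (y : ℂ)).sub_const _).comp_ofReal
        have h3 := (h2.const_mul ((s - 1) * (a : ℂ) ^ (-s))).add h1
        rw [mul_one] at h3
        exact h3.hasDerivWithinAt)
      (fun y hy => by
        have : (s - 1) * (a : ℂ) ^ (-s) + (1 - s) * (y : ℂ) ^ (1 - s - 1) =
            -((s - 1) * ((y : ℂ) ^ (-s) - (a : ℂ) ^ (-s))) := by
          rw [show 1 - s - 1 = -s by ring]; ring
        rw [this, norm_neg, norm_mul]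
        exact mul_le_mul_of_nonneg_left (key y hy) (norm_nonneg _))
      (Set.left_mem_Icc.2 (by linarith)) (Set.right_mem_Icc.2 (by linarith))
  have e : a + 1 = n + 2 := by rw [ha]; ring
  rw [add_sub_cancel_left, norm_one, mul_one, ← mul_assoc, e] at this
  refine le_trans (le_of_eq ?_) this
  unfold zetaTerm
  congr 1
  have : ((n + 2 : ℝ) : ℂ) - a = 1 := by rw [← e]; push_cast; ring
  rw [this]
  ring

lemma summable_natAdd_rpow {p : ℝ} (hp : p < -1) :
    Summable (fun n : ℕ => (n + 1 : ℝ) ^ p) := by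
  have := (summable_nat_add_iff 1).2 (Real.summable_nat_rpow.2 hp)
  simpa using this

/-- In the half plane of absolute convergence the series splits into (s - 1)ζ(s) and a telescoping
sum with value -1. -/
lemma tsum_zetaTerm {s : ℂ} (hs : 1 < s.re) :
    1 + ∑' n, zetaTerm n s = riemannZeta₁ s := by
  have hs1 : s ≠ 1 := by rintro rfl; simp at hs
  have hz : HasSum (fun n : ℕ => ((n + 1 : ℝ) : ℂ) ^ (-s)) (riemannZeta s) := by
    rw [zeta_eq_tsum_one_div_nat_add_one_cpow hs]
    have : Summable (fun n : ℕ => 1 / (n + 1 : ℂ) ^ s) := by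
      have := (summable_nat_add_iff 1).2 (Complex.summable_one_div_nat_cpow.2 hs)
      simpa using this
    convert! this.hasSum using 2 with n
    rw [Complex.cpow_neg]; push_cast; simp
  have ht : HasSum (fun n : ℕ => ((n + 2 : ℝ) : ℂ) ^ (1 - s) - ((n + 1 : ℝ) : ℂ) ^ (1 - s))
      (-1) := by
    have hsum : Summable (fun n : ℕ =>
        ((n + 2 : ℝ) : ℂ) ^ (1 - s) - ((n + 1 : ℝ) : ℂ) ^ (1 - s)) := by
      have h1 : Summable (fun n => zetaTerm n s) :=
        Summable.of_norm_bounded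
          ((summable_natAdd_rpow (by linarith : -s.re - 1 < -1)).mul_left (‖s - 1‖ * ‖s‖))
          (fun n => norm_zetaTerm_le n (by linarith))
      refine (h1.sub (hz.summable.mul_left (s - 1))).congr (fun n => ?_)
      unfold zetaTerm; ring
    have hlim : Tendsto (fun N : ℕ => ((N + 1 : ℝ) : ℂ) ^ (1 - s) - 1) atTop (𝓝 (0 - 1)) := by
      refine Tendsto.sub_const ?_ 1
      rw [tendsto_zero_iff_norm_tendsto_zero]
      have h2 : Tendsto (fun N : ℕ => ((N : ℝ) + 1) ^ (-(s.re - 1))) atTop (𝓝 0) :=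
        (tendsto_rpow_neg_atTop (by linarith : 0 < s.re - 1)).comp
          (tendsto_atTop_add_const_right _ _ tendsto_natCast_atTop_atTop)
      refine h2.congr (fun N => ?_)
      rw [Complex.norm_cpow_eq_rpow_re_of_pos (by positivity)]
      simp
    have h3 := hsum.hasSum.tendsto_sum_nat
    have h4 : ∀ N : ℕ, ∑ n ∈ Finset.range N,
        (((n + 2 : ℝ) : ℂ) ^ (1 - s) - ((n + 1 : ℝ) : ℂ) ^ (1 - s)) =
        ((N + 1 : ℝ) : ℂ) ^ (1 - s) - 1 := by
      intro N
      have := Finset.sum_range_sub (fun n : ℕ => ((n + 1 : ℝ) : ℂ) ^ (1 - s)) N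
      simp only [Nat.cast_zero, zero_add, Complex.ofReal_one, Complex.one_cpow] at this
      rw [← this]
      refine Finset.sum_congr rfl (fun n _ => ?_)
      push_cast
      rw [show (n : ℂ) + 1 + 1 = n + 2 by ring]
    simp_rw [h4] at h3
    have := tendsto_nhds_unique h3 hlim
    rw [zero_sub] at this
    rw [← this]
    exact hsum.hasSum
  have h5 := (hz.mul_left (s - 1)).add ht
  have h6 : HasSum (fun n => zetaTerm n s) ((s - 1) * riemannZeta s + -1) := by
    convert! h5 using 2 with n
    unfold zetaTerm; ring
  rw [h6.tsum_eq, riemannZeta_eq_inv_sub_mul hs1]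
  have : s - 1 ≠ 0 := sub_ne_zero.2 hs1
  field_simp
  ring

/-- Identity theorem, starting from a neighbourhood of 2. The half plane is cut by a ball containing
s and 2, so that the factors |s - 1||s| have a uniform bound and the series a summable majorant. -/
lemma riemannZeta₁_eq_tsum {s : ℂ} (hs : 1 / 4 < s.re) :
    riemannZeta₁ s = 1 + ∑' n, zetaTerm n s := by
  set R : ℝ := ‖s‖ + 3 with hR
  set U : Set ℂ := {w | 1 / 4 < w.re} ∩ Metric.ball 0 R with hU
  have hUo : IsOpen U := (isOpen_lt continuous_const Complex.continuous_re).inter Metric.isOpen_ball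
  have hUc : Convex ℝ U := (convex_halfSpace_re_gt (1 / 4)).inter (convex_ball 0 R)
  have hsU : s ∈ U := ⟨hs, by simp [hR]⟩
  have h2U : (2 : ℂ) ∈ U := ⟨by norm_num, by simp [hR]; linarith [norm_nonneg s]⟩
  have hd : DifferentiableOn ℂ (fun w => ∑' n, zetaTerm n w) U := by
    refine Complex.differentiableOn_tsum_of_summable_norm
      (u := fun n : ℕ => ((R + 1) * R) * (n + 1 : ℝ) ^ (-(5 / 4) : ℝ))
      ((summable_natAdd_rpow (by norm_num)).mul_left _) (fun n => ?_) hUo (fun n w hw => ?_)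
    · intro w _
      unfold zetaTerm
      have h1 : ((n + 1 : ℝ) : ℂ) ≠ 0 := by exact_mod_cast (by positivity : (n + 1 : ℝ) ≠ 0)
      have h2 : ((n + 2 : ℝ) : ℂ) ≠ 0 := by exact_mod_cast (by positivity : (n + 2 : ℝ) ≠ 0)
      refine DifferentiableAt.differentiableWithinAt ?_
      refine ((((differentiableAt_id).sub_const _).mul ?_).sub ?_).add ?_
      · exact (differentiableAt_id.neg).const_cpow (Or.inl h1)
      · exact (differentiableAt_id.const_sub _).const_cpow (Or.inl h1)
      · exact (differentiableAt_id.const_sub _).const_cpow (Or.inl h2)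
    · have hw1 : 1 / 4 < w.re := hw.1
      have hw2 : ‖w‖ < R := by simpa using hw.2
      refine (norm_zetaTerm_le n (by linarith)).trans ?_
      have : ‖w - 1‖ ≤ R + 1 := (norm_sub_le _ _).trans (by simp; linarith)
      have h3 : (n + 1 : ℝ) ^ (-w.re - 1) ≤ (n + 1 : ℝ) ^ (-(5 / 4) : ℝ) :=
        Real.rpow_le_rpow_of_exponent_le (by linarith [n.cast_nonneg (α := ℝ)]) (by linarith)
      have : 0 ≤ R := by positivity
      gcongr
  have h1 : AnalyticOnNhd ℂ riemannZeta₁ U :=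
    fun w _ => (differentiable_riemannZeta₁.analyticAt w)
  have h2 : AnalyticOnNhd ℂ (fun w => 1 + ∑' n, zetaTerm n w) U :=
    DifferentiableOn.analyticOnNhd ((differentiableOn_const _).add hd) hUo
  refine h1.eqOn_of_preconnected_of_eventuallyEq h2 hUc.isPreconnected h2U ?_ hsU
  have : ∀ᶠ w : ℂ in 𝓝 2, 1 < w.re :=
    (isOpen_lt continuous_const Complex.continuous_re).mem_nhds (by simp)
  filter_upwards [this] with w hw
  exact (tsum_zetaTerm hw).symm

/-- Polynomial growth of `(s - 1) ζ(s)` in `Re s > 1/4`. -/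
theorem exists_norm_riemannZeta₁_le :
    ∃ C : ℝ, 1 ≤ C ∧ ∀ s : ℂ, 1 / 4 < s.re → ‖riemannZeta₁ s‖ ≤ C * (1 + ‖s‖) ^ 2 := by
  have hsum := summable_natAdd_rpow (by norm_num : (-(5 / 4) : ℝ) < -1)
  set S := ∑' n : ℕ, (n + 1 : ℝ) ^ (-(5 / 4) : ℝ) with hS
  have hS0 : 0 ≤ S := tsum_nonneg fun n => by positivity
  refine ⟨1 + S, by linarith, fun s hs => ?_⟩
  rw [riemannZeta₁_eq_tsum hs]
  have h1 : ‖∑' n, zetaTerm n s‖ ≤ (‖s - 1‖ * ‖s‖) * S := by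
    refine tsum_of_norm_bounded (hsum.hasSum.mul_left _) (fun n => ?_)
    refine (norm_zetaTerm_le n (by linarith)).trans ?_
    have : (n + 1 : ℝ) ^ (-s.re - 1) ≤ (n + 1 : ℝ) ^ (-(5 / 4) : ℝ) :=
      Real.rpow_le_rpow_of_exponent_le (by linarith [n.cast_nonneg (α := ℝ)]) (by linarith)
    gcongr
  have h2 : ‖s - 1‖ ≤ 1 + ‖s‖ := (norm_sub_le _ _).trans (by simp [add_comm])
  have h3 := norm_nonneg s
  calc ‖1 + ∑' n, zetaTerm n s‖ ≤ 1 + (‖s - 1‖ * ‖s‖) * S := by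
        refine (norm_add_le _ _).trans ?_
        simpa using h1
    _ ≤ 1 * (1 + ‖s‖) ^ 2 + ((1 + ‖s‖) * (1 + ‖s‖)) * S := by
        gcongr
        · nlinarith
        · linarith
    _ = _ := by ring

/-- The Dirichlet series of `ζ` on the real axis. -/
noncomputable def zetaReal (x : ℝ) : ℝ := ∑' n : ℕ, (n + 1 : ℝ) ^ (-x)

lemma summable_zetaReal {x : ℝ} (hx : 1 < x) : Summable fun n : ℕ => (n + 1 : ℝ) ^ (-x) :=
  summable_natAdd_rpow (by linarith)

lemma riemannZeta_eq_tsum {s : ℂ} (hs : 1 < s.re) :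
    riemannZeta s = ∑' n : ℕ, ((n + 1 : ℝ) : ℂ) ^ (-s) := by
  rw [zeta_eq_tsum_one_div_nat_add_one_cpow hs]
  refine tsum_congr (fun n => ?_)
  rw [Complex.cpow_neg]; push_cast; simp

lemma riemannZeta_ofReal {x : ℝ} (hx : 1 < x) : riemannZeta x = zetaReal x := by
  rw [riemannZeta_eq_tsum (by simpa using hx), zetaReal, Complex.ofReal_tsum]
  refine tsum_congr (fun n => ?_)
  rw [Complex.ofReal_cpow (by positivity)]; simp

lemma one_le_zetaReal {x : ℝ} (hx : 1 < x) : 1 ≤ zetaReal x := by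
  have := (summable_zetaReal hx).le_tsum 0 (fun n _ => by positivity)
  simpa [zetaReal] using this

lemma zetaReal_two_lt : zetaReal 2 < 7 / 4 := by
  have h : (zetaReal 2 : ℂ) = Real.pi ^ 2 / 6 := by
    rw [← riemannZeta_ofReal (by norm_num)]
    have := riemannZeta_two
    simpa using this
  have h2 : zetaReal 2 = Real.pi ^ 2 / 6 := by exact_mod_cast h
  rw [h2]
  nlinarith [Real.pi_lt_d2, Real.pi_pos]

/-- The terms after the first sum to at most ζ(2) - 1 < 3/4 in modulus. -/
lemma quarter_le_norm_riemannZeta {s : ℂ} (hs : 2 ≤ s.re) : 1 / 4 ≤ ‖riemannZeta s‖ := by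
  have hs1 : 1 < s.re := by linarith
  have hsum : Summable (fun n : ℕ => ((n + 1 : ℝ) : ℂ) ^ (-s)) := by
    refine Summable.of_norm_bounded (summable_zetaReal hs1) (fun n => ?_)
    rw [Complex.norm_cpow_eq_rpow_re_of_pos (by positivity)]
    simp
  have h2 := summable_zetaReal (by norm_num : (1 : ℝ) < 2)
  have e1 := hsum.tsum_eq_zero_add
  have e2 := h2.tsum_eq_zero_add
  rw [← riemannZeta_eq_tsum hs1] at e1
  change zetaReal 2 = _ at e2
  have h3 : ‖∑' n : ℕ, (((n + 1 : ℕ) + 1 : ℝ) : ℂ) ^ (-s)‖ ≤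
      ∑' n : ℕ, (((n + 1 : ℕ) : ℝ) + 1) ^ (-2 : ℝ) := by
    refine tsum_of_norm_bounded ((summable_nat_add_iff 1).2 h2).hasSum (fun n => ?_)
    rw [Complex.norm_cpow_eq_rpow_re_of_pos (by positivity)]
    refine Real.rpow_le_rpow_of_exponent_le ?_ (by simpa using hs)
    push_cast
    linarith [n.cast_nonneg (α := ℝ)]
  simp only [Nat.cast_zero, zero_add, Complex.ofReal_one, Complex.one_cpow, Real.one_rpow]
    at e1 e2
  have h4 := zetaReal_two_lt
  rw [e1]
  have h5 := norm_sub_le_norm_add (1 : ℂ) (∑' n : ℕ, (((n + 1 : ℕ) + 1 : ℝ) : ℂ) ^ (-s))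
  rw [norm_one] at h5
  linarith

/-- `ζ` is logarithmically convex on `(1, ∞)`. -/
theorem convexOn_log_zetaReal : ConvexOn ℝ (Set.Ioi 1) (fun x => Real.log (zetaReal x)) := by
  refine convexOn_iff_forall_pos.mpr ⟨convex_Ioi _, fun x hx y hy a b ha hb hab => ?_⟩
  have hx : 1 < x := hx
  have hy : 1 < y := hy
  simp only [smul_eq_mul]
  have hxy : 1 < a * x + b * y := by nlinarith
  have hA := one_le_zetaReal hx
  have hB := one_le_zetaReal hy
  have hA0 : 0 < zetaReal x := by linarith
  have hB0 : 0 < zetaReal y := by linarith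
  have key : zetaReal (a * x + b * y) ≤ zetaReal x ^ a * zetaReal y ^ b := by
    -- This is Hölder's inequality, proved by weighted AM–GM on terms normalised to have sum 1.
    have h1 : ∀ n : ℕ, (n + 1 : ℝ) ^ (-(a * x + b * y)) ≤ zetaReal x ^ a * zetaReal y ^ b *
        (a * ((n + 1 : ℝ) ^ (-x) / zetaReal x) + b * ((n + 1 : ℝ) ^ (-y) / zetaReal y)) := by
      intro n
      have hn : (0 : ℝ) < n + 1 := by positivity
      have := Real.geom_mean_le_arith_mean2_weighted ha.le hb.le
        (p₁ := (n + 1 : ℝ) ^ (-x) / zetaReal x) (p₂ := (n + 1 : ℝ) ^ (-y) / zetaReal y)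
        (by positivity) (by positivity) hab
      rw [Real.div_rpow (by positivity) hA0.le, Real.div_rpow (by positivity) hB0.le,
        ← Real.rpow_mul hn.le, ← Real.rpow_mul hn.le] at this
      refine le_trans (le_of_eq ?_) (mul_le_mul_of_nonneg_left this (by positivity))
      rw [show -(a * x + b * y) = -x * a + -y * b by ring, Real.rpow_add hn]
      have : zetaReal x ^ a ≠ 0 := by positivity
      have : zetaReal y ^ b ≠ 0 := by positivity
      field_simp
    have h2 := (((summable_zetaReal hx).hasSum.div_const (zetaReal x)).mul_left a).add
      (((summable_zetaReal hy).hasSum.div_const (zetaReal y)).mul_left b)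
    have h3 := h2.mul_left (zetaReal x ^ a * zetaReal y ^ b)
    have h4 := hasSum_le h1 (summable_zetaReal hxy).hasSum h3
    change zetaReal (a * x + b * y) ≤ zetaReal x ^ a * zetaReal y ^ b *
      (a * (zetaReal x / zetaReal x) + b * (zetaReal y / zetaReal y)) at h4
    rwa [div_self hA0.ne', div_self hB0.ne', mul_one, mul_one, hab, mul_one] at h4
  have h0 := one_le_zetaReal hxy
  have := Real.log_le_log (by linarith) key
  rwa [Real.log_mul (by positivity) (by positivity), Real.log_rpow hA0, Real.log_rpow hB0] at this

/-! ### Factorisation of f and its values on the real half-line. -/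

lemma f_neg (w : ℂ) : f (-w) = f w := by
  unfold f xi
  rw [show (1 / 2 + -w : ℂ) = 1 - (1 / 2 + w) by ring, completedRiemannZeta₀_one_sub]
  ring

lemma differentiable_f : Differentiable ℂ f := by
  unfold f
  exact differentiable_xi.comp (by fun_prop)

/-- The factor s/2 is absorbed into Γ, and s - 1 into ζ. The resulting product has no removable
singularity left at s = 1. -/
lemma f_eq {w : ℂ} (hw : -1 / 2 < w.re) :
    f w = (Real.pi : ℂ) ^ (-(1 / 2 + w) / 2) * Complex.Gamma (5 / 4 + w / 2) *
      riemannZeta₁ (1 / 2 + w) := by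
  unfold f
  set s : ℂ := 1 / 2 + w with hs
  have hsre : 0 < s.re := by simp [hs]; linarith
  have hs0 : s ≠ 0 := by intro h; rw [h] at hsre; simp at hsre
  have hG : Complex.Gamma (5 / 4 + w / 2) = s / 2 * Complex.Gamma (s / 2) := by
    rw [← Complex.Gamma_add_one _ (div_ne_zero hs0 two_ne_zero)]
    congr 1
    rw [hs]; ring
  rw [hG]
  by_cases h1 : s = 1
  · rw [h1]
    have e : Complex.Gamma (1 / 2) = (Real.pi : ℂ) ^ (1 / 2 : ℂ) := Complex.Gamma_one_half_eq
    rw [e, riemannZeta₁_one]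
    unfold xi
    have hpi : (Real.pi : ℂ) ≠ 0 := by exact_mod_cast Real.pi_ne_zero
    have : (Real.pi : ℂ) ^ (-1 / 2 : ℂ) * (Real.pi : ℂ) ^ (1 / 2 : ℂ) = 1 := by
      rw [← Complex.cpow_add _ _ hpi]; norm_num
    linear_combination (-1 / 2) * this
  · rw [xi_eq hs0 h1, riemannZeta_eq_inv_sub_mul h1]
    · have : s - 1 ≠ 0 := sub_ne_zero.2 h1
      field_simp
    · intro m h
      have : (s / 2).re = (-(m : ℂ)).re := by rw [h]
      simp at this
      linarith [m.cast_nonneg (α := ℝ)]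

lemma riemannZeta₁_eq_mul {s : ℂ} (hs : s ≠ 1) : riemannZeta₁ s = (s - 1) * riemannZeta s := by
  rw [riemannZeta_eq_inv_sub_mul hs, mul_inv_cancel_left₀ (sub_ne_zero.2 hs)]

lemma norm_f_eq {w : ℂ} (hw : -1 / 2 < w.re) :
    ‖f w‖ = Real.pi ^ (-(1 / 2 + w.re) / 2) * ‖Complex.Gamma (5 / 4 + w / 2)‖ *
      ‖riemannZeta₁ (1 / 2 + w)‖ := by
  rw [f_eq hw, norm_mul, norm_mul, Complex.norm_cpow_eq_rpow_re_of_pos Real.pi_pos]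
  congr 3
  simp

/-- Growth of `f` in the right half plane. -/
theorem exists_norm_f_le : ∃ C : ℝ, 1 ≤ C ∧ ∀ w : ℂ, 0 ≤ w.re →
    ‖f w‖ ≤ C * (1 + ‖w‖) ^ 2 * (Real.Gamma (5 / 4 + w.re / 2) *
      Real.exp (-gammaDecay (w.im / 2) (5 / 4 + w.re / 2))) := by
  obtain ⟨C, hC1, hC⟩ := exists_norm_riemannZeta₁_le
  refine ⟨4 * C, by linarith, fun w hw => ?_⟩
  rw [norm_f_eq (by linarith)]
  have h1 := norm_Gamma_le (s := 5 / 4 + w / 2) (by simp; linarith)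
  have h2 := hC (1 / 2 + w) (by simp; linarith)
  have h3 : ‖(1 / 2 + w : ℂ)‖ ≤ 1 / 2 + ‖w‖ := by
    refine (norm_add_le _ _).trans ?_
    simp
  have e1 : (5 / 4 + w / 2 : ℂ).re = 5 / 4 + w.re / 2 := by simp
  have e2 : (5 / 4 + w / 2 : ℂ).im = w.im / 2 := by simp
  rw [e1, e2] at h1
  have h4 : Real.pi ^ (-(1 / 2 + w.re) / 2) ≤ 1 :=
    Real.rpow_le_one_of_one_le_of_nonpos (by linarith [Real.pi_gt_three]) (by linarith)
  have h5 : C * (1 + ‖(1 / 2 + w : ℂ)‖) ^ 2 ≤ 4 * C * (1 + ‖w‖) ^ 2 := by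
    have : (1 + ‖(1 / 2 + w : ℂ)‖) ^ 2 ≤ (2 * (1 + ‖w‖)) ^ 2 := by
      gcongr; linarith [norm_nonneg w]
    nlinarith
  have hG := Real.Gamma_pos_of_pos (by linarith : 0 < 5 / 4 + w.re / 2)
  calc _ ≤ 1 * (Real.Gamma (5 / 4 + w.re / 2) *
        Real.exp (-gammaDecay (w.im / 2) (5 / 4 + w.re / 2))) * (4 * C * (1 + ‖w‖) ^ 2) := by
        gcongr
        exact h2.trans h5
    _ = _ := by ring

/-- `log` of the completed zeta function at `1/2 + x`. -/
noncomputable def logLam (x : ℝ) : ℝ :=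
  -((1 / 2 + x) / 2) * Real.log Real.pi + Real.log (Real.Gamma (1 / 4 + x / 2)) +
    Real.log (zetaReal (1 / 2 + x))

/-- The restriction of `f` to the half-line `x > 1/2`. -/
noncomputable def fReal (x : ℝ) : ℝ := (x ^ 2 - 1 / 4) / 2 * Real.exp (logLam x)

lemma f_ofReal {x : ℝ} (hx : 1 / 2 < x) : f x = fReal x := by
  rw [f_eq (by simp; linarith)]
  have h1 : (1 / 2 + x : ℂ) ≠ 1 := by
    intro h
    have : 1 / 2 + x = 1 := by exact_mod_cast (by push_cast; exact h : ((1 / 2 + x : ℝ) : ℂ) = (1 : ℝ))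
    linarith
  have h2 : riemannZeta₁ (1 / 2 + x) = ((x - 1 / 2 : ℝ) : ℂ) * zetaReal (1 / 2 + x) := by
    rw [← riemannZeta_ofReal (by linarith)]
    push_cast
    rw [riemannZeta₁_eq_mul h1]
    ring
  have h3 : Complex.Gamma (5 / 4 + x / 2) = ((1 / 4 + x / 2) * Real.Gamma (1 / 4 + x / 2) : ℝ) := by
    rw [← Real.Gamma_add_one (by linarith), ← Complex.Gamma_ofReal]
    congr 1; push_cast; ring
  have h4 : (Real.pi : ℂ) ^ (-(1 / 2 + x) / 2 : ℂ) = (Real.pi ^ (-(1 / 2 + x) / 2) : ℝ) := by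
    rw [Complex.ofReal_cpow Real.pi_pos.le]; push_cast; rfl
  rw [h2, h3, h4]
  unfold fReal logLam
  have hz := one_le_zetaReal (by linarith : 1 < 1 / 2 + x)
  rw [Real.exp_add, Real.exp_add, Real.exp_log (Real.Gamma_pos_of_pos (by linarith)),
    Real.exp_log (by linarith), Real.rpow_def_of_pos Real.pi_pos]
  norm_cast
  rw [show Real.log Real.pi * (-(1 / 2 + x) / 2) = -((1 / 2 + x) / 2) * Real.log Real.pi by ring]
  ring

lemma fReal_pos {x : ℝ} (hx : 1 / 2 < x) : 0 < fReal x := by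
  unfold fReal
  have : 0 < x ^ 2 - 1 / 4 := by nlinarith
  positivity

lemma norm_f_ofReal {x : ℝ} (hx : 1 / 2 < x) : ‖f x‖ = fReal x := by
  rw [f_ofReal hx, Complex.norm_real, Real.norm_of_nonneg (fReal_pos hx).le]

lemma f_ne_zero {w : ℂ} (hw : 1 / 2 ≤ w.re) : f w ≠ 0 := by
  rw [f_eq (by linarith)]
  refine mul_ne_zero (mul_ne_zero ?_ ?_) ?_
  · rw [Ne, Complex.cpow_eq_zero_iff]
    exact fun h => Complex.ofReal_ne_zero.mpr Real.pi_ne_zero h.1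
  · exact Complex.Gamma_ne_zero_of_re_pos (by simp; linarith)
  · by_cases h1 : 1 / 2 + w = 1
    · rw [h1]; simp
    · have := riemannZeta_ne_zero_of_one_le_re (s := 1 / 2 + w) (by simp; linarith)
      rw [riemannZeta_eq_inv_sub_mul h1] at this
      exact right_ne_zero_of_mul this

/-- Affine plus log Γ plus log ζ. The polynomial factor (x² - 1/4)/2 of f is left out because the
convexity argument does not cover its logarithm; its contribution is added back explicitly later. -/
lemma convexOn_logLam : ConvexOn ℝ (Set.Ioi (1 / 2)) logLam := by
  have h1 : ConvexOn ℝ (Set.Ioi (1 / 2 : ℝ)) (fun x : ℝ => -((1 / 2 + x) / 2) * Real.log Real.pi) := by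
    refine ⟨convex_Ioi _, fun x _ y _ a b _ _ hab => le_of_eq ?_⟩
    simp only [smul_eq_mul]
    have : b = 1 - a := by linarith
    subst this; ring
  have h2 : ConvexOn ℝ (Set.Ioi (1 / 2 : ℝ))
      (fun x : ℝ => Real.log (Real.Gamma (1 / 4 + x / 2))) := by
    refine ⟨convex_Ioi _, fun x hx y hy a b ha hb hab => ?_⟩
    have hx : 1 / 2 < x := hx
    have hy : 1 / 2 < y := hy
    have := Real.convexOn_log_Gamma.2 (show 1 / 4 + x / 2 ∈ Set.Ioi (0 : ℝ) from by
      simp; linarith) (show 1 / 4 + y / 2 ∈ Set.Ioi (0 : ℝ) from by simp; linarith) ha hb hab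
    simp only [smul_eq_mul, Function.comp_apply] at this ⊢
    convert! this using 3
    have : b = 1 - a := by linarith
    subst this; ring
  have h3 : ConvexOn ℝ (Set.Ioi (1 / 2 : ℝ)) (fun x : ℝ => Real.log (zetaReal (1 / 2 + x))) := by
    refine ⟨convex_Ioi _, fun x hx y hy a b ha hb hab => ?_⟩
    have hx : 1 / 2 < x := hx
    have hy : 1 / 2 < y := hy
    have := convexOn_log_zetaReal.2 (show 1 / 2 + x ∈ Set.Ioi (1 : ℝ) from by
      simp; linarith) (show 1 / 2 + y ∈ Set.Ioi (1 : ℝ) from by simp; linarith) ha hb hab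
    simp only [smul_eq_mul] at this ⊢
    convert! this using 3
    have : b = 1 - a := by linarith
    subst this; ring
  exact (h1.add h2).add h3

/-! ### Asymptotics of log|f| along rays. -/

lemma tendsto_log_div_atTop : Tendsto (fun x : ℝ => Real.log x / x) atTop (𝓝 0) := by
  simpa using Real.isLittleO_log_id_atTop.tendsto_div_nhds_zero

lemma tendsto_const_div_atTop (c : ℝ) : Tendsto (fun x : ℝ => c / x) atTop (𝓝 0) :=
  tendsto_const_nhds.div_atTop tendsto_id

/-- Along the ray |(s - 1)ζ(s)| eventually lies between 1/4 and a³, so its logarithm is O(log a). -/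
lemma tendsto_zeta_part {z : ℂ} (hz : 0 < z.re) :
    Tendsto (fun a : ℝ => Real.log ‖riemannZeta₁ (1 / 2 + a * z)‖ / a) atTop (𝓝 0) := by
  obtain ⟨C, hC1, hC⟩ := exists_norm_riemannZeta₁_le
  have hre : ∀ a : ℝ, (1 / 2 + a * z : ℂ).re = 1 / 2 + a * z.re := by intro a; simp
  have hlow : ∀ᶠ a : ℝ in atTop, 1 / 4 ≤ ‖riemannZeta₁ (1 / 2 + a * z)‖ := by
    filter_upwards [eventually_ge_atTop (2 / z.re)] with a ha
    rw [div_le_iff₀ hz] at ha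
    have h2 : 2 ≤ (1 / 2 + a * z : ℂ).re := by rw [hre]; linarith
    have h3 := quarter_le_norm_riemannZeta h2
    have h1 : (1 / 2 + a * z : ℂ) ≠ 1 := by
      intro h; rw [h] at h2; norm_num at h2
    have h4 : riemannZeta₁ (1 / 2 + a * z) =
        (1 / 2 + a * z - 1) * riemannZeta (1 / 2 + a * z) := riemannZeta₁_eq_mul h1
    rw [h4, norm_mul]
    have h5 : 1 ≤ ‖(1 / 2 + a * z - 1 : ℂ)‖ := by
      refine le_trans ?_ (Complex.re_le_norm _)
      rw [Complex.sub_re, Complex.one_re]; linarith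
    nlinarith
  have hup : ∀ᶠ a : ℝ in atTop, ‖riemannZeta₁ (1 / 2 + a * z)‖ ≤ a ^ 3 := by
    filter_upwards [eventually_ge_atTop (C * (2 + ‖z‖) ^ 2), eventually_ge_atTop 1] with a ha ha1
    refine (hC _ (by rw [hre]; nlinarith)).trans ?_
    have h1 : 1 + ‖(1 / 2 + a * z : ℂ)‖ ≤ (2 + ‖z‖) * a := by
      have := norm_add_le (1 / 2 : ℂ) (a * z)
      rw [norm_mul, Complex.norm_real, Real.norm_of_nonneg (by linarith)] at this
      have h2 : ‖(1 / 2 : ℂ)‖ = 1 / 2 := by norm_num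
      linarith
    calc C * (1 + ‖(1 / 2 + a * z : ℂ)‖) ^ 2 ≤ C * ((2 + ‖z‖) * a) ^ 2 := by gcongr
      _ = C * (2 + ‖z‖) ^ 2 * a ^ 2 := by ring
      _ ≤ a * a ^ 2 := by gcongr
      _ = a ^ 3 := by ring
  have t1 := tendsto_const_div_atTop (Real.log (1 / 4))
  have t2 : Tendsto (fun x : ℝ => 3 * (Real.log x / x)) atTop (𝓝 0) := by
    simpa using tendsto_log_div_atTop.const_mul 3
  refine tendsto_of_tendsto_of_tendsto_of_le_of_le' t1 t2 ?_ ?_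
  · filter_upwards [hlow, eventually_gt_atTop 0] with a h1 ha
    gcongr
  · filter_upwards [hlow, hup, eventually_gt_atTop 0] with a h1 h2 ha
    rw [← mul_div_assoc]
    gcongr
    have := Real.log_le_log (by linarith) h2
    rwa [Real.log_pow] at this

/-- `gammaDecay` is homogeneous of degree one. Dividing by a therefore replaces the argument 5/4 +
ax/2 by q(a), which tends to x/2, and continuity gives the limit. The upper and lower bounds for |Γ|
differ by one `gammaLogTerm`, which is bounded and vanishes after division by a. -/
lemma tendsto_Gamma_part {z : ℂ} (hz : 0 < z.re) :
    Tendsto (fun a : ℝ => Real.log ‖Complex.Gamma (5 / 4 + a * z / 2)‖ / a -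
      z.re / 2 * Real.log a) atTop
      (𝓝 (z.re / 2 * Real.log (z.re / 2) - z.re / 2 - gammaDecay (z.im / 2) (z.re / 2))) := by
  set x := z.re with hx
  set Y := z.im with hY
  set q : ℝ → ℝ := fun a => 5 / 4 / a + x / 2 with hq
  have hx2 : x / 2 ≠ 0 := by positivity
  have tq : Tendsto q atTop (𝓝 (x / 2)) := by
    simpa using (tendsto_const_div_atTop (5 / 4)).add_const (x / 2)
  have hGre : ∀ a : ℝ, (5 / 4 + a * z / 2 : ℂ).re = 5 / 4 + a * x / 2 := by intro a; simp [hx]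
  have hGim : ∀ a : ℝ, (5 / 4 + a * z / 2 : ℂ).im = a * Y / 2 := by intro a; simp [hY]
  have tlogq : Tendsto (fun a => q a * Real.log (q a)) atTop (𝓝 (x / 2 * Real.log (x / 2))) :=
    tq.mul (tq.log hx2)
  have tql : Tendsto (fun a : ℝ => (q a - x / 2) * Real.log a) atTop (𝓝 0) := by
    have := tendsto_log_div_atTop.const_mul (5 / 4)
    rw [mul_zero] at this
    refine this.congr (fun a => ?_)
    simp only [hq]; ring
  have tD : Tendsto (fun a => gammaDecay (Y / 2) (q a)) atTop (𝓝 (gammaDecay (Y / 2) (x / 2))) :=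
    ((hasDerivAt_gammaDecay (Y / 2) (by positivity : 0 < x / 2)).continuousAt.tendsto).comp tq
  have hDscale : ∀ a : ℝ, 0 < a →
      gammaDecay (a * Y / 2) (5 / 4 + a * x / 2) = a * gammaDecay (Y / 2) (q a) := by
    intro a ha
    have e : 5 / 4 + a * x / 2 = a * q a := by simp only [hq]; field_simp
    have hqa : 0 < q a := by simp only [hq]; positivity
    rw [e]
    unfold gammaDecay
    have e1 : a * Y / 2 / (a * q a) = Y / 2 / q a := by field_simp
    have e2 : (a * Y / 2) ^ 2 / (a * q a) ^ 2 = (Y / 2) ^ 2 / q a ^ 2 := by field_simp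
    rw [e1, e2]; ring
  have hLscale : ∀ a : ℝ, 0 < a →
      gammaLogTerm (a * Y / 2) (5 / 4 + a * x / 2) = gammaLogTerm (Y / 2) (q a) := by
    intro a ha
    have e : 5 / 4 + a * x / 2 = a * q a := by simp only [hq]; field_simp
    have hqa : 0 < q a := by simp only [hq]; positivity
    rw [e]
    unfold gammaLogTerm
    have e2 : (a * Y / 2) ^ 2 / (a * q a) ^ 2 = (Y / 2) ^ 2 / q a ^ 2 := by field_simp
    rw [e2]
  have tL : Tendsto (fun a => gammaLogTerm (Y / 2) (q a) / a) atTop (𝓝 0) := by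
    refine Tendsto.div_atTop (a := gammaLogTerm (Y / 2) (x / 2)) ?_ tendsto_id
    unfold gammaLogTerm
    have : Tendsto (fun a => 1 + (Y / 2) ^ 2 / q a ^ 2) atTop
        (𝓝 (1 + (Y / 2) ^ 2 / (x / 2) ^ 2)) :=
      (tendsto_const_nhds.div (tq.pow 2) (by positivity)).const_add 1
    exact (this.log (by positivity)).div_const 2
  have tR : Tendsto (fun a : ℝ => (Real.log (Real.Gamma (5 / 4 + a * x / 2)) -
      ((5 / 4 + a * x / 2) * Real.log (5 / 4 + a * x / 2) - (5 / 4 + a * x / 2))) / a)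
      atTop (𝓝 0) := by
    have tb : Tendsto (fun a : ℝ => 2 * (Real.log a / a) + 2 * (Real.log (q a) / a) + 1 / a)
        atTop (𝓝 0) := by
      have h1 := tendsto_log_div_atTop.const_mul 2
      have h2 := ((tq.log hx2).div_atTop tendsto_id).const_mul 2
      have h3 := (h1.add h2).add (tendsto_const_div_atTop 1)
      simpa using h3
    refine squeeze_zero_norm' ?_ tb
    filter_upwards [eventually_ge_atTop (2 / x), eventually_gt_atTop 0] with a ha ha0
    rw [div_le_iff₀ hz] at ha
    have := abs_log_Gamma_sub_le (x := 5 / 4 + a * x / 2) (by linarith)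
    rw [Real.norm_eq_abs, abs_div, abs_of_pos ha0]
    have e : 5 / 4 + a * x / 2 = a * q a := by simp only [hq]; field_simp
    have hqa : 0 < q a := by simp only [hq]; positivity
    have hl : Real.log (5 / 4 + a * x / 2) = Real.log a + Real.log (q a) := by
      rw [e, Real.log_mul ha0.ne' hqa.ne']
    calc _ ≤ (2 * Real.log (5 / 4 + a * x / 2) + 1) / a := by gcongr
      _ = _ := by rw [hl]; ring
  have base : ∀ a : ℝ, 0 < a → ((5 / 4 + a * x / 2) * Real.log (5 / 4 + a * x / 2) -
      (5 / 4 + a * x / 2)) / a - x / 2 * Real.log a =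
      q a * Real.log (q a) - q a + (q a - x / 2) * Real.log a := by
    intro a ha
    have e : 5 / 4 + a * x / 2 = a * q a := by simp only [hq]; field_simp
    have hqa : 0 < q a := by simp only [hq]; positivity
    rw [e, Real.log_mul ha.ne' hqa.ne']
    field_simp
    ring
  have main : Tendsto (fun a : ℝ => (Real.log (Real.Gamma (5 / 4 + a * x / 2)) -
      gammaDecay (a * Y / 2) (5 / 4 + a * x / 2)) / a - x / 2 * Real.log a) atTop
      (𝓝 (x / 2 * Real.log (x / 2) - x / 2 - gammaDecay (Y / 2) (x / 2))) := by
    have := ((tR.add ((tlogq.sub tq).add tql)).sub tD)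
    rw [zero_add, add_zero] at this
    refine this.congr' ?_
    filter_upwards [eventually_gt_atTop 0] with a ha
    rw [← base a ha, hDscale a ha]
    field_simp
    ring
  have mainL := main.sub tL
  rw [sub_zero] at mainL
  refine tendsto_of_tendsto_of_tendsto_of_le_of_le' mainL main ?_ ?_
  · filter_upwards [eventually_gt_atTop 0] with a ha
    have hre : 0 < (5 / 4 + a * z / 2 : ℂ).re := by rw [hGre]; positivity
    have h := le_norm_Gamma hre
    have hG := Real.Gamma_pos_of_pos hre
    have hn : 0 < ‖(5 / 4 + a * z / 2 : ℂ)‖ := norm_pos_iff.2 (fun h0 => by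
      rw [h0] at hre; simp at hre)
    have h := Real.log_le_log (by positivity) h
    have e3 := norm_eq_mul_exp_gammaLogTerm hre
    have e4 : (5 / 4 + a * z / 2 : ℂ).re / ‖(5 / 4 + a * z / 2 : ℂ)‖ =
        Real.exp (-gammaLogTerm (5 / 4 + a * z / 2 : ℂ).im (5 / 4 + a * z / 2 : ℂ).re) := by
      rw [e3, Real.exp_neg, ← div_div, div_self hre.ne', one_div]
    rw [e4, Real.log_mul (by positivity) (Real.exp_ne_zero _),
      Real.log_mul hG.ne' (Real.exp_ne_zero _), Real.log_exp, Real.log_exp, hGre, hGim] at h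
    rw [hLscale a ha] at h
    have : (Real.log (Real.Gamma (5 / 4 + a * x / 2)) -
      gammaDecay (a * Y / 2) (5 / 4 + a * x / 2)) / a - gammaLogTerm (Y / 2) (q a) / a ≤
      Real.log ‖Complex.Gamma (5 / 4 + a * z / 2)‖ / a := by
      rw [← sub_div]
      gcongr
      linarith
    linarith
  · filter_upwards [eventually_gt_atTop 0] with a ha
    have hre : 0 < (5 / 4 + a * z / 2 : ℂ).re := by rw [hGre]; positivity
    have h := norm_Gamma_le hre
    have hG := Real.Gamma_pos_of_pos hre
    have h := Real.log_le_log (norm_pos_iff.2 (Complex.Gamma_ne_zero_of_re_pos hre)) h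
    rw [Real.log_mul hG.ne' (Real.exp_ne_zero _), Real.log_exp, hGre, hGim] at h
    gcongr
    linarith

/-- Stirling's approximation for `log |f(a z)|` along a ray in the right half plane. -/
theorem tendsto_log_norm_f {z : ℂ} (hz : 0 < z.re) :
    Tendsto (fun a : ℝ => Real.log ‖f (a * z)‖ / a - z.re / 2 * Real.log a) atTop
      (𝓝 (z.re / 2 * Real.log ‖z‖ - z.im / 2 * Real.arctan (z.im / z.re) -
        z.re / 2 * (Real.log (2 * Real.pi) + 1))) := by
  have t1 : Tendsto (fun a : ℝ => -(1 / 4 / a + z.re / 2) * Real.log Real.pi) atTop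
      (𝓝 (-(0 + z.re / 2) * Real.log Real.pi)) :=
    (((tendsto_const_div_atTop (1 / 4)).add_const _).neg).mul_const _
  have t := (t1.add (tendsto_Gamma_part hz)).add (tendsto_zeta_part hz)
  have elim : -(0 + z.re / 2) * Real.log Real.pi + (z.re / 2 * Real.log (z.re / 2) - z.re / 2 -
      gammaDecay (z.im / 2) (z.re / 2)) + 0 = z.re / 2 * Real.log ‖z‖ -
      z.im / 2 * Real.arctan (z.im / z.re) - z.re / 2 * (Real.log (2 * Real.pi) + 1) := by
    rw [norm_eq_mul_exp_gammaLogTerm hz, Real.log_mul hz.ne' (Real.exp_ne_zero _), Real.log_exp,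
      Real.log_div hz.ne' two_ne_zero, Real.log_mul two_ne_zero Real.pi_ne_zero]
    unfold gammaDecay gammaLogTerm
    have e1 : z.im / 2 / (z.re / 2) = z.im / z.re := by field_simp
    have e2 : (z.im / 2) ^ 2 / (z.re / 2) ^ 2 = z.im ^ 2 / z.re ^ 2 := by field_simp
    rw [e1, e2]; ring
  rw [elim] at t
  refine t.congr' ?_
  filter_upwards [eventually_ge_atTop (1 / z.re), eventually_gt_atTop 0] with a ha ha0
  rw [div_le_iff₀ hz] at ha
  have hre : (a * z : ℂ).re = a * z.re := by simp
  have h1 : 1 / 2 ≤ (a * z : ℂ).re := by rw [hre]; linarith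
  have hf := f_ne_zero h1
  have hn := norm_f_eq (w := a * z) (by linarith)
  have hf' : ‖f (a * z)‖ ≠ 0 := norm_ne_zero_iff.2 hf
  have hG : ‖Complex.Gamma (5 / 4 + a * z / 2)‖ ≠ 0 := by
    intro h; rw [hn, h] at hf'; simp at hf'
  have hZ : ‖riemannZeta₁ (1 / 2 + a * z)‖ ≠ 0 := by
    intro h; rw [hn, h] at hf'; simp at hf'
  have hp : Real.pi ^ (-(1 / 2 + (a * z : ℂ).re) / 2) ≠ 0 := by
    have := Real.pi_pos
    positivity
  rw [hn, Real.log_mul (mul_ne_zero hp hG) hZ, Real.log_mul hp hG, Real.log_rpow Real.pi_pos, hre]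
  field_simp
  ring

/-! ### The scaling parameter: existence, uniqueness, divergence. -/

lemma hasDerivAt_fReal {x : ℝ} (hx : 1 / 2 < x) : HasDerivAt fReal (deriv f x).re x := by
  have h := (differentiable_f (x : ℂ)).hasDerivAt.real_of_complex
  refine h.congr_of_eventuallyEq ?_
  filter_upwards [lt_mem_nhds hx] with y hy
  rw [f_ofReal hy, Complex.ofReal_re]

lemma deriv_f_ofReal {x : ℝ} (hx : 1 / 2 < x) : deriv f x = ((deriv f x).re : ℂ) := by
  have h1 : HasDerivAt (fun y : ℝ => f y) (deriv f x) x :=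
    (differentiable_f (x : ℂ)).hasDerivAt.comp_ofReal
  have h2 : HasDerivAt (fun y : ℝ => (fReal y : ℂ)) ((deriv f x).re : ℂ) x :=
    (hasDerivAt_fReal hx).ofReal_comp
  refine h1.unique (h2.congr_of_eventuallyEq ?_)
  filter_upwards [lt_mem_nhds hx] with y hy
  exact f_ofReal hy

lemma logLam_eq {x : ℝ} (hx : 1 / 2 < x) :
    logLam x = Real.log (fReal x) - Real.log ((x ^ 2 - 1 / 4) / 2) := by
  have : 0 < (x ^ 2 - 1 / 4) / 2 := by nlinarith
  rw [fReal, Real.log_mul this.ne' (Real.exp_ne_zero _), Real.log_exp]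
  ring

/-- The logarithmic derivative of the completed zeta function on the half line. -/
noncomputable def lamSlope (x : ℝ) : ℝ := (deriv f x).re / fReal x - 2 * x / (x ^ 2 - 1 / 4)

lemma hasDerivAt_logLam {x : ℝ} (hx : 1 / 2 < x) : HasDerivAt logLam (lamSlope x) x := by
  have hp : 0 < (x ^ 2 - 1 / 4) / 2 := by nlinarith
  have h1 := (hasDerivAt_fReal hx).log (fReal_pos hx).ne'
  have h2 : HasDerivAt (fun x : ℝ => (x ^ 2 - 1 / 4) / 2) x x := by
    have := (((hasDerivAt_id x).pow 2).sub_const (1 / 4)).div_const 2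
    convert! this using 1
    simp
  have h3 := h1.sub (h2.log hp.ne')
  have e : x / ((x ^ 2 - 1 / 4) / 2) = 2 * x / (x ^ 2 - 1 / 4) := by
    have : x ^ 2 - 1 / 4 ≠ 0 := by linarith
    field_simp
  rw [e] at h3
  refine h3.congr_of_eventuallyEq ?_
  filter_upwards [lt_mem_nhds hx] with y hy
  exact logLam_eq hy

/-- `x f'(x) / f(x)`; the scaling parameter solves `scaleFun lam = 2 n`. -/
noncomputable def scaleFun (x : ℝ) : ℝ := x * ((deriv f x).re / fReal x)

lemma scaleFun_eq (x : ℝ) : scaleFun x = x * lamSlope x + 2 * x ^ 2 / (x ^ 2 - 1 / 4) := by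
  unfold scaleFun lamSlope
  ring

lemma logDeriv_f_ofReal {x : ℝ} (hx : 1 / 2 < x) :
    logDeriv f x = (((deriv f x).re / fReal x : ℝ) : ℂ) := by
  rw [logDeriv_apply, deriv_f_ofReal hx, f_ofReal hx]
  push_cast; simp

lemma isScale_iff {n : ℕ} (hn : n ≠ 0) {x : ℝ} :
    IsScale n x ↔ 1 / 2 < x ∧ scaleFun x = 2 * n := by
  unfold IsScale
  refine and_congr_right (fun hx => ?_)
  rw [logDeriv_f_ofReal hx, sub_eq_zero]
  have hn' : (n : ℝ) ≠ 0 := by exact_mod_cast hn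
  unfold scaleFun
  constructor
  · intro h
    have h2 : (2 : ℝ) = x / n * ((deriv f x).re / fReal x) := by exact_mod_cast h
    rw [div_mul_eq_mul_div, eq_div_iff hn'] at h2
    exact h2.symm
  · intro h
    have h2 : (2 : ℝ) = x / n * ((deriv f x).re / fReal x) := by
      rw [div_mul_eq_mul_div, eq_div_iff hn']; exact h.symm
    exact_mod_cast h2

lemma lamSlope_mono {x y : ℝ} (hx : 1 / 2 < x) (hxy : x ≤ y) : lamSlope x ≤ lamSlope y := by
  have := convexOn_logLam.monotoneOn_deriv (fun x hx => (hasDerivAt_logLam hx).differentiableAt)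
  have := this hx (hx.trans_le hxy : (1 / 2 : ℝ) < y) hxy
  rwa [(hasDerivAt_logLam hx).deriv, (hasDerivAt_logLam (hx.trans_le hxy)).deriv] at this

lemma tendsto_log_fReal :
    Tendsto (fun a : ℝ => Real.log (fReal a) / a - 1 / 2 * Real.log a) atTop
      (𝓝 (-(1 / 2) * (Real.log (2 * Real.pi) + 1))) := by
  have h := tendsto_log_norm_f (z := 1) (by simp)
  simp only [mul_one, Complex.one_re, norm_one, Real.log_one, mul_zero, Complex.one_im, zero_div,
    zero_mul, sub_zero, zero_sub] at h
  rw [neg_mul]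
  refine h.congr' ?_
  filter_upwards [eventually_gt_atTop (1 / 2)] with a ha
  rw [norm_f_ofReal ha]

lemma tendsto_logLam :
    Tendsto (fun a : ℝ => logLam a / a - 1 / 2 * Real.log a) atTop
      (𝓝 (-(1 / 2) * (Real.log (2 * Real.pi) + 1))) := by
  have h1 : Tendsto (fun a : ℝ => Real.log ((a ^ 2 - 1 / 4) / 2) / a) atTop (𝓝 0) := by
    have t2 : Tendsto (fun x : ℝ => 2 * (Real.log x / x)) atTop (𝓝 0) := by
      simpa using tendsto_log_div_atTop.const_mul 2
    refine tendsto_of_tendsto_of_tendsto_of_le_of_le' tendsto_const_nhds t2 ?_ ?_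
    · filter_upwards [eventually_ge_atTop 2] with a ha
      exact div_nonneg (Real.log_nonneg (by nlinarith)) (by linarith)
    · filter_upwards [eventually_ge_atTop 2] with a ha
      rw [← mul_div_assoc]
      gcongr
      have := Real.log_le_log (by nlinarith) (by nlinarith : (a ^ 2 - 1 / 4) / 2 ≤ a ^ 2)
      rwa [Real.log_pow] at this
  have := tendsto_log_fReal.sub h1
  rw [sub_zero] at this
  refine this.congr' ?_
  filter_upwards [eventually_gt_atTop (1 / 2)] with a ha
  rw [logLam_eq ha]
  ring

/-- The derivative of a convex function inherits its logarithmic asymptotics. -/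
lemma tendsto_deriv_of_convexOn {ψ ψ' : ℝ → ℝ} {x₀ c : ℝ} (hx₀ : 0 ≤ x₀)
    (hc : ConvexOn ℝ (Set.Ioi x₀) ψ) (hd : ∀ x, x₀ < x → HasDerivAt ψ (ψ' x) x)
    (h : Tendsto (fun a : ℝ => ψ a / a - 1 / 2 * Real.log a) atTop (𝓝 c)) :
    Tendsto (fun a : ℝ => ψ' a - 1 / 2 * Real.log a) atTop (𝓝 (c + 1 / 2)) := by
  set e : ℝ → ℝ := fun a => ψ a / a - 1 / 2 * Real.log a with he
  have hψ : ∀ a, 0 < a → ψ a = a * e a + a / 2 * Real.log a := by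
    intro a ha; simp only [he]; field_simp; ring
  -- This is the secant slope of ψ between a and βa, less (1/2) log a. Its limit c + (β/2) log β/(β
  -- - 1) tends to c + 1/2 as β → 1. Convexity bounds the derivative below by the secant with β = 1
  -- - δ and above by the one with β = 1 + δ.
  have hbd : ∀ β : ℝ, 0 < β → β ≠ 1 → Tendsto (fun a => (β * e (β * a) - e a) / (β - 1) + β / 2 *
      (Real.log β / (β - 1))) atTop (𝓝 (c + β / 2 * (Real.log β / (β - 1)))) := by
    intro β hβ hβ1
    have t1 : Tendsto (fun a => e (β * a)) atTop (𝓝 c) :=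
      h.comp (tendsto_id.const_mul_atTop hβ)
    have := (((t1.const_mul β).sub h).div_const (β - 1)).add_const (β / 2 * (Real.log β / (β - 1)))
    have hb : β - 1 ≠ 0 := sub_ne_zero.2 hβ1
    convert! this using 2
    field_simp
  have hval : ∀ β a : ℝ, 0 < β → β ≠ 1 → 0 < a → (ψ (β * a) - ψ a) / (β * a - a) =
      (β * e (β * a) - e a) / (β - 1) + β / 2 * (Real.log β / (β - 1)) + 1 / 2 * Real.log a := by
    intro β a hβ hβ1 ha
    have hb : β - 1 ≠ 0 := sub_ne_zero.2 hβ1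
    have : β * a - a = (β - 1) * a := by ring
    rw [hψ _ (by positivity), hψ _ ha, Real.log_mul hβ.ne' ha.ne', this]
    field_simp
    ring
  rw [tendsto_order]
  constructor
  · intro b hb
    obtain ⟨δ, hδ, hδ1, hδb⟩ : ∃ δ : ℝ, 0 < δ ∧ δ < 1 ∧ b < c + (1 - δ) / 2 := by
      refine ⟨min (1 / 2) (c + 1 / 2 - b), ?_, ?_, ?_⟩
      · exact lt_min (by norm_num) (by linarith)
      · exact (min_le_left _ _).trans_lt (by norm_num)
      · have := min_le_right (1 / 2) (c + 1 / 2 - b); linarith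
    have hβ : 0 < 1 - δ := by linarith
    have hβ1 : 1 - δ ≠ 1 := by linarith
    have hlim : b < c + (1 - δ) / 2 * (Real.log (1 - δ) / (1 - δ - 1)) := by
      refine hδb.trans_le ?_
      have := Real.log_le_sub_one_of_pos hβ
      have h2 : 1 ≤ Real.log (1 - δ) / (1 - δ - 1) := by
        rw [le_div_iff_of_neg (by linarith)]; linarith
      nlinarith
    filter_upwards [(hbd _ hβ hβ1).eventually (lt_mem_nhds hlim),
      eventually_gt_atTop (x₀ / (1 - δ)), eventually_gt_atTop x₀] with a h1 h2 h3
    have ha : 0 < a := by linarith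
    rw [div_lt_iff₀ hβ] at h2
    have := hc.slope_le_of_hasDerivAt (x := (1 - δ) * a) (y := a)
      (show x₀ < _ by linarith) (show x₀ < a from h3) (by nlinarith) (hd a h3)
    rw [slope_def_field, ← neg_div_neg_eq, neg_sub, neg_sub, hval _ a hβ hβ1 ha] at this
    linarith
  · intro b hb
    set δ := b - (c + 1 / 2) with hδ
    have hβ : 0 < 1 + δ := by linarith
    have hβ1 : 1 + δ ≠ 1 := by linarith
    have hlim : c + (1 + δ) / 2 * (Real.log (1 + δ) / (1 + δ - 1)) < b := by
      have := Real.log_le_sub_one_of_pos hβ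
      have h2 : Real.log (1 + δ) / (1 + δ - 1) ≤ 1 := by
        rw [div_le_one (by linarith)]; linarith
      nlinarith
    filter_upwards [(hbd _ hβ hβ1).eventually (gt_mem_nhds hlim),
      eventually_gt_atTop x₀] with a h1 h3
    have ha : 0 < a := by linarith
    have := hc.le_slope_of_hasDerivAt (x := a) (y := (1 + δ) * a)
      (show x₀ < a from h3) (show x₀ < _ by nlinarith) (by nlinarith) (hd a h3)
    rw [slope_def_field, hval _ a hβ hβ1 ha] at this
    linarith

lemma tendsto_lamSlope : Tendsto (fun a : ℝ => lamSlope a - 1 / 2 * Real.log a) atTop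
    (𝓝 (-(1 / 2) * Real.log (2 * Real.pi))) := by
  have := tendsto_deriv_of_convexOn (by norm_num) convexOn_logLam
    (fun x hx => hasDerivAt_logLam hx) tendsto_logLam
  convert! this using 2
  ring

lemma tendsto_scaleFun_div : Tendsto (fun a : ℝ => scaleFun a / a - 1 / 2 * Real.log a) atTop
    (𝓝 (-(1 / 2) * Real.log (2 * Real.pi))) := by
  have h : Tendsto (fun a : ℝ => 2 * a / (a ^ 2 - 1 / 4)) atTop (𝓝 0) := by
    refine tendsto_of_tendsto_of_tendsto_of_le_of_le' tendsto_const_nhds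
      (tendsto_const_div_atTop 4) ?_ ?_
    · filter_upwards [eventually_ge_atTop 1] with a ha
      exact div_nonneg (by linarith) (by nlinarith)
    · filter_upwards [eventually_ge_atTop 1] with a ha
      rw [div_le_div_iff₀ (by nlinarith) (by linarith)]
      nlinarith
  have := tendsto_lamSlope.add h
  rw [add_zero] at this
  refine this.congr' ?_
  filter_upwards [eventually_ge_atTop 1] with a ha
  have : a ^ 2 - 1 / 4 ≠ 0 := by nlinarith
  rw [scaleFun_eq]
  field_simp
  ring

lemma tendsto_lamSlope_atTop : Tendsto lamSlope atTop atTop := by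
  have h1 : Tendsto (fun a : ℝ => 1 / 2 * Real.log a) atTop atTop :=
    Real.tendsto_log_atTop.const_mul_atTop (by norm_num)
  have := tendsto_lamSlope.add_atTop h1
  simpa using this

/-- The convex part contributes at least (b - a) `lamSlope a`, while the rational term of
`scaleFun_eq` can decrease by at most b - a. -/
lemma scaleFun_sub_ge {a b : ℝ} (ha : 2 ≤ a) (hab : a ≤ b) :
    (b - a) * (lamSlope a - 1) ≤ scaleFun b - scaleFun a := by
  rw [scaleFun_eq, scaleFun_eq]
  have h1 := lamSlope_mono (by linarith) hab
  have h2 : 2 * a ^ 2 / (a ^ 2 - 1 / 4) - 2 * b ^ 2 / (b ^ 2 - 1 / 4) ≤ b - a := by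
    have ha' : 0 < a ^ 2 - 1 / 4 := by nlinarith
    have hb' : 0 < b ^ 2 - 1 / 4 := by nlinarith
    rw [div_sub_div _ _ ha'.ne' hb'.ne', div_le_iff₀ (by positivity)]
    have e : 2 * a ^ 2 * (b ^ 2 - 1 / 4) - (a ^ 2 - 1 / 4) * (2 * b ^ 2) =
      (b - a) * ((a + b) / 2) := by ring
    rw [e]
    have h3 : a * b ≤ (a ^ 2 - 1 / 4) * (b ^ 2 - 1 / 4) := by
      apply mul_le_mul <;> nlinarith
    have h4 : (a + b) / 2 ≤ a * b := by nlinarith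
    exact mul_le_mul_of_nonneg_left (h4.trans h3) (by linarith)
  have h3 : 0 ≤ b * (lamSlope b - lamSlope a) := mul_nonneg (by linarith) (by linarith)
  nlinarith

lemma continuousOn_scaleFun : ContinuousOn scaleFun (Set.Ioi (1 / 2)) := by
  intro x hx
  have h1 : ContinuousAt (fun x : ℝ => (deriv f x).re) x := by
    have : Continuous (deriv f) := differentiable_f.contDiff.continuous_deriv le_top
    exact (Complex.continuous_re.comp (this.comp Complex.continuous_ofReal)).continuousAt
  exact (continuousAt_id.mul (h1.div (hasDerivAt_fReal hx).continuousAt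
    (fReal_pos hx).ne')).continuousWithinAt

/-- The endpoint 1/2 is excluded from the real formula, but f(1/2) ≠ 0. The complex logarithmic
derivative is therefore continuous, hence bounded, on the closed interval. -/
lemma exists_scaleFun_le (M : ℝ) : ∃ B, ∀ x, 1 / 2 < x → x ≤ M → scaleFun x ≤ B := by
  have hcont : ContinuousOn (fun x : ℝ => x * ‖logDeriv f x‖) (Set.Icc (1 / 2) M) := by
    intro x hx
    have h1 : Continuous (fun x : ℝ => deriv f x) :=
      (differentiable_f.contDiff.continuous_deriv le_top).comp Complex.continuous_ofReal
    have h2 : Continuous (fun x : ℝ => f x) :=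
      differentiable_f.continuous.comp Complex.continuous_ofReal
    have h3 : f x ≠ 0 := f_ne_zero (by simpa using hx.1)
    exact (continuousAt_id.mul
      (h1.continuousAt.div h2.continuousAt h3).norm).continuousWithinAt
  obtain ⟨B, hB⟩ := isCompact_Icc.bddAbove_image hcont
  refine ⟨B, fun x hx hxM => ?_⟩
  have := hB (Set.mem_image_of_mem _ (⟨hx.le, hxM⟩ : x ∈ Set.Icc (1 / 2) M))
  refine le_trans ?_ this
  rw [logDeriv_f_ofReal hx, Complex.norm_real, scaleFun]
  exact mul_le_mul_of_nonneg_left (Real.le_norm_self _) (by linarith)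

/-- A threshold beyond which `scaleFun` is strictly increasing. -/
lemma exists_scale_threshold : ∃ X : ℝ, 2 ≤ X ∧ ∀ a, X ≤ a → 2 ≤ lamSlope a := by
  obtain ⟨X, hX⟩ := eventually_atTop.1 (tendsto_lamSlope_atTop.eventually_ge_atTop 2)
  exact ⟨max X 2, le_max_right _ _, fun a ha => hX a ((le_max_left _ _).trans ha)⟩

theorem eventually_existsUnique_isScale : ∀ᶠ n : ℕ in atTop, ∃! lam : ℝ, IsScale n lam := by
  obtain ⟨X, hX2, hX⟩ := exists_scale_threshold
  obtain ⟨B, hB⟩ := exists_scaleFun_le X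
  have hgrow : ∀ a b, X ≤ a → a ≤ b → b - a ≤ scaleFun b - scaleFun a := by
    intro a b ha hab
    have h1 := scaleFun_sub_ge (hX2.trans ha) hab
    have := hX a ha
    nlinarith
  filter_upwards [eventually_gt_atTop 0, (tendsto_natCast_atTop_atTop (R := ℝ)).eventually_gt_atTop B]
    with n hn hnB
  have hn0 : (0 : ℝ) ≤ n := n.cast_nonneg
  have hBX := hB X (by linarith) le_rfl
  simp only [isScale_iff hn.ne']
  have hlow : ∀ x, 1 / 2 < x → scaleFun x = 2 * n → X < x := by
    intro x hx hxn
    by_contra hcon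
    have := hB x hx (not_lt.1 hcon)
    linarith
  -- Beyond X the function grows at least at unit rate, so it has reached 2n by this right endpoint.
  obtain ⟨x, hx, hxn⟩ : ∃ x ∈ Set.Icc X (X + (2 * n - scaleFun X)), scaleFun x = 2 * n := by
    have hle : X ≤ X + (2 * n - scaleFun X) := by linarith
    have := intermediate_value_Icc hle
      (continuousOn_scaleFun.mono (fun y hy => (by linarith [hy.1] : (1 / 2 : ℝ) < y)))
    have h2 := hgrow X _ le_rfl hle
    exact this ⟨by linarith, by linarith⟩
  refine ⟨x, ⟨by linarith [hx.1], hxn⟩, ?_⟩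
  rintro y ⟨hy, hyn⟩
  have hy' := hlow y hy hyn
  rcases le_total x y with h | h
  · have := hgrow x y hx.1 h; linarith
  · have := hgrow y x hy'.le h; linarith

theorem tendsto_of_isScale {lam : ℕ → ℝ} (h : ∀ᶠ n : ℕ in atTop, IsScale n (lam n)) :
    Tendsto lam atTop atTop := by
  refine tendsto_atTop.2 (fun M => ?_)
  obtain ⟨B, hB⟩ := exists_scaleFun_le M
  filter_upwards [h, eventually_gt_atTop 0,
    (tendsto_natCast_atTop_atTop (R := ℝ)).eventually_gt_atTop B] with n hn hn0 hnB
  obtain ⟨h1, h2⟩ := (isScale_iff hn0.ne').1 hn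
  by_contra hcon
  have := hB _ h1 (not_le.1 hcon).le
  have : (0 : ℝ) ≤ n := n.cast_nonneg
  linarith

/-! ### Elementary growth bounds for f and the scale function. -/

lemma Gamma_le_exp {x : ℝ} (hx : 0 ≤ x) : Real.Gamma (5 / 4 + x / 2) ≤
    Real.exp 1 * (2 + x) ^ 4 * Real.exp (x / 2 * Real.log (2 + x)) := by
  have hl : 0 ≤ Real.log (2 + x) := Real.log_nonneg (by linarith)
  rcases le_total x (3 / 2) with h | h
  · have h1 : Real.Gamma (5 / 4 + x / 2) ≤ 1 := by
      have := Real.convexOn_Gamma.2 (show (1 : ℝ) ∈ Set.Ioi 0 by simp)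
        (show (2 : ℝ) ∈ Set.Ioi 0 by simp) (by linarith : 0 ≤ 3 / 4 - x / 2)
        (by linarith : 0 ≤ 1 / 4 + x / 2) (by ring)
      simp only [smul_eq_mul, Real.Gamma_one, Real.Gamma_two] at this
      rw [show (3 / 4 - x / 2) * 1 + (1 / 4 + x / 2) * 2 = 5 / 4 + x / 2 by ring] at this
      linarith
    have h2 : 1 ≤ Real.exp 1 := Real.one_le_exp (by norm_num)
    have h3 : (1 : ℝ) ≤ (2 + x) ^ 4 := one_le_pow₀ (by linarith)
    have h4 : 1 ≤ Real.exp (x / 2 * Real.log (2 + x)) := Real.one_le_exp (by positivity)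
    calc _ ≤ (1 : ℝ) * 1 * 1 := by linarith
      _ ≤ _ := by gcongr
  · have hu : 2 ≤ 5 / 4 + x / 2 := by linarith
    have hG := Real.Gamma_pos_of_pos (by linarith : 0 < 5 / 4 + x / 2)
    have h1 := (abs_le.1 (abs_log_Gamma_sub_le hu)).2
    have h2 : Real.log (5 / 4 + x / 2) ≤ Real.log (2 + x) :=
      Real.log_le_log (by linarith) (by linarith)
    have h3 : Real.log (Real.Gamma (5 / 4 + x / 2)) ≤
        1 + 4 * Real.log (2 + x) + x / 2 * Real.log (2 + x) := by
      have : (5 / 4 + x / 2) * Real.log (5 / 4 + x / 2) ≤ (5 / 4 + x / 2) * Real.log (2 + x) := by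
        gcongr
      nlinarith
    rw [← Real.exp_log hG]
    refine (Real.exp_le_exp.2 h3).trans (le_of_eq ?_)
    rw [Real.exp_add, Real.exp_add, show (4 : ℝ) * Real.log (2 + x) = (4 : ℕ) * Real.log (2 + x) by
      norm_num, Real.exp_nat_mul, Real.exp_log (by linarith)]

/-- Growth of `f` in the right half plane, in elementary terms. -/
theorem exists_norm_f_le_exp : ∃ C : ℝ, 1 ≤ C ∧ ∀ w : ℂ, 0 ≤ w.re →
    ‖f w‖ ≤ C * (2 + ‖w‖) ^ 6 * Real.exp (w.re / 2 * Real.log (2 + w.re)) := by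
  obtain ⟨C, hC1, hC⟩ := exists_norm_f_le
  refine ⟨C * Real.exp 1, ?_, fun w hw => ?_⟩
  · have := Real.one_le_exp (by norm_num : (0 : ℝ) ≤ 1)
    nlinarith
  · refine (hC w hw).trans ?_
    have h1 := Gamma_le_exp hw
    have h2 : Real.exp (-gammaDecay (w.im / 2) (5 / 4 + w.re / 2)) ≤ 1 := by
      rw [Real.exp_le_one_iff, neg_nonpos]
      exact gammaDecay_nonneg _ (by linarith)
    have h3 : w.re ≤ ‖w‖ := Complex.re_le_norm w
    have hG := Real.Gamma_pos_of_pos (by linarith : 0 < 5 / 4 + w.re / 2)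
    calc C * (1 + ‖w‖) ^ 2 * (Real.Gamma (5 / 4 + w.re / 2) *
          Real.exp (-gammaDecay (w.im / 2) (5 / 4 + w.re / 2)))
        ≤ C * (2 + ‖w‖) ^ 2 * ((Real.exp 1 * (2 + ‖w‖) ^ 4 *
          Real.exp (w.re / 2 * Real.log (2 + w.re))) * 1) := by
          gcongr
          · norm_num
          · exact h1.trans (by gcongr)
      _ = _ := by ring

lemma tendsto_log_inv_atTop_of_tendsto {u : ℝ → ℝ} {c : ℝ}
    (h : Tendsto (fun a => u a - 1 / 2 * Real.log a) atTop (𝓝 c)) {k K : ℝ} (hk : k < 1 / 2)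
    (hK : 1 / 2 < K) : ∀ᶠ a in atTop, k * Real.log a ≤ u a ∧ u a ≤ K * Real.log a := by
  have hL := Real.tendsto_log_atTop
  filter_upwards [h.eventually (lt_mem_nhds (by linarith : c - 1 < c)),
    h.eventually (gt_mem_nhds (by linarith : c < c + 1)),
    (hL.const_mul_atTop (by linarith : 0 < 1 / 2 - k)).eventually_ge_atTop (1 - c),
    (hL.const_mul_atTop (by linarith : 0 < K - 1 / 2)).eventually_ge_atTop (c + 1)]
    with a h1 h2 h3 h4
  constructor <;> linarith

lemma eventually_lamSlope_bounds {k K : ℝ} (hk : k < 1 / 2) (hK : 1 / 2 < K) :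
    ∀ᶠ a in atTop, k * Real.log a ≤ lamSlope a ∧ lamSlope a ≤ K * Real.log a :=
  tendsto_log_inv_atTop_of_tendsto tendsto_lamSlope hk hK

lemma eventually_scaleFun_bounds {k K : ℝ} (hk : k < 1 / 2) (hK : 1 / 2 < K) :
    ∀ᶠ a in atTop, k * (a * Real.log a) ≤ scaleFun a ∧ scaleFun a ≤ K * (a * Real.log a) := by
  filter_upwards [tendsto_log_inv_atTop_of_tendsto tendsto_scaleFun_div hk hK,
    eventually_gt_atTop 0] with a h ha
  rw [le_div_iff₀ ha, div_le_iff₀ ha] at h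
  constructor <;> linarith [h.1, h.2]

lemma eventually_log_fReal_bounds {k K : ℝ} (hk : k < 1 / 2) (hK : 1 / 2 < K) :
    ∀ᶠ a in atTop, k * (a * Real.log a) ≤ Real.log (fReal a) ∧
      Real.log (fReal a) ≤ K * (a * Real.log a) := by
  filter_upwards [tendsto_log_inv_atTop_of_tendsto tendsto_log_fReal hk hK,
    eventually_gt_atTop 0] with a h ha
  rw [le_div_iff₀ ha, div_le_iff₀ ha] at h
  constructor <;> linarith [h.1, h.2]

/-! ### The holomorphic phase near the saddle point. -/

/-- The second logarithmic derivative of `u ↦ f (exp u)` at `u = log a`. -/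
noncomputable def phaseCurv (a : ℝ) : ℝ := a * deriv scaleFun a

lemma hasDerivAt_complex_scaleFun {w : ℂ} (hw : 1 / 2 ≤ w.re) :
    DifferentiableAt ℂ (fun w => w * (deriv f w / f w)) w := by
  have h1 : Differentiable ℂ (deriv f) := by
    have := (differentiable_f.contDiff (n := 2)).differentiable_deriv_two
    exact this
  exact differentiableAt_id.mul ((h1 w).div (differentiable_f w) (f_ne_zero hw))

lemma scaleFun_ofReal {x : ℝ} (hx : 1 / 2 < x) :
    (x : ℂ) * (deriv f x / f x) = (scaleFun x : ℂ) := by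
  rw [deriv_f_ofReal hx, f_ofReal hx]
  unfold scaleFun
  push_cast
  simp

lemma hasDerivAt_scaleFun {x : ℝ} (hx : 1 / 2 < x) :
    HasDerivAt (fun w : ℂ => w * (deriv f w / f w)) ((deriv scaleFun x : ℝ) : ℂ) x ∧
      HasDerivAt scaleFun (deriv scaleFun x) x := by
  set G : ℂ → ℂ := fun w => w * (deriv f w / f w) with hG
  have hd := (hasDerivAt_complex_scaleFun (w := x) (by simpa using hx.le)).hasDerivAt
  have hev : ∀ᶠ y : ℝ in 𝓝 x, (G y) = (scaleFun y : ℂ) := by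
    filter_upwards [lt_mem_nhds hx] with y hy
    exact scaleFun_ofReal hy
  have h1 : HasDerivAt scaleFun (deriv G x).re x := by
    refine hd.real_of_complex.congr_of_eventuallyEq ?_
    filter_upwards [hev] with y hy
    change scaleFun y = (G y).re
    rw [hy, Complex.ofReal_re]
  have h2 : HasDerivAt (fun y : ℝ => G y) (deriv G x) x := hd.comp_ofReal
  have h3 : HasDerivAt (fun y : ℝ => (scaleFun y : ℂ)) ((deriv G x).re : ℂ) x := h1.ofReal_comp
  have h4 : deriv G x = ((deriv G x).re : ℂ) := h2.unique (h3.congr_of_eventuallyEq hev)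
  rw [h1.deriv, ← h4]
  exact ⟨hd, h1⟩

/-- The one-sided difference quotients of `scaleFun` at a satisfy `scaleFun_sub_ge`, and the bound
passes to the derivative. -/
lemma phaseCurv_ge {a : ℝ} (ha : 2 ≤ a) : a * (lamSlope a - 1) ≤ phaseCurv a := by
  unfold phaseCurv
  have h := (hasDerivAt_scaleFun (by linarith : 1 / 2 < a)).2
  have h2 : lamSlope a - 1 ≤ deriv scaleFun a := by
    have ht := (hasDerivAt_iff_tendsto_slope.1 h).mono_left
      (nhdsWithin_mono a (s := Set.Ioi a) (fun y hy => ne_of_gt hy))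
    refine ge_of_tendsto ht ?_
    filter_upwards [self_mem_nhdsWithin] with y hy
    have hy : a < y := hy
    rw [slope_def_field, le_div_iff₀ (by linarith)]
    have := scaleFun_sub_ge ha hy.le
    linarith
  exact mul_le_mul_of_nonneg_left h2 (by linarith)

/-- For a ≥ 4 this keeps a e^τ in Re ≥ 1/2, where f has no zeros; a logarithm therefore exists on
the whole unit disc. -/
lemma re_exp_ge {τ : ℂ} (hτ : ‖τ‖ < 1) : 1 / 8 ≤ (Complex.exp τ).re := by
  rw [Complex.exp_re]
  have h1 : |τ.re| < 1 := (Complex.abs_re_le_norm τ).trans_lt hτ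
  have h2 : |τ.im| < 1 := (Complex.abs_im_le_norm τ).trans_lt hτ
  have h3 : 1 / 2 ≤ Real.cos τ.im := by
    rw [← Real.cos_abs, ← Real.cos_pi_div_three]
    exact Real.cos_le_cos_of_nonneg_of_le_pi (abs_nonneg _) (by linarith [Real.pi_pos])
      (by linarith [Real.pi_gt_three])
  have h4 : 1 / 4 ≤ Real.exp τ.re := by
    have : Real.exp (-1) ≤ Real.exp τ.re := Real.exp_le_exp.2 (abs_lt.1 h1).1.le
    refine le_trans ?_ this
    rw [Real.exp_neg, ← one_div]
    apply one_div_le_one_div_of_le (Real.exp_pos _)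
    linarith [Real.exp_one_lt_d9]
  nlinarith

/-- A holomorphic logarithm of `f (a e^τ) e^(-τ scaleFun a) / f a` on the unit disc. -/
lemma exists_phase {a : ℝ} (ha : 4 ≤ a) : ∃ H : ℂ → ℂ, DifferentiableOn ℂ H (Metric.ball 0 1) ∧
    H 0 = 0 ∧ (∀ τ ∈ Metric.ball (0 : ℂ) 1,
      Complex.exp (H τ) = f (a * Complex.exp τ) / f a * Complex.exp (-(scaleFun a * τ))) ∧
    (fun τ => H τ - phaseCurv a / 2 * τ ^ 2) =o[𝓝 0] (fun τ => ‖τ‖ ^ 2) := by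
  set G : ℂ → ℂ := fun w => w * (deriv f w / f w) with hG
  have hre : ∀ τ ∈ Metric.ball (0 : ℂ) 1, 1 / 2 ≤ (a * Complex.exp τ : ℂ).re := by
    intro τ hτ
    have := re_exp_ge (by simpa using hτ : ‖τ‖ < 1)
    rw [Complex.re_ofReal_mul]
    nlinarith
  have hin : ∀ τ : ℂ, HasDerivAt (fun τ : ℂ => (a : ℂ) * Complex.exp τ) (a * Complex.exp τ) τ :=
    fun τ => (Complex.hasDerivAt_exp τ).const_mul _
  -- This is the τ-derivative of the wanted logarithm. It vanishes at 0 and has derivative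
  -- `phaseCurv a` there, which gives the quadratic term after integration.
  set h : ℂ → ℂ := fun τ => G (a * Complex.exp τ) - scaleFun a with hh
  have hhd : DifferentiableOn ℂ h (Metric.ball 0 1) := by
    intro τ hτ
    have h1 : DifferentiableAt ℂ G (a * Complex.exp τ) := hasDerivAt_complex_scaleFun (hre τ hτ)
    exact ((h1.comp τ (hin τ).differentiableAt).sub_const _).differentiableWithinAt
  obtain ⟨H, hH0, hH⟩ := hhd.isExactOn_ball.with_val_at 0 0
  have h00 : (0 : ℂ) ∈ Metric.ball (0 : ℂ) 1 := by simp
  have hfa : f a ≠ 0 := f_ne_zero (by simp; linarith)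
  refine ⟨H, fun τ hτ => (hH τ hτ).differentiableAt.differentiableWithinAt, hH0, ?_, ?_⟩
  · set Q : ℂ → ℂ := fun τ => Complex.exp (-H τ) *
      (f (a * Complex.exp τ) * Complex.exp (-(scaleFun a * τ))) with hQ
    have hQd : ∀ τ ∈ Metric.ball (0 : ℂ) 1, HasDerivAt Q 0 τ := by
      intro τ hτ
      have d1 := (hH τ hτ).neg.cexp
      have d2 := (differentiable_f (a * Complex.exp τ)).hasDerivAt.comp τ (hin τ)
      have d3 : HasDerivAt (fun τ : ℂ => Complex.exp (-(scaleFun a * τ)))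
          (Complex.exp (-(scaleFun a * τ)) * -(scaleFun a)) τ := by
        have := ((hasDerivAt_id τ).const_mul (scaleFun a : ℂ)).neg.cexp
        simpa using this
      have := d1.mul (d2.mul d3)
      convert! this using 1
      have hne := f_ne_zero (hre τ hτ)
      simp only [hh, hG, Function.comp_apply, Pi.mul_apply]
      field_simp
      ring
    have hconst : ∀ τ ∈ Metric.ball (0 : ℂ) 1, Q τ = Q 0 := by
      intro τ hτ
      have := (convex_ball (0 : ℂ) 1).norm_image_sub_le_of_norm_hasDerivWithin_le
        (f := Q) (f' := fun _ => 0) (C := 0) (fun x hx => (hQd x hx).hasDerivWithinAt)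
        (fun x _ => by simp) h00 hτ
      rw [zero_mul] at this
      exact sub_eq_zero.1 (norm_le_zero_iff.1 this)
    intro τ hτ
    have := hconst τ hτ
    simp only [hQ, hH0, neg_zero, Complex.exp_zero, mul_one, mul_zero, one_mul] at this
    rw [Complex.exp_neg, inv_mul_eq_iff_eq_mul₀ (Complex.exp_ne_zero _)] at this
    rw [div_mul_eq_mul_div, this, mul_div_cancel_right₀ _ hfa]
  · have hGa : G a = scaleFun a := scaleFun_ofReal (by linarith)
    have hd0 : HasDerivAt h (phaseCurv a : ℂ) 0 := by
      have h1 := (hasDerivAt_scaleFun (by linarith : 1 / 2 < a)).1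
      have h2 : HasDerivAt G ((deriv scaleFun a : ℝ) : ℂ) ((fun τ : ℂ => (a : ℂ) * Complex.exp τ) 0) := by
        simpa using h1
      have h3 := (h2.comp 0 (hin 0)).sub_const (scaleFun a : ℂ)
      convert! h3 using 1
      unfold phaseCurv; push_cast; simp; ring
    have h0 : h 0 = 0 := by simp [hh, hGa]
    have hlo := hd0.isLittleO
    rw [h0] at hlo
    rw [Asymptotics.isLittleO_iff] at hlo ⊢
    intro ε hε
    obtain ⟨δ, hδ, hball⟩ := Metric.eventually_nhds_iff_ball.1 (hlo hε)
    filter_upwards [Metric.ball_mem_nhds (0 : ℂ) (lt_min hδ one_pos)] with τ hτ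
    rw [Metric.mem_ball, dist_zero_right, lt_min_iff] at hτ
    have hsub : ∀ x ∈ Metric.closedBall (0 : ℂ) ‖τ‖, x ∈ Metric.ball (0 : ℂ) δ ∧
        x ∈ Metric.ball (0 : ℂ) 1 := by
      intro x hx
      rw [Metric.mem_closedBall, dist_zero_right] at hx
      rw [Metric.mem_ball, Metric.mem_ball, dist_zero_right]
      exact ⟨hx.trans_lt hτ.1, hx.trans_lt hτ.2⟩
    -- The estimate h(τ) - Wτ = o(τ) is integrated over the disc of radius |τ|, giving o(τ²) for H.
    have := (convex_closedBall (0 : ℂ) ‖τ‖).norm_image_sub_le_of_norm_hasDerivWithin_le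
      (f := fun τ => H τ - phaseCurv a / 2 * τ ^ 2) (f' := fun x => h x - phaseCurv a * x)
      (C := ε * ‖τ‖) (x := 0) (y := τ)
      (fun x hx => by
        have d1 := hH x (hsub x hx).2
        have d2 := ((hasDerivAt_id x).pow 2).const_mul (phaseCurv a / 2 : ℂ)
        have d3 := d1.sub d2
        refine HasDerivAt.hasDerivWithinAt ?_
        convert! d3 using 1
        simp; ring)
      (fun x hx => by
        have h1 := hball x (hsub x hx).1
        rw [Metric.mem_closedBall, dist_zero_right] at hx
        simp only [sub_zero, smul_eq_mul] at h1
        rw [mul_comm (phaseCurv a : ℂ)]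
        exact h1.trans (by gcongr))
      (by simp) (by simp)
    simp only [hH0, sub_zero, ne_eq, OfNat.ofNat_ne_zero, not_false_eq_true, zero_pow, mul_zero]
      at this
    rw [norm_pow, norm_norm]
    refine this.trans (le_of_eq (by ring))

/-- Re H is the logarithm of a modulus, so the growth of f bounds it on the unit disc by 25 a log a.
Borel–Carathéodory turns this one-sided bound into a bound for |H| on the half disc, at the cost of
a factor 2. -/
lemma eventually_norm_phase_le : ∀ᶠ a : ℝ in atTop, ∀ H : ℂ → ℂ,
    DifferentiableOn ℂ H (Metric.ball 0 1) → H 0 = 0 →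
    (∀ τ ∈ Metric.ball (0 : ℂ) 1,
      Complex.exp (H τ) = f (a * Complex.exp τ) / f a * Complex.exp (-(scaleFun a * τ))) →
    ∀ τ ∈ Metric.ball (0 : ℂ) (1 / 2), ‖H τ‖ ≤ 50 * (a * Real.log a) := by
  obtain ⟨C, hC1, hC⟩ := exists_norm_f_le_exp
  filter_upwards [eventually_ge_atTop 8, eventually_ge_atTop C,
    eventually_scaleFun_bounds (k := 1 / 4) (K := 1) (by norm_num) (by norm_num),
    eventually_log_fReal_bounds (k := 1 / 4) (K := 1) (by norm_num) (by norm_num)]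
    with a ha haC hg hF H hHd hH0 hH
  have hla : 1 ≤ Real.log a := by
    rw [Real.le_log_iff_exp_le (by linarith)]
    linarith [Real.exp_one_lt_d9]
  have hF0 : 1 ≤ fReal a := by
    have : 0 ≤ Real.log (fReal a) := le_trans (by positivity) hF.1
    exact (Real.log_nonneg_iff (fReal_pos (by linarith))).1 this
  have hM : 0 < 25 * (a * Real.log a) := by positivity
  have hre : Set.MapsTo H (Metric.ball 0 1) {z | z.re ≤ 25 * (a * Real.log a)} := by
    intro τ hτ
    change (H τ).re ≤ _
    have hτ1 : ‖τ‖ < 1 := by simpa using hτ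
    have e := congrArg norm (hH τ hτ)
    have hw0 := re_exp_ge hτ1
    set w : ℂ := a * Complex.exp τ with hw
    have hwre : 0 ≤ w.re := by rw [hw, Complex.re_ofReal_mul]; positivity
    have hre1 := abs_lt.1 ((Complex.abs_re_le_norm τ).trans_lt hτ1)
    have hwn : ‖w‖ ≤ 3 * a := by
      rw [hw, norm_mul, Complex.norm_real, Real.norm_of_nonneg (by linarith), Complex.norm_exp,
        mul_comm]
      have : Real.exp τ.re ≤ Real.exp 1 := Real.exp_le_exp.2 hre1.2.le
      have := Real.exp_one_lt_d9
      gcongr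
      linarith
    have hwr : w.re ≤ 3 * a := (Complex.re_le_norm w).trans hwn
    rw [norm_mul, norm_div, Complex.norm_exp, Complex.norm_exp, norm_f_ofReal (by linarith)] at e
    have e2 : (-(scaleFun a * τ) : ℂ).re = -(scaleFun a * τ.re) := by simp
    rw [e2] at e
    have hg0 : 0 ≤ scaleFun a := le_trans (by positivity) hg.1
    have h3 : -(scaleFun a * τ.re) ≤ a * Real.log a := by nlinarith
    have hl3 : Real.log (4 * a) ≤ 2 * Real.log a := by
      have := Real.log_le_log (by positivity) (by nlinarith : 4 * a ≤ a ^ 2)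
      rwa [Real.log_pow] at this
    have h4 : ‖f w‖ ≤ Real.exp (24 * (a * Real.log a)) := by
      refine (hC w hwre).trans ?_
      have h5 : w.re / 2 * Real.log (2 + w.re) ≤ 3 * (a * Real.log a) := by
        have : Real.log (2 + w.re) ≤ Real.log (4 * a) :=
          Real.log_le_log (by linarith) (by linarith)
        calc w.re / 2 * Real.log (2 + w.re) ≤ 3 * a / 2 * (2 * Real.log a) := by
              gcongr
              · exact Real.log_nonneg (by linarith)
              · linarith
          _ = _ := by ring
      have h6 : C * (2 + ‖w‖) ^ 6 ≤ Real.exp (13 * Real.log a) := by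
        calc C * (2 + ‖w‖) ^ 6 ≤ a * (a ^ 2) ^ 6 := by
              gcongr
              nlinarith
          _ = Real.exp (13 * Real.log a) := by
              rw [show (13 : ℝ) * Real.log a = (13 : ℕ) * Real.log a by norm_num,
                Real.exp_nat_mul, Real.exp_log (by linarith)]
              ring
      calc _ ≤ Real.exp (13 * Real.log a) * Real.exp (3 * (a * Real.log a)) := by gcongr
        _ = Real.exp (13 * Real.log a + 3 * (a * Real.log a)) := by rw [Real.exp_add]
        _ ≤ _ := Real.exp_le_exp.2 (by nlinarith)
    have h7 : Real.exp (H τ).re ≤ Real.exp (25 * (a * Real.log a)) := by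
      rw [e]
      calc _ ≤ Real.exp (24 * (a * Real.log a)) / 1 * Real.exp (a * Real.log a) := by gcongr
        _ = _ := by rw [div_one, ← Real.exp_add]; congr 1; ring
    exact Real.exp_le_exp.1 h7
  intro τ hτ
  have hτ1 : ‖τ‖ < 1 / 2 := by simpa using hτ
  have hb := Complex.borelCaratheodory_zero hM hHd hre one_pos
    (by rw [Metric.mem_ball, dist_zero_right]; linarith : τ ∈ Metric.ball (0 : ℂ) 1) hH0
  refine hb.trans ?_
  rw [div_le_iff₀ (by linarith)]
  nlinarith [norm_nonneg τ]

/-- Third order control of the phase near the saddle point. -/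
theorem eventually_exists_phase : ∀ᶠ a : ℝ in atTop, phaseCurv a ≤ 1000 * (a * Real.log a) ∧
    ∃ H : ℂ → ℂ, (∀ τ ∈ Metric.ball (0 : ℂ) 1,
      Complex.exp (H τ) = f (a * Complex.exp τ) / f a * Complex.exp (-(scaleFun a * τ))) ∧
    ∀ τ : ℂ, ‖τ‖ < 1 / 2 →
      ‖H τ - phaseCurv a / 2 * τ ^ 2‖ ≤ 2000 * (a * Real.log a) * ‖τ‖ ^ 3 := by
  filter_upwards [eventually_norm_phase_le, eventually_ge_atTop 4,
    tendsto_lamSlope_atTop.eventually_ge_atTop 2] with a hbound ha hslope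
  obtain ⟨H, hHd, hH0, hH, hlo⟩ := exists_phase ha
  have hb := hbound H hHd hH0 hH
  set M := a * Real.log a with hM
  have hla : 1 ≤ Real.log a := by
    rw [Real.le_log_iff_exp_le (by linarith)]
    linarith [Real.exp_one_lt_d9]
  have hM1 : 4 ≤ M := by nlinarith
  set W := phaseCurv a with hW
  have hW0 : 0 ≤ W := le_trans (by nlinarith) (phaseCurv_ge (by linarith : 2 ≤ a))
  have hsub : Metric.ball (0 : ℂ) (1 / 2) ⊆ Metric.ball 0 1 := Metric.ball_subset_ball (by norm_num)
  have hlo1 : (fun τ => H τ - H 0) =o[𝓝 0] (fun τ : ℂ => ‖τ - 0‖ ^ 1) := by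
    simp only [hH0, sub_zero, pow_one]
    have h1 : (fun τ : ℂ => ‖τ‖ ^ 2) =o[𝓝 0] (fun τ : ℂ => ‖τ‖) := by
      have := (Asymptotics.isLittleO_pow_id (𝕜 := ℝ) (n := 2) (by norm_num)).comp_tendsto
        (tendsto_norm_zero (E := ℂ))
      exact this
    have h2 : (fun τ : ℂ => (W / 2 : ℂ) * τ ^ 2) =o[𝓝 0] (fun τ : ℂ => ‖τ‖) := by
      refine Asymptotics.IsBigO.trans_isLittleO ?_ h1
      refine Asymptotics.IsBigO.of_bound ‖(W / 2 : ℂ)‖ (Eventually.of_forall fun τ => ?_)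
      rw [norm_mul, norm_pow, norm_pow, norm_norm]
    refine ((hlo.trans h1).add h2).congr_left (fun τ => by ring)
  have hS1 : ∀ τ ∈ Metric.ball (0 : ℂ) (1 / 2), ‖H τ‖ ≤ 200 * M * ‖τ‖ ^ 2 := by
    intro τ hτ
    -- Schwarz lemma with a double zero at 0: 50M/(1/2)² = 200M. The same argument with a triple
    -- zero, applied below to H - Wτ²/2, gives 250M/(1/2)³ = 2000M.
    have := Complex.dist_le_mul_div_pow_of_mapsTo_ball_of_isLittleO (n := 1) (hHd.mono hsub)
      (R₂ := 50 * M) (fun w hw => by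
        rw [hH0, Metric.mem_closedBall, dist_zero_right]; exact hb w hw) hlo1 hτ
    rw [hH0, dist_zero_right, dist_zero_right] at this
    refine this.trans (le_of_eq (by ring))
  have hWb : W ≤ 1000 * M := by
    have h1 := Asymptotics.isLittleO_iff.1 hlo one_pos
    obtain ⟨δ, hδ, hball⟩ := Metric.eventually_nhds_iff_ball.1 h1
    set r := min (δ / 2) (1 / 4) with hr
    have hr0 : 0 < r := by positivity
    have hrn : ‖(r : ℂ)‖ = r := by rw [Complex.norm_real, Real.norm_of_nonneg hr0.le]
    have h2 := hball (r : ℂ) (by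
      rw [Metric.mem_ball, dist_zero_right, hrn]
      exact (min_le_left _ _).trans_lt (by linarith))
    have h3 := hS1 (r : ℂ) (by
      rw [Metric.mem_ball, dist_zero_right, hrn]
      exact (min_le_right _ _).trans_lt (by norm_num))
    rw [hrn] at h3
    rw [norm_pow, norm_norm, hrn, one_mul] at h2
    have h4 : ‖(W / 2 * r ^ 2 : ℂ)‖ = W / 2 * r ^ 2 := by
      rw [show (W / 2 * r ^ 2 : ℂ) = ((W / 2 * r ^ 2 : ℝ) : ℂ) by push_cast; ring,
        Complex.norm_real, Real.norm_of_nonneg (by positivity)]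
    have h5 : W / 2 * r ^ 2 ≤ (200 * M + 1) * r ^ 2 := by
      rw [← h4]
      have := norm_sub_norm_le (W / 2 * r ^ 2 : ℂ) (H r)
      rw [norm_sub_rev] at this
      linarith
    have := le_of_mul_le_mul_right h5 (by positivity)
    linarith
  refine ⟨hWb, H, hH, fun τ hτ => ?_⟩
  set K : ℂ → ℂ := fun τ => H τ - W / 2 * τ ^ 2 with hK
  have hK0 : K 0 = 0 := by simp [hK, hH0]
  have := Complex.dist_le_mul_div_pow_of_mapsTo_ball_of_isLittleO (n := 2) (f := K)
      (c := 0) (z := τ) (R₁ := 1 / 2) (R₂ := 250 * M)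
      ((hHd.mono hsub).sub (by fun_prop)) (fun w hw => by
        rw [hK0, Metric.mem_closedBall, dist_zero_right]
        have h1 := hb w hw
        have hw' : ‖w‖ < 1 / 2 := by simpa using hw
        have h2 : ‖(W / 2 * w ^ 2 : ℂ)‖ ≤ W / 2 * (1 / 2) ^ 2 := by
          rw [norm_mul, norm_pow, norm_div, Complex.norm_real, Real.norm_of_nonneg hW0]
          norm_num
          gcongr
          nlinarith [norm_nonneg w]
        refine (norm_sub_le _ _).trans ?_
        linarith)
      (by simpa [hK0] using hlo) (by simpa using hτ)
  rw [hK0, dist_zero_right, dist_zero_right] at this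
  refine this.trans (le_of_eq (by ring))

/-! ### Cauchy's integral for the Taylor remainder. -/

open Complex in
lemma T_eq_circleIntegral (m : ℕ) {R : ℝ} (hR : 0 < R) (w : ℂ) :
    T m w = (2 * Real.pi * I)⁻¹ *
      ∮ ζ in C(0, R), ∑ k ∈ Finset.range (m + 1), w ^ k * (1 / ζ ^ (k + 1) * f ζ) := by
  have hcirc : ∀ k ∈ Finset.range (m + 1),
      CircleIntegrable (fun ζ : ℂ => w ^ k * (1 / ζ ^ (k + 1) * f ζ)) 0 R := by
    intro k _
    refine ContinuousOn.circleIntegrable hR.le ?_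
    refine continuousOn_const.mul ((continuousOn_const.div (by fun_prop) ?_).mul
      differentiable_f.continuous.continuousOn)
    intro ζ hζ
    have : ζ ≠ 0 := by
      rintro rfl
      simp at hζ; linarith
    positivity
  rw [circleIntegral.integral_fun_sum hcirc]
  unfold T
  rw [Finset.mul_sum]
  refine Finset.sum_congr rfl (fun k _ => ?_)
  rw [circleIntegral.integral_const_mul]
  have h := DiffContOnCl.circleIntegral_one_div_sub_center_pow_smul (c := 0) hR k
    differentiable_f.diffContOnCl
  simp only [sub_zero, smul_eq_mul] at h
  rw [h]
  have h2 : (2 * Real.pi * I : ℂ) ≠ 0 := two_pi_I_ne_zero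
  have h3 : (k ! : ℂ) ≠ 0 := by exact_mod_cast Nat.factorial_ne_zero k
  field_simp

open Complex in
/-- Cauchy's formula for the Taylor polynomial, on either side of the contour. -/
lemma T_sub_eq_circleIntegral (m : ℕ) {R : ℝ} (hR : 0 < R) {w : ℂ} (hw : ‖w‖ ≠ R) :
    T m w - (if ‖w‖ < R then f w else 0) = -((2 * Real.pi * I)⁻¹ *
      ∮ ζ in C(0, R), f ζ * (w / ζ) ^ (m + 1) / (ζ - w)) := by
  have hne : ∀ ζ ∈ Metric.sphere (0 : ℂ) R, ζ ≠ 0 ∧ ζ - w ≠ 0 := by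
    intro ζ hζ
    have hζ : ‖ζ‖ = R := by simpa using hζ
    refine ⟨fun h => ?_, fun h => ?_⟩
    · rw [h, norm_zero] at hζ; linarith
    · rw [sub_eq_zero] at h; rw [h] at hζ; exact hw hζ
  have hf : ContinuousOn f (Metric.sphere 0 R) := differentiable_f.continuous.continuousOn
  have i1 : CircleIntegrable (fun ζ : ℂ => (ζ - w)⁻¹ * f ζ) 0 R :=
    (((continuousOn_id.sub continuousOn_const).inv₀ (fun ζ hζ => (hne ζ hζ).2)).mul
      hf).circleIntegrable hR.le
  have i2 : CircleIntegrable (fun ζ : ℂ => f ζ * (w / ζ) ^ (m + 1) / (ζ - w)) 0 R :=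
    ((hf.mul ((continuousOn_const.div continuousOn_id (fun ζ hζ => (hne ζ hζ).1)).pow _)).div
      (continuousOn_id.sub continuousOn_const) (fun ζ hζ => (hne ζ hζ).2)).circleIntegrable hR.le
  have key : (∮ ζ in C(0, R), ∑ k ∈ Finset.range (m + 1), w ^ k * (1 / ζ ^ (k + 1) * f ζ)) =
      (∮ ζ in C(0, R), (ζ - w)⁻¹ * f ζ) -
        ∮ ζ in C(0, R), f ζ * (w / ζ) ^ (m + 1) / (ζ - w) := by
    rw [← circleIntegral.integral_sub i1 i2]
    refine circleIntegral.integral_congr hR.le (fun ζ hζ => ?_)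
    obtain ⟨h0, h1⟩ := hne ζ hζ
    have e1 : ∑ k ∈ Finset.range (m + 1), w ^ k * (1 / ζ ^ (k + 1) * f ζ) =
        f ζ / ζ * ∑ k ∈ Finset.range (m + 1), (w / ζ) ^ k := by
      rw [Finset.mul_sum]
      refine Finset.sum_congr rfl (fun k _ => ?_)
      rw [div_pow, pow_succ]
      field_simp
    have e2 : (w / ζ) ≠ 1 := by
      intro h
      rw [div_eq_one_iff_eq h0] at h
      exact h1 (by rw [h, sub_self])
    rw [e1, geom_sum_eq e2]
    have e3 : w / ζ - 1 = -((ζ - w) / ζ) := by field_simp; ring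
    rw [e3]
    field_simp
    ring
  rw [T_eq_circleIntegral m hR, key, mul_sub]
  have h2 : (2 * Real.pi * I : ℂ) ≠ 0 := two_pi_I_ne_zero
  split_ifs with hlt
  · have := DiffContOnCl.circleIntegral_sub_inv_smul (c := 0) (R := R) (w := w)
      (f := f) differentiable_f.diffContOnCl (by simpa using hlt)
    simp only [smul_eq_mul] at this
    rw [this, inv_mul_cancel_left₀ h2]
    ring
  · have hgt : R < ‖w‖ := lt_of_le_of_ne (not_lt.1 hlt) (Ne.symm hw)
    have : (∮ ζ in C(0, R), (ζ - w)⁻¹ * f ζ) = 0 := by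
      refine DiffContOnCl.circleIntegral_eq_zero hR.le ?_
      refine DifferentiableOn.diffContOnCl ?_
      intro ζ hζ
      have hζ : ‖ζ‖ ≤ R := by
        have := Metric.closure_ball_subset_closedBall hζ
        simpa using this
      have hne : ζ - w ≠ 0 := by
        intro h; rw [sub_eq_zero] at h; rw [h] at hζ; linarith
      have h1 : DifferentiableAt ℂ (fun ζ : ℂ => (ζ - w)⁻¹) ζ :=
        DifferentiableAt.fun_inv (by fun_prop) hne
      exact (h1.mul (differentiable_f ζ)).differentiableWithinAt
    rw [this]
    ring

/-- The rescaled integrand, in the logarithmic variable `τ`. -/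
noncomputable def saddle (n : ℕ) (a : ℝ) (τ : ℂ) : ℂ :=
  f (a * Complex.exp τ) / f a * Complex.exp (-(2 * n * τ))

/-- The symmetrised Cauchy kernel in the logarithmic variable. -/
noncomputable def kernel (z τ : ℂ) : ℂ := 2 * z ^ 2 / (Complex.exp (2 * τ) - z ^ 2)

open Complex in
/-- The remainder of the Taylor polynomial as an integral over a half circle. -/
theorem T_sub_eq_integral {n : ℕ} {a r : ℝ} (ha : 1 / 2 < a) {z : ℂ}
    (hz : ‖z‖ ≠ Real.exp r) :
    T (2 * n) (a * z) - (if ‖z‖ < Real.exp r then f (a * z) else 0) =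
      z ^ (2 * n) * f a * (-(1 / (2 * Real.pi)) *
        ∫ θ in (-(Real.pi / 2))..(Real.pi / 2), saddle n a (r + θ * I) * kernel z (r + θ * I)) := by
  have ha0 : 0 < a := by linarith
  have hR : 0 < a * Real.exp r := by positivity
  have hnorm : ‖(a * z : ℂ)‖ = a * ‖z‖ := by
    rw [norm_mul, norm_real, Real.norm_of_nonneg ha0.le]
  have hw : ‖(a * z : ℂ)‖ ≠ a * Real.exp r := by
    rw [hnorm]; intro h; exact hz (mul_left_cancel₀ ha0.ne' h)
  have hiff : ‖(a * z : ℂ)‖ < a * Real.exp r ↔ ‖z‖ < Real.exp r := by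
    rw [hnorm]; exact mul_lt_mul_iff_right₀ ha0
  have h := T_sub_eq_circleIntegral (2 * n) hR hw
  simp only [hiff] at h
  rw [h]
  have hfa : f a ≠ 0 := f_ne_zero (by simp; linarith)
  set A : ℝ → ℂ := fun θ => saddle n a (r + θ * I) * (z ^ (2 * n) * f a) with hA
  set G : ℝ → ℂ := fun θ => A θ * (z / (exp (r + θ * I) - z)) with hG
  have hexp : ∀ θ : ℝ, circleMap 0 (a * Real.exp r) θ = a * exp (r + θ * I) := by
    intro θ
    rw [circleMap, zero_add, exp_add]
    push_cast; ring
  have hne : ∀ θ : ℝ, exp (r + θ * I) - z ≠ 0 := by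
    intro θ h
    rw [sub_eq_zero] at h
    apply hz
    rw [← h, norm_exp]
    simp
  have hG1 : (2 * Real.pi * I)⁻¹ * (∮ ζ in C(0, a * Real.exp r),
      f ζ * (a * z / ζ) ^ (2 * n + 1) / (ζ - a * z)) =
      1 / (2 * Real.pi) * ∫ θ in (0 : ℝ)..2 * Real.pi, G θ := by
    rw [circleIntegral]
    have : ∀ θ : ℝ, deriv (circleMap 0 (a * Real.exp r)) θ • (f (circleMap 0 (a * Real.exp r) θ) *
        (a * z / circleMap 0 (a * Real.exp r) θ) ^ (2 * n + 1) /
          (circleMap 0 (a * Real.exp r) θ - a * z)) = I * G θ := by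
      intro θ
      rw [deriv_circleMap, hexp θ, smul_eq_mul]
      simp only [hG, hA, saddle]
      have e1 : exp (r + θ * I) ≠ 0 := exp_ne_zero _
      have e2 := hne θ
      have e3 : (a : ℂ) ≠ 0 := by exact_mod_cast ha0.ne'
      have e4 : (a * exp (r + θ * I) - a * z : ℂ) ≠ 0 := by
        rw [← mul_sub]; exact mul_ne_zero e3 e2
      have e5 : exp (-(2 * n * (r + θ * I))) = (exp (r + θ * I) ^ (2 * n))⁻¹ := by
        rw [exp_neg, ← exp_nat_mul]; push_cast; rfl
      rw [e5, mul_div_mul_left _ _ e3, div_pow, pow_succ, pow_succ, ← mul_sub]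
      field_simp
    simp_rw [this]
    rw [intervalIntegral.integral_const_mul]
    have : (Real.pi : ℂ) ≠ 0 := by exact_mod_cast Real.pi_ne_zero
    have := I_ne_zero
    field_simp
  have hcont : Continuous G := by
    simp only [hG, hA, saddle]
    have h1 : Continuous fun θ : ℝ => exp (r + θ * I) := by fun_prop
    have h2 : Continuous fun θ : ℝ => f (a * exp (r + θ * I)) :=
      differentiable_f.continuous.comp (by fun_prop)
    exact (((h2.div_const _).mul (by fun_prop)).mul continuous_const).mul
      (continuous_const.div (h1.sub continuous_const) hne)
  have hshift : ∀ θ : ℝ, exp (r + ((θ + Real.pi : ℝ) : ℂ) * I) = -exp (r + θ * I) := by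
    intro θ
    rw [show (r + ((θ + Real.pi : ℝ) : ℂ) * I : ℂ) = (r + θ * I) + Real.pi * I by push_cast; ring,
      exp_add, exp_pi_mul_I]
    ring
  -- f is even and the exponent 2n is even, so this factor has period π. Folding the left half
  -- circle onto the right one adds the kernels at ζ and -ζ, giving `kernel`, and leaves only the
  -- saddle at ζ = 1.
  have hAper : ∀ θ : ℝ, A (θ + Real.pi) = A θ := by
    intro θ
    simp only [hA, saddle]
    rw [hshift, mul_neg, f_neg]
    congr 2
    rw [show -(2 * n * (r + ((θ + Real.pi : ℝ) : ℂ) * I) : ℂ) =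
      -(2 * n * (r + θ * I)) + (-n : ℤ) * (2 * Real.pi * I) by push_cast; ring, exp_add,
      exp_int_mul_two_pi_mul_I, mul_one]
  have hper : Function.Periodic G (2 * Real.pi) := by
    intro θ
    have e1 : A (θ + 2 * Real.pi) = A θ := by
      rw [show θ + 2 * Real.pi = (θ + Real.pi) + Real.pi by ring, hAper, hAper]
    have e2 : exp (r + ((θ + 2 * Real.pi : ℝ) : ℂ) * I) = exp (r + θ * I) := by
      rw [show θ + 2 * Real.pi = (θ + Real.pi) + Real.pi by ring, hshift, hshift, neg_neg]
    simp only [hG]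
    rw [e1, e2]
  have hsplit : (∫ θ in (0 : ℝ)..2 * Real.pi, G θ) =
      ∫ θ in (-(Real.pi / 2))..(Real.pi / 2), A θ * kernel z (r + θ * I) := by
    have e1 := hper.intervalIntegral_add_eq 0 (-(Real.pi / 2))
    rw [zero_add] at e1
    rw [e1, ← intervalIntegral.integral_add_adjacent_intervals (b := Real.pi / 2)
      (hcont.intervalIntegrable _ _) (hcont.intervalIntegrable _ _)]
    have e2 : (∫ θ in (Real.pi / 2)..(-(Real.pi / 2) + 2 * Real.pi), G θ) =
        ∫ θ in (-(Real.pi / 2))..(Real.pi / 2), G (θ + Real.pi) := by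
      rw [intervalIntegral.integral_comp_add_right]
      congr 1 <;> ring
    have hcont' : Continuous (fun θ => G (θ + Real.pi)) := hcont.comp (by fun_prop)
    rw [e2, ← intervalIntegral.integral_add (hcont.intervalIntegrable _ _)
      (hcont'.intervalIntegrable _ _)]
    refine intervalIntegral.integral_congr (fun θ _ => ?_)
    simp only [hG, kernel]
    rw [hAper, hshift, ← mul_add]
    congr 1
    have n1 := hne θ
    have n2 := hne (θ + Real.pi)
    rw [hshift] at n2
    have e3 : exp (2 * (r + θ * I)) = exp (r + θ * I) ^ 2 := by
      rw [← exp_nat_mul]; push_cast; rfl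
    have e4 : exp (2 * (r + θ * I)) - z ^ 2 = (exp (r + θ * I) - z) * (exp (r + θ * I) + z) := by
      rw [e3]; ring
    have n3 : exp (r + θ * I) + z ≠ 0 := by
      intro h; apply n2; linear_combination -h
    rw [e4]
    field_simp
    ring
  rw [hG1, hsplit]
  have : ∀ θ : ℝ, A θ * kernel z (r + θ * I) =
      (z ^ (2 * n) * f a) * (saddle n a (r + θ * I) * kernel z (r + θ * I)) := by
    intro θ; simp only [hA]; ring
  simp_rw [this]
  rw [intervalIntegral.integral_const_mul]
  ring

/-! ### Saddle point asymptotics of the remainder integral. -/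

/-- In a cone `Re w ≤ κ a` with `κ < 1`, `f` is negligible compared with `f a`. -/
theorem eventually_norm_f_le_of_re_le {κ : ℝ} (hκ0 : 0 ≤ κ) (hκ : κ < 1) (B : ℝ) :
    ∀ᶠ a : ℝ in atTop, ∀ w : ℂ, 0 ≤ w.re → w.re ≤ κ * a → ‖w‖ ≤ B * a →
      ‖f w‖ ≤ fReal a * Real.exp (-a) := by
  obtain ⟨C, hC1, hC⟩ := exists_norm_f_le_exp
  -- Since f(w) is at most exp((κ/2) a log a) up to lower order while f(a) is exp((1/2) a log a),
  -- any k strictly between leaves a surplus of order a log a.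
  set k := (κ / 2 + 1 / 2) / 2 with hk
  have hgap : 0 < k - κ / 2 := by rw [hk]; linarith
  filter_upwards [eventually_ge_atTop 2, eventually_ge_atTop C, eventually_ge_atTop (2 + B),
    (Real.tendsto_log_atTop.const_mul_atTop hgap).eventually_ge_atTop 15,
    eventually_log_fReal_bounds (k := k) (K := 1) (by rw [hk]; linarith) (by norm_num)]
    with a ha haC haB hlog hF w hw0 hw hwn
  have hla : 0 ≤ Real.log a := Real.log_nonneg (by linarith)
  have hla2 : Real.log a ≤ a := (Real.log_le_sub_one_of_pos (by linarith)).trans (by linarith)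
  have h1 : C * (2 + ‖w‖) ^ 6 ≤ Real.exp (13 * Real.log a) := by
    calc C * (2 + ‖w‖) ^ 6 ≤ a * (a ^ 2) ^ 6 := by
          gcongr
          nlinarith
      _ = Real.exp (13 * Real.log a) := by
          rw [show (13 : ℝ) * Real.log a = (13 : ℕ) * Real.log a by norm_num,
            Real.exp_nat_mul, Real.exp_log (by linarith)]
          ring
  have h2 : w.re / 2 * Real.log (2 + w.re) ≤ κ / 2 * (a * Real.log a) + 1 := by
    have h3 : Real.log (2 + w.re) ≤ Real.log a + 2 / a := by
      have : 2 + w.re ≤ a * (1 + 2 / a) := by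
        rw [mul_add, mul_div_cancel₀ _ (by linarith : a ≠ 0)]; nlinarith
      refine (Real.log_le_log (by linarith) this).trans ?_
      rw [Real.log_mul (by linarith) (by positivity)]
      have := Real.log_le_sub_one_of_pos (by positivity : 0 < 1 + 2 / a)
      linarith
    calc w.re / 2 * Real.log (2 + w.re) ≤ κ * a / 2 * (Real.log a + 2 / a) := by
          gcongr
          exact Real.log_nonneg (by linarith)
      _ = κ / 2 * (a * Real.log a) + κ := by field_simp
      _ ≤ _ := by linarith
  have h3 : ‖f w‖ ≤ Real.exp (13 * Real.log a + (κ / 2 * (a * Real.log a) + 1)) := by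
    rw [Real.exp_add]
    refine (hC w hw0).trans ?_
    gcongr
  rw [← Real.exp_log (fReal_pos (by linarith : 1 / 2 < a)), ← Real.exp_add]
  refine h3.trans (Real.exp_le_exp.2 ?_)
  have h4 : 15 * a ≤ (k - κ / 2) * Real.log a * a := by gcongr
  nlinarith [hF.1]

lemma one_sub_exp_neg_ge {x : ℝ} (hx0 : 0 ≤ x) (hx : x ≤ 1) : x / 2 ≤ 1 - Real.exp (-x) := by
  have h := Real.add_one_le_exp x
  rw [Real.exp_neg]
  have h2 : (Real.exp x)⁻¹ ≤ (x + 1)⁻¹ := inv_anti₀ (by linarith) h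
  have h3 : (x + 1)⁻¹ ≤ 1 - x / 2 := by
    rw [inv_le_iff_one_le_mul₀ (by linarith)]
    nlinarith
  linarith

/-- The kernel is at most linearly large on the contour `‖exp τ‖ = exp (-1/n)`. -/
lemma eventually_norm_kernel_le (z : ℂ) : ∀ᶠ n : ℕ in atTop, ∀ θ : ℝ,
    ‖kernel z (((-1 / n : ℝ) : ℂ) + θ * Complex.I)‖ ≤ 2 * ‖z‖ ^ 2 * n := by
  have key : ∀ᶠ n : ℕ in atTop, 1 / (n : ℝ) ≤ |Real.exp (-(2 / n)) - ‖z‖ ^ 2| := by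
    rcases lt_or_ge ‖z‖ 1 with hz | hz
    · have t0 : Tendsto (fun n : ℕ => (2 : ℝ) / n) atTop (𝓝 0) :=
        (tendsto_const_div_atTop 2).comp tendsto_natCast_atTop_atTop
      have t1 : Tendsto (fun n : ℕ => |Real.exp (-(2 / n)) - ‖z‖ ^ 2|) atTop
          (𝓝 |Real.exp (-0) - ‖z‖ ^ 2|) :=
        (((Real.continuous_exp.tendsto _).comp t0.neg).sub_const _).abs
      have t2 : Tendsto (fun n : ℕ => (1 : ℝ) / n) atTop (𝓝 0) :=
        (tendsto_const_div_atTop 1).comp tendsto_natCast_atTop_atTop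
      have hpos : 0 < |Real.exp (-0) - ‖z‖ ^ 2| := by
        rw [neg_zero, Real.exp_zero, abs_pos]
        nlinarith [norm_nonneg z]
      filter_upwards [t2.eventually_lt t1 hpos] with n hn using hn.le
    -- For |z| ≥ 1 the gap is at least 1 - e^{-2/n} ≥ 1/n. Its order is attained when |z| = 1, which
    -- is why the bound on the kernel grows with n.
    · filter_upwards [eventually_ge_atTop 2] with n hn
      have hn' : (2 : ℝ) ≤ n := by exact_mod_cast hn
      have h1 := one_sub_exp_neg_ge (x := 2 / n) (by positivity)
        (by rw [div_le_one (by linarith)]; exact hn')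
      rw [abs_sub_comm]
      refine le_trans ?_ (le_abs_self _)
      have : (1 : ℝ) / n = 2 / n / 2 := by field_simp
      nlinarith
  filter_upwards [key, eventually_gt_atTop 0] with n hn hn0 θ
  have hn0' : (0 : ℝ) < n := by exact_mod_cast hn0
  unfold kernel
  rw [norm_div, norm_mul, norm_pow]
  have h2 : ‖(2 : ℂ)‖ = 2 := by norm_num
  rw [h2, div_le_iff₀']
  · have h1 : 1 / (n : ℝ) ≤
        ‖Complex.exp (2 * (((-1 / n : ℝ) : ℂ) + θ * Complex.I)) - z ^ 2‖ := by
      refine hn.trans ?_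
      have := abs_norm_sub_norm_le
        (Complex.exp (2 * (((-1 / n : ℝ) : ℂ) + θ * Complex.I))) (z ^ 2)
      rw [Complex.norm_exp, norm_pow] at this
      convert! this using 3
      simp
      ring
    calc 2 * ‖z‖ ^ 2 = 1 / n * (2 * ‖z‖ ^ 2 * n) := by field_simp
      _ ≤ _ := by gcongr
  · have := hn.trans' (by positivity : 0 < 1 / (n : ℝ)).le
    have h1 : 0 < |Real.exp (-(2 / n)) - ‖z‖ ^ 2| := lt_of_lt_of_le (by positivity) hn
    refine lt_of_lt_of_le h1 ?_
    have := abs_norm_sub_norm_le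
        (Complex.exp (2 * (((-1 / n : ℝ) : ℂ) + θ * Complex.I))) (z ^ 2)
    rw [Complex.norm_exp, norm_pow] at this
    convert! this using 3
    simp
    ring

lemma exists_norm_kernel_le {z : ℂ} (hz : z ^ 2 ≠ 1) : ∃ δ > 0, ∃ B, 0 ≤ B ∧ ∀ τ : ℂ,
    ‖τ‖ < δ → ‖kernel z τ‖ ≤ B := by
  have hc : ContinuousAt (kernel z) 0 := by
    unfold kernel
    refine ContinuousAt.div continuousAt_const (by fun_prop) ?_
    simp only [mul_zero, Complex.exp_zero]
    exact sub_ne_zero.2 (Ne.symm hz)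
  have := hc.norm.eventually (gt_mem_nhds (by linarith : ‖kernel z 0‖ < ‖kernel z 0‖ + 1))
  obtain ⟨δ, hδ, hb⟩ := Metric.eventually_nhds_iff_ball.1 this
  exact ⟨δ, hδ, ‖kernel z 0‖ + 1, by positivity, fun τ hτ => (hb τ (by simpa using hτ)).le⟩

/-- Orders of magnitude of the quantities attached to the scaling parameter. -/
lemma eventually_scale_bounds {lam : ℕ → ℝ} (h : ∀ᶠ n : ℕ in atTop, IsScale n (lam n)) :
    ∀ᶠ n : ℕ in atTop, 4 ≤ lam n ∧ scaleFun (lam n) = 2 * n ∧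
      lam n * Real.log (lam n) / 4 ≤ phaseCurv (lam n) ∧
      phaseCurv (lam n) ≤ 1000 * (lam n * Real.log (lam n)) ∧
      2 * n ≤ lam n * Real.log (lam n) ∧ lam n * Real.log (lam n) ≤ 8 * n ∧
      lam n ≤ lam n * Real.log (lam n) := by
  have ht := tendsto_of_isScale h
  filter_upwards [h, eventually_gt_atTop 0, ht.eventually_ge_atTop 4,
    ht.eventually (Real.tendsto_log_atTop.eventually_ge_atTop 8),
    ht.eventually (eventually_lamSlope_bounds (k := 3 / 8) (K := 1) (by norm_num) (by norm_num)),
    ht.eventually (eventually_scaleFun_bounds (k := 1 / 4) (K := 1) (by norm_num) (by norm_num)),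
    ht.eventually eventually_exists_phase] with n hn hn0 ha hl hs hg hp
  have hg2 := ((isScale_iff hn0.ne').1 hn).2
  have hc := phaseCurv_ge (by linarith : 2 ≤ lam n)
  rw [hg2] at hg
  refine ⟨ha, hg2, ?_, hp.1, by linarith [hg.2], by linarith [hg.1], by nlinarith⟩
  refine le_trans ?_ hc
  have : Real.log (lam n) / 4 ≤ lamSlope (lam n) - 1 := by linarith [hs.1]
  calc _ = lam n * (Real.log (lam n) / 4) := by ring
    _ ≤ _ := mul_le_mul_of_nonneg_left this (by linarith)

/-- At a scale, `scaleFun (lam n) = 2 * n`, so the exponential of the phase is exactly the integrand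
`saddle`. -/
lemma exists_phase_seq {lam : ℕ → ℝ} (h : ∀ᶠ n : ℕ in atTop, IsScale n (lam n)) :
    ∃ H : ℕ → ℂ → ℂ, ∀ᶠ n : ℕ in atTop, ∀ τ : ℂ, ‖τ‖ < 1 / 2 →
      Complex.exp (H n τ) = saddle n (lam n) τ ∧ ‖H n τ - phaseCurv (lam n) / 2 * τ ^ 2‖ ≤
        2000 * (lam n * Real.log (lam n)) * ‖τ‖ ^ 3 := by
  have : ∀ᶠ n : ℕ in atTop, ∃ H : ℂ → ℂ, ∀ τ : ℂ, ‖τ‖ < 1 / 2 →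
      Complex.exp (H τ) = saddle n (lam n) τ ∧ ‖H τ - phaseCurv (lam n) / 2 * τ ^ 2‖ ≤
        2000 * (lam n * Real.log (lam n)) * ‖τ‖ ^ 3 := by
    filter_upwards [(tendsto_of_isScale h).eventually eventually_exists_phase,
      eventually_scale_bounds h] with n hn hb
    obtain ⟨H, hH1, hH2⟩ := hn.2
    refine ⟨H, fun τ hτ => ⟨?_, hH2 τ hτ⟩⟩
    rw [hH1 τ (by simp; linarith), saddle, hb.2.1]
    push_cast; rfl
  exact this.choice

lemma norm_phase_remainder {M x y : ℝ} (hM : 0 ≤ M) {τ : ℂ} (hx : 0 ≤ x) (hy : 0 ≤ y)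
    (hτ : ‖τ‖ ≤ x + y) : 2000 * M * ‖τ‖ ^ 3 ≤ 8000 * M * x ^ 3 + 8000 * M * y ^ 3 := by
  have h1 : (x + y) ^ 3 ≤ 4 * x ^ 3 + 4 * y ^ 3 := by
    nlinarith [mul_nonneg (add_nonneg hx hy) (sq_nonneg (x - y))]
  calc 2000 * M * ‖τ‖ ^ 3 ≤ 2000 * M * (x + y) ^ 3 := by gcongr
    _ ≤ 2000 * M * (4 * x ^ 3 + 4 * y ^ 3) := by gcongr
    _ = _ := by ring

/-- The points of the integration contour. -/
noncomputable def contourPt (n : ℕ) (θ : ℝ) : ℂ := ((-1 / n : ℝ) : ℂ) + θ * Complex.I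

lemma norm_contourPt_le (n : ℕ) (θ : ℝ) : ‖contourPt n θ‖ ≤ 1 / n + |θ| := by
  unfold contourPt
  refine (norm_add_le _ _).trans ?_
  rw [norm_mul, Complex.norm_I, mul_one, Complex.norm_real, Complex.norm_real, Real.norm_eq_abs,
    Real.norm_eq_abs, abs_div, abs_neg, abs_one, Nat.abs_cast]

lemma re_contour_sq (n : ℕ) (θ W : ℝ) :
    (W / 2 * contourPt n θ ^ 2 : ℂ).re = W / 2 * (1 / n ^ 2 - θ ^ 2) := by
  have : (W / 2 * contourPt n θ ^ 2 : ℂ) = ((W / 2 : ℝ) : ℂ) * contourPt n θ ^ 2 := by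
    push_cast; rfl
  rw [this, Complex.re_ofReal_mul]
  congr 1
  unfold contourPt
  rw [sq]
  simp
  ring

lemma continuous_saddle_contour (n : ℕ) (a : ℝ) : Continuous fun θ => saddle n a (contourPt n θ) := by
  unfold saddle contourPt
  have h2 : Continuous fun θ : ℝ => f (a * Complex.exp (((-1 / n : ℝ) : ℂ) + θ * Complex.I)) :=
      differentiable_f.continuous.comp (by fun_prop)
  exact (h2.div_const _).mul (by fun_prop)

lemma measurable_kernel_contour (n : ℕ) (z : ℂ) : Measurable fun θ => kernel z (contourPt n θ) := by
  unfold kernel contourPt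
  have h : Continuous fun θ : ℝ =>
      Complex.exp (2 * (((-1 / n : ℝ) : ℂ) + θ * Complex.I)) - z ^ 2 := by fun_prop
  exact measurable_const.div h.measurable

-- Laplace's method: with θ = u/√W the integrand tends to e^{-u²/2} times the kernel at 0. The shift
-- of the contour by 1/n is harmless because W is comparable to n, so W/n² → 0. The bound on δ is
-- chosen so that the cubic error 32000 Wδθ² is at most u²/4, which leaves an integrable Gaussian.
open MeasureTheory in
lemma tendsto_near_integral {lam : ℕ → ℝ} (h : ∀ᶠ n : ℕ in atTop, IsScale n (lam n)) {z : ℂ}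
    (hz : z ^ 2 ≠ 1) {δ B : ℝ} (hδ0 : 0 < δ) (hδ : δ ≤ 1 / 128000) (hB0 : 0 ≤ B)
    (hB : ∀ τ : ℂ, ‖τ‖ < 2 * δ → ‖kernel z τ‖ ≤ B) :
    Tendsto (fun n : ℕ => (√(phaseCurv (lam n)) : ℂ) *
      ∫ θ in (-δ)..δ, saddle n (lam n) (contourPt n θ) * kernel z (contourPt n θ)) atTop
      (𝓝 (√(2 * Real.pi) * kernel z 0)) := by
  obtain ⟨H, hH⟩ := exists_phase_seq h
  have hb := eventually_scale_bounds h
  have hlamt := tendsto_of_isScale h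
  set W : ℕ → ℝ := fun n => phaseCurv (lam n) with hW
  set g : ℕ → ℝ → ℂ := fun n θ => saddle n (lam n) (contourPt n θ) * kernel z (contourPt n θ)
    with hg
  have tn : Tendsto (fun n : ℕ => (n : ℝ)) atTop atTop := tendsto_natCast_atTop_atTop
  have tWtop : Tendsto W atTop atTop := by
    refine tendsto_atTop_mono' _ ?_ (hlamt.atTop_div_const (by norm_num : (0 : ℝ) < 4))
    filter_upwards [hb] with n hn
    linarith [hn.2.2.1, hn.2.2.2.2.2.2]
  have tsq : Tendsto (fun n => √(W n)) atTop atTop := Real.tendsto_sqrt_atTop.comp tWtop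
  have tWn : Tendsto (fun n : ℕ => W n / n ^ 2) atTop (𝓝 0) := by
    refine squeeze_zero' ?_ ?_ ((tendsto_const_div_atTop 8000).comp tn)
    · filter_upwards [tWtop.eventually_ge_atTop 0] with n hn
      positivity
    · filter_upwards [hb, eventually_gt_atTop 0] with n hn hn0
      have : (0 : ℝ) < n := by exact_mod_cast hn0
      simp only [Function.comp_apply]
      rw [div_le_div_iff₀ (by positivity) this]
      have h1 : W n ≤ 8000 * n := by linarith [hn.2.2.2.1, hn.2.2.2.2.2.1]
      nlinarith
  have hset : ∀ᶠ n : ℕ in atTop, (√(W n) : ℂ) * ∫ θ in (-δ)..δ, g n θ =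
      ∫ u : ℝ, (Set.Ioc (-(δ * √(W n))) (δ * √(W n))).indicator (fun u => g n (u / √(W n))) u := by
    filter_upwards [tsq.eventually_gt_atTop 0] with n hn
    rw [integral_indicator measurableSet_Ioc,
      ← intervalIntegral.integral_of_le (by nlinarith), intervalIntegral.integral_comp_div _ hn.ne',
      neg_div, mul_div_cancel_right₀ _ hn.ne', Complex.real_smul]
  have hgauss : ∫ u : ℝ, Complex.exp (-(u ^ 2 / 2 : ℝ)) * kernel z 0 =
      √(2 * Real.pi) * kernel z 0 := by
    rw [integral_mul_const]
    congr 1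
    have := integral_gaussian (1 / 2)
    rw [show Real.pi / (1 / 2) = 2 * Real.pi by ring] at this
    rw [← this, ← integral_complex_ofReal]
    refine integral_congr_ae (Eventually.of_forall fun u => ?_)
    simp only [Complex.ofReal_exp]
    congr 1
    push_cast
    ring
  rw [← hgauss]
  refine Tendsto.congr' (EventuallyEq.symm hset) ?_
  -- The factor e in the majorant covers the θ-independent terms W/(2n²) + 64000/n², eventually less
  -- than 1.
  refine tendsto_integral_filter_of_dominated_convergence
    (fun u => Real.exp 1 * B * Real.exp (-(1 / 4) * u ^ 2)) ?_ ?_ ?_ ?_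
  · refine Eventually.of_forall fun n => ?_
    have h1 : Measurable (g n) :=
      (continuous_saddle_contour n (lam n)).measurable.mul (measurable_kernel_contour n z)
    exact ((h1.comp (measurable_id.div_const _)).indicator measurableSet_Ioc).aestronglyMeasurable
  · have t1 : Tendsto (fun n : ℕ => W n / n ^ 2 / 2 + 64000 / (n : ℝ) ^ 2) atTop (𝓝 (0 / 2 + 0)) :=
      (tWn.div_const 2).add (tendsto_const_nhds.div_atTop ((tendsto_pow_atTop two_ne_zero).comp tn))
    filter_upwards [hb, hH, tsq.eventually_gt_atTop 0, eventually_gt_atTop 0,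
      t1.eventually (gt_mem_nhds (by norm_num : (0 : ℝ) / 2 + 0 < 1)),
      tn.eventually_gt_atTop (1 / δ)] with n hn hHn hs hn0 hsmall hnδ
    refine Eventually.of_forall fun u => ?_
    have hn0' : (0 : ℝ) < n := by exact_mod_cast hn0
    by_cases hu : u ∈ Set.Ioc (-(δ * √(W n))) (δ * √(W n))
    · rw [Set.indicator_of_mem hu]
      set θ := u / √(W n) with hθ
      have hθδ : |θ| ≤ δ := by
        rw [hθ, abs_div, abs_of_pos hs, div_le_iff₀ hs]
        exact abs_le.2 ⟨hu.1.le, hu.2⟩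
      have hnδ' : 1 / (n : ℝ) < δ := by
        rw [div_lt_iff₀ hn0']; rw [div_lt_iff₀ hδ0] at hnδ; linarith
      have hτ := norm_contourPt_le n θ
      have hτδ : ‖contourPt n θ‖ < 2 * δ := by linarith
      obtain ⟨e1, e2⟩ := hHn (contourPt n θ) (by linarith)
      set M := lam n * Real.log (lam n) with hM
      have hM0 : 0 ≤ M := by linarith [hn.1, hn.2.2.2.2.2.2]
      have hW4 : M ≤ 4 * W n := by linarith [hn.2.2.1]
      have hMn : M ≤ 8 * n := hn.2.2.2.2.2.1
      have hrem := norm_phase_remainder hM0 (by positivity : (0 : ℝ) ≤ 1 / n) (abs_nonneg θ) hτ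
      have hWθ : W n * θ ^ 2 = u ^ 2 := by
        rw [hθ, div_pow, Real.sq_sqrt (Real.sqrt_pos.1 hs).le]
        field_simp [(Real.sqrt_pos.1 hs).ne']
      have hr1 : 8000 * M * (1 / (n : ℝ)) ^ 3 ≤ 64000 / (n : ℝ) ^ 2 := by
        calc 8000 * M * (1 / (n : ℝ)) ^ 3 ≤ 8000 * (8 * n) * (1 / (n : ℝ)) ^ 3 := by gcongr
          _ = _ := by field_simp; ring
      have hr2 : 8000 * M * |θ| ^ 3 ≤ u ^ 2 / 4 := by
        calc 8000 * M * |θ| ^ 3 = 8000 * M * (|θ| * θ ^ 2) := by rw [← sq_abs θ]; ring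
          _ ≤ 8000 * (4 * W n) * ((1 / 128000) * θ ^ 2) := by
              have : 0 ≤ 8000 * (4 * W n) := by linarith
              have := hθδ.trans hδ
              gcongr
          _ = W n * θ ^ 2 / 4 := by ring
          _ = _ := by rw [hWθ]
      have hre : (H n (contourPt n θ)).re ≤ 1 + -(1 / 4) * u ^ 2 := by
        have h1 := (Complex.re_le_norm _).trans e2
        rw [Complex.sub_re, re_contour_sq] at h1
        have h2 : W n / 2 * (1 / (n : ℝ) ^ 2 - θ ^ 2) = W n / n ^ 2 / 2 - u ^ 2 / 2 := by
          rw [mul_sub, ← hWθ]; ring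
        change (H n (contourPt n θ)).re - W n / 2 * (1 / (n : ℝ) ^ 2 - θ ^ 2) ≤ _ at h1
        rw [h2] at h1
        linarith
      simp only [hg]
      rw [norm_mul, ← e1, Complex.norm_exp]
      calc _ ≤ Real.exp (1 + -(1 / 4) * u ^ 2) * B := by
            gcongr
            exact hB _ hτδ
        _ = _ := by rw [Real.exp_add]; ring
    · rw [Set.indicator_of_notMem hu, norm_zero]
      positivity
  · exact (integrable_exp_neg_mul_sq (by norm_num)).const_mul _
  · refine Eventually.of_forall fun u => ?_
    set θ : ℕ → ℝ := fun n => u / √(W n) with hθ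
    have tθ : Tendsto θ atTop (𝓝 0) := tendsto_const_nhds.div_atTop tsq
    have tinv : Tendsto (fun n : ℕ => 1 / (n : ℝ)) atTop (𝓝 0) :=
      (tendsto_const_div_atTop 1).comp tn
    have tτ : Tendsto (fun n => contourPt n (θ n)) atTop (𝓝 0) := by
      refine squeeze_zero_norm (fun n => norm_contourPt_le n (θ n)) ?_
      simpa using tinv.add tθ.abs
    have tK : Tendsto (fun n => kernel z (contourPt n (θ n))) atTop (𝓝 (kernel z 0)) := by
      have hc : ContinuousAt (kernel z) 0 := by
        unfold kernel
        refine ContinuousAt.div continuousAt_const (by fun_prop) ?_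
        simp only [mul_zero, Complex.exp_zero]
        exact sub_ne_zero.2 (Ne.symm hz)
      exact hc.tendsto.comp tτ
    have tquad : Tendsto (fun n => (W n / 2 * contourPt n (θ n) ^ 2 : ℂ)) atTop
        (𝓝 (-(u ^ 2 / 2 : ℝ))) := by
      have t1 : Tendsto (fun n : ℕ => √(W n) / n) atTop (𝓝 0) := by
        have := (Real.continuous_sqrt.tendsto 0).comp tWn
        rw [Real.sqrt_zero] at this
        refine this.congr (fun n => ?_)
        simp only [Function.comp_apply]
        rw [Real.sqrt_div' _ (by positivity), Real.sqrt_sq (by positivity)]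
      have t2 : Tendsto (fun n : ℕ => (((W n / n ^ 2 / 2 : ℝ) : ℂ) -
          ((u * (√(W n) / n) : ℝ) : ℂ) * Complex.I) + ((-(u ^ 2 / 2) : ℝ) : ℂ)) atTop
          (𝓝 ((((0 / 2 : ℝ) : ℂ) - ((u * 0 : ℝ) : ℂ) * Complex.I) + ((-(u ^ 2 / 2) : ℝ) : ℂ))) :=
        (((Complex.continuous_ofReal.tendsto _).comp (tWn.div_const 2)).sub
          (((Complex.continuous_ofReal.tendsto _).comp (t1.const_mul u)).mul_const _)).add_const _
      have e0 : (((0 / 2 : ℝ) : ℂ) - ((u * 0 : ℝ) : ℂ) * Complex.I) + ((-(u ^ 2 / 2) : ℝ) : ℂ) =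
          -(u ^ 2 / 2 : ℝ) := by push_cast; ring
      rw [e0] at t2
      refine t2.congr' ?_
      filter_upwards [tsq.eventually_gt_atTop 0, eventually_gt_atTop 0] with n hs hn0
      have hn0' : (n : ℂ) ≠ 0 := by exact_mod_cast hn0.ne'
      have hWs : (W n : ℂ) = (√(W n) : ℂ) ^ 2 := by
        rw [← Complex.ofReal_pow, Real.sq_sqrt (Real.sqrt_pos.1 hs).le]
      have hs' : (√(W n) : ℂ) ≠ 0 := by exact_mod_cast hs.ne'
      simp only [hθ, contourPt]
      push_cast
      rw [hWs]
      field_simp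
      linear_combination (-(n : ℂ) ^ 2 * u ^ 2) * Complex.I_sq
    have terr : Tendsto (fun n => H n (contourPt n (θ n)) - (W n / 2 * contourPt n (θ n) ^ 2 : ℂ))
        atTop (𝓝 0) := by
      have tb : Tendsto (fun n : ℕ => 64000 * (1 / (n : ℝ)) ^ 2 + 32000 * (u ^ 2 * |θ n|))
          atTop (𝓝 (64000 * 0 ^ 2 + 32000 * (u ^ 2 * |0|))) :=
        ((tinv.pow 2).const_mul _).add ((tθ.abs.const_mul _).const_mul _)
      simp only [abs_zero, mul_zero, ne_eq, OfNat.ofNat_ne_zero, not_false_eq_true, zero_pow,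
        add_zero] at tb
      refine squeeze_zero_norm' ?_ tb
      filter_upwards [hb, hH, tsq.eventually_gt_atTop 0, eventually_gt_atTop 0,
        tτ.norm.eventually (gt_mem_nhds (by norm_num : ‖(0 : ℂ)‖ < 1 / 2))] with n hn hHn hs hn0 hτ
      have hn0' : (0 : ℝ) < n := by exact_mod_cast hn0
      refine ((hHn _ hτ).2).trans ?_
      set M := lam n * Real.log (lam n) with hM
      have hM0 : 0 ≤ M := by linarith [hn.1, hn.2.2.2.2.2.2]
      have hW4 : M ≤ 4 * W n := by linarith [hn.2.2.1]
      have hMn : M ≤ 8 * n := hn.2.2.2.2.2.1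
      refine (norm_phase_remainder hM0 (by positivity : (0 : ℝ) ≤ 1 / n) (abs_nonneg (θ n))
        (norm_contourPt_le n (θ n))).trans ?_
      have hWθ : W n * θ n ^ 2 = u ^ 2 := by
        simp only [hθ]
        rw [div_pow, Real.sq_sqrt (Real.sqrt_pos.1 hs).le]
        field_simp [(Real.sqrt_pos.1 hs).ne']
      have hr1 : 8000 * M * (1 / (n : ℝ)) ^ 3 ≤ 64000 * (1 / (n : ℝ)) ^ 2 := by
        calc 8000 * M * (1 / (n : ℝ)) ^ 3 ≤ 8000 * (8 * n) * (1 / (n : ℝ)) ^ 3 := by gcongr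
          _ = _ := by field_simp; ring
      have hr2 : 8000 * M * |θ n| ^ 3 ≤ 32000 * (u ^ 2 * |θ n|) := by
        calc 8000 * M * |θ n| ^ 3 = 8000 * M * (|θ n| * θ n ^ 2) := by rw [← sq_abs (θ n)]; ring
          _ ≤ 8000 * (4 * W n) * (|θ n| * θ n ^ 2) := by gcongr
          _ = 32000 * (W n * θ n ^ 2 * |θ n|) := by ring
          _ = _ := by rw [hWθ]
      linarith
    have tH : Tendsto (fun n => H n (contourPt n (θ n))) atTop (𝓝 (-(u ^ 2 / 2 : ℝ))) := by
      have := terr.add tquad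
      simpa using this
    have tlim := ((Complex.continuous_exp.tendsto _).comp tH).mul tK
    refine tlim.congr' ?_
    filter_upwards [hH, (tsq.const_mul_atTop hδ0).eventually_gt_atTop |u|,
      tτ.norm.eventually (gt_mem_nhds (by norm_num : ‖(0 : ℂ)‖ < 1 / 2))] with n hHn hu hτ
    have hmem : u ∈ Set.Ioc (-(δ * √(W n))) (δ * √(W n)) :=
      ⟨(abs_lt.1 hu).1, (abs_lt.1 hu).2.le⟩
    rw [Set.indicator_of_mem hmem]
    simp only [hg, Function.comp_apply]
    rw [(hHn _ hτ).1]

/-- Away from the saddle Re(e^τ) ≤ cos δ < 1, so the cone estimate applies. On the contour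
|e^{-2nτ}| is the constant e². -/
lemma eventually_norm_saddle_le {lam : ℕ → ℝ} (h : ∀ᶠ n : ℕ in atTop, IsScale n (lam n)) {δ : ℝ}
    (hδ0 : 0 < δ) (hδ : δ ≤ 1) : ∀ᶠ n : ℕ in atTop, ∀ θ : ℝ, δ ≤ |θ| → |θ| ≤ Real.pi / 2 →
      ‖saddle n (lam n) (contourPt n θ)‖ ≤ Real.exp 2 * Real.exp (-lam n) := by
  have hpi := Real.pi_gt_three
  have hκ0 : 0 ≤ Real.cos δ := Real.cos_nonneg_of_mem_Icc ⟨by linarith, by linarith⟩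
  have hκ : Real.cos δ < 1 := by
    rw [← Real.cos_zero]
    exact Real.cos_lt_cos_of_nonneg_of_le_pi le_rfl (by linarith) hδ0
  filter_upwards [(tendsto_of_isScale h).eventually (eventually_norm_f_le_of_re_le hκ0 hκ 1),
    eventually_gt_atTop 0, eventually_scale_bounds h] with n hn hn0 hb θ h1 h2
  have ha : 4 ≤ lam n := hb.1
  have hn0' : (0 : ℝ) < n := by exact_mod_cast hn0
  set w : ℂ := lam n * Complex.exp (contourPt n θ) with hw
  have hre : (contourPt n θ).re = -1 / n := by simp [contourPt]
  have him : (contourPt n θ).im = θ := by simp [contourPt]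
  have hcos0 : 0 ≤ Real.cos θ := Real.cos_nonneg_of_mem_Icc (by
    rw [abs_le] at h2; exact ⟨h2.1, h2.2⟩)
  have hcos : Real.cos θ ≤ Real.cos δ := by
    rw [← Real.cos_abs θ]
    exact Real.cos_le_cos_of_nonneg_of_le_pi hδ0.le (by linarith) h1
  have hexp : Real.exp (-1 / n) ≤ 1 := by
    rw [Real.exp_le_one_iff]
    exact div_nonpos_of_nonpos_of_nonneg (by norm_num) hn0'.le
  have hwre : w.re = lam n * (Real.exp (-1 / n) * Real.cos θ) := by
    rw [hw, Complex.re_ofReal_mul, Complex.exp_re, hre, him]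
  have hfw := hn w (by rw [hwre]; positivity) (by
    rw [hwre, mul_comm]
    gcongr
    calc _ ≤ 1 * Real.cos δ := by gcongr
      _ = _ := one_mul _) (by
    rw [hw, norm_mul, Complex.norm_real, Real.norm_of_nonneg (by linarith), Complex.norm_exp, hre,
      mul_comm]
    gcongr)
  have hF := fReal_pos (by linarith : 1 / 2 < lam n)
  unfold saddle
  rw [norm_mul, norm_div, norm_f_ofReal (by linarith), Complex.norm_exp]
  have e : (-(2 * n * contourPt n θ) : ℂ).re = 2 := by
    have : (-(2 * n * contourPt n θ) : ℂ) = ((-(2 * n) : ℝ) : ℂ) * contourPt n θ := by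
      push_cast; ring
    rw [this, Complex.re_ofReal_mul, hre]
    field_simp
  rw [e, mul_comm]
  gcongr
  rw [div_le_iff₀ hF]
  exact hfw.trans (le_of_eq (mul_comm _ _))

/-- Saddle point asymptotics of the remainder integral. -/
theorem tendsto_saddle_integral {lam : ℕ → ℝ} (h : ∀ᶠ n : ℕ in atTop, IsScale n (lam n)) {z : ℂ}
    (hz : z ^ 2 ≠ 1) :
    Tendsto (fun n : ℕ => (√(phaseCurv (lam n)) : ℂ) * ∫ θ in (-(Real.pi / 2))..(Real.pi / 2),
      saddle n (lam n) (contourPt n θ) * kernel z (contourPt n θ)) atTop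
      (𝓝 (√(2 * Real.pi) * kernel z 0)) := by
  have hpi := Real.pi_gt_three
  obtain ⟨δ₁, hδ₁, B, hB0, hB⟩ := exists_norm_kernel_le hz
  set δ := min (δ₁ / 2) (1 / 128000) with hδdef
  have hδ0 : 0 < δ := by positivity
  have hδ : δ ≤ 1 / 128000 := min_le_right _ _
  have hδ2 : 2 * δ ≤ δ₁ := by linarith [min_le_left (δ₁ / 2) (1 / 128000)]
  have hnear := tendsto_near_integral h hz hδ0 hδ hB0 (fun τ hτ => hB τ (hτ.trans_le hδ2))
  set g : ℕ → ℝ → ℂ := fun n θ => saddle n (lam n) (contourPt n θ) * kernel z (contourPt n θ)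
    with hg
  have hlamt := tendsto_of_isScale h
  have hbound : ∀ᶠ n : ℕ in atTop, ∀ θ : ℝ, δ ≤ |θ| → |θ| ≤ Real.pi / 2 →
      ‖g n θ‖ ≤ Real.exp 2 * Real.exp (-lam n) * (2 * ‖z‖ ^ 2 * n) := by
    filter_upwards [eventually_norm_saddle_le h hδ0 (by linarith), eventually_norm_kernel_le z]
      with n h1 h2 θ h3 h4
    simp only [hg]
    rw [norm_mul]
    have := h1 θ h3 h4
    have := h2 θ
    unfold contourPt at *
    gcongr
  have hmeas : ∀ n, Measurable (g n) := fun n =>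
    (continuous_saddle_contour n (lam n)).measurable.mul (measurable_kernel_contour n z)
  have hint : ∀ᶠ n : ℕ in atTop, ∀ a b : ℝ, IntervalIntegrable (g n) MeasureTheory.volume a b := by
    filter_upwards [eventually_norm_kernel_le z] with n hn a b
    refine IntervalIntegrable.continuousOn_mul ?_ (continuous_saddle_contour n (lam n)).continuousOn
    refine (intervalIntegrable_const (c := 2 * ‖z‖ ^ 2 * (n : ℝ))).mono_fun
      (measurable_kernel_contour n z).aestronglyMeasurable (Eventually.of_forall fun θ => ?_)
    exact (hn θ).trans (Real.le_norm_self _)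
  have hfar : Tendsto (fun n : ℕ => (√(phaseCurv (lam n)) : ℂ) *
      ((∫ θ in (-(Real.pi / 2))..(-δ), g n θ) + ∫ θ in δ..(Real.pi / 2), g n θ)) atTop (𝓝 0) := by
    -- One factor λ² bounds √W up to a constant, the other bounds the n coming from the kernel
    -- estimate.
    have tb : Tendsto (fun n : ℕ => (2000 * (Real.exp 2 * (2 * ‖z‖ ^ 2)) * Real.pi) *
        (lam n ^ 4 * Real.exp (-lam n))) atTop (𝓝 0) := by
      have := ((Real.tendsto_pow_mul_exp_neg_atTop_nhds_zero 4).comp hlamt).const_mul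
        (2000 * (Real.exp 2 * (2 * ‖z‖ ^ 2)) * Real.pi)
      simpa using this
    refine squeeze_zero_norm' ?_ tb
    filter_upwards [hbound, eventually_scale_bounds h] with n hn hb
    have ha : 4 ≤ lam n := hb.1
    have hla : Real.log (lam n) ≤ lam n :=
      (Real.log_le_sub_one_of_pos (by linarith)).trans (by linarith)
    set K := Real.exp 2 * Real.exp (-lam n) * (2 * ‖z‖ ^ 2 * n) with hK
    have hK0 : 0 ≤ K := by positivity
    have i1 : ‖∫ θ in (-(Real.pi / 2))..(-δ), g n θ‖ ≤ K * (Real.pi / 2) := by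
      refine (intervalIntegral.norm_integral_le_of_norm_le_const (C := K) (fun θ hθ => ?_)).trans ?_
      · rw [Set.uIoc_of_le (by linarith)] at hθ
        have : |θ| = -θ := abs_of_nonpos (by linarith [hθ.2])
        exact hn θ (by linarith [hθ.2]) (by linarith [hθ.1])
      · gcongr
        rw [abs_of_nonneg (by linarith)]
        linarith
    have i2 : ‖∫ θ in δ..(Real.pi / 2), g n θ‖ ≤ K * (Real.pi / 2) := by
      refine (intervalIntegral.norm_integral_le_of_norm_le_const (C := K) (fun θ hθ => ?_)).trans ?_
      · rw [Set.uIoc_of_le (by linarith)] at hθ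
        have : |θ| = θ := abs_of_pos (by linarith [hθ.1])
        exact hn θ (by linarith [hθ.1]) (by linarith [hθ.2])
      · gcongr
        rw [abs_of_nonneg (by linarith)]
        linarith
    have hW : √(phaseCurv (lam n)) ≤ 1000 * lam n ^ 2 := by
      have hM : phaseCurv (lam n) ≤ 1000 * lam n ^ 2 := by nlinarith [hb.2.2.2.1]
      rw [Real.sqrt_le_left (by positivity)]
      nlinarith
    have hn2 : (n : ℝ) ≤ lam n ^ 2 := by nlinarith [hb.2.2.2.2.1, n.cast_nonneg (α := ℝ)]
    rw [norm_mul, Complex.norm_real, Real.norm_of_nonneg (Real.sqrt_nonneg _)]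
    calc _ ≤ 1000 * lam n ^ 2 * (K * (Real.pi / 2) + K * (Real.pi / 2)) := by
          gcongr
          exact (norm_add_le _ _).trans (by gcongr)
      _ = 1000 * lam n ^ 2 * (Real.exp 2 * Real.exp (-lam n) * (2 * ‖z‖ ^ 2) * Real.pi) * n := by
          rw [hK]; ring
      _ ≤ 1000 * lam n ^ 2 * (Real.exp 2 * Real.exp (-lam n) * (2 * ‖z‖ ^ 2) * Real.pi) *
          lam n ^ 2 := by gcongr
      _ = 1000 * (Real.exp 2 * (2 * ‖z‖ ^ 2)) * Real.pi * (lam n ^ 4 * Real.exp (-lam n)) := by ring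
      _ ≤ _ := by
          gcongr
          norm_num
  have := hnear.add hfar
  rw [add_zero] at this
  refine this.congr' ?_
  filter_upwards [hint] with n hn
  rw [← mul_add]
  congr 1
  rw [← intervalIntegral.integral_add_adjacent_intervals (hn (-(Real.pi / 2)) (-δ))
    (hn (-δ) (Real.pi / 2)),
    ← intervalIntegral.integral_add_adjacent_intervals (hn (-δ) δ) (hn δ (Real.pi / 2))]
  ring

/-- The normalised remainder `(T - [inside] f) / (z^(2n) f(lam))`. -/
noncomputable def remainderRatio (z : ℂ) (n : ℕ) (a : ℝ) : ℂ :=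
  -(1 / (2 * Real.pi)) * ∫ θ in (-(Real.pi / 2))..(Real.pi / 2),
    saddle n a (contourPt n θ) * kernel z (contourPt n θ)

/-- The radius e^{-1/n} increases strictly to 1, so a fixed z, even with |z| = 1, is eventually off
the contour and inside it exactly when |z| < 1. -/
lemma eventually_T_eq {lam : ℕ → ℝ} (h : ∀ᶠ n : ℕ in atTop, IsScale n (lam n)) (z : ℂ) :
    ∀ᶠ n : ℕ in atTop, T (2 * n) (lam n * z) = (if ‖z‖ < 1 then f (lam n * z) else 0) +
      z ^ (2 * n) * f (lam n) * remainderRatio z n (lam n) := by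
  have hside : ∀ᶠ n : ℕ in atTop, ‖z‖ ≠ Real.exp (-1 / n) ∧
      (‖z‖ < Real.exp (-1 / n) ↔ ‖z‖ < 1) := by
    have hlt : ∀ᶠ n : ℕ in atTop, Real.exp (-1 / n) < 1 := by
      filter_upwards [eventually_gt_atTop 0] with n hn
      have : (0 : ℝ) < n := by exact_mod_cast hn
      rw [Real.exp_lt_one_iff]
      exact div_neg_of_neg_of_pos (by norm_num) this
    rcases lt_or_ge ‖z‖ 1 with hz | hz
    · have t0 : Tendsto (fun n : ℕ => Real.exp (-1 / n)) atTop (𝓝 1) := by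
        have := (Real.continuous_exp.tendsto 0).comp
          ((tendsto_const_div_atTop (-1)).comp tendsto_natCast_atTop_atTop)
        rw [Real.exp_zero] at this
        exact this
      filter_upwards [t0.eventually (lt_mem_nhds hz)] with n hn
      exact ⟨hn.ne, by simp [hn, hz]⟩
    · filter_upwards [hlt] with n hn
      exact ⟨by linarith [hn.trans_le hz] |> fun (h : Real.exp (-1 / n) < ‖z‖) => h.ne',
        by constructor <;> intro h' <;> linarith⟩
  filter_upwards [h, hside] with n hn hs
  have := T_sub_eq_integral (n := n) (r := -1 / n) hn.1 hs.1
  simp only [hs.2] at this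
  rw [sub_eq_iff_eq_add'] at this
  rw [this]
  rfl

theorem tendsto_remainderRatio {lam : ℕ → ℝ} (h : ∀ᶠ n : ℕ in atTop, IsScale n (lam n)) {z : ℂ}
    (hz : z ^ 2 ≠ 1) :
    Tendsto (fun n : ℕ => (√(phaseCurv (lam n)) : ℂ) * remainderRatio z n (lam n)) atTop
      (𝓝 (-(1 / (2 * Real.pi)) * (√(2 * Real.pi) * kernel z 0))) := by
  refine ((tendsto_saddle_integral h hz).const_mul (-(1 / (2 * Real.pi)) : ℂ)).congr (fun n => ?_)
  unfold remainderRatio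
  ring

/-! ### Exclusion of small imaginary z from ℧₊. -/

/-- An entire function that is small at many separated nodes near `c` is small at `c`. -/
theorem norm_center_le_of_nodes {ι : Type*} [DecidableEq ι] {c : ℂ} {r δ : ℝ} (hr : 0 < r)
    (hδ : 0 < δ) (a : ι → ℂ) (S : Finset ι) :
    ∀ {G : ℂ → ℂ} {K ε : ℝ}, Differentiable ℂ G → 0 ≤ ε →
      (∀ w, ‖w - c‖ = r → ‖G w‖ ≤ K) → (∀ i ∈ S, ‖a i - c‖ < r) →
      (∀ i ∈ S, ∀ j ∈ S, i ≠ j → δ ≤ ‖a i - a j‖) → (∀ i ∈ S, ‖G (a i)‖ ≤ ε) →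
      ‖G c‖ ≤ K * ∏ i ∈ S, (‖a i - c‖ / r) + ε * (4 * r / δ + 2) ^ S.card := by
  induction S using Finset.induction_on with
  | empty =>
    intro G K ε hG hε hK _ _ _
    have h := Complex.norm_le_of_forall_mem_frontier_norm_le (f := G) (C := K)
      (U := Metric.ball c r) Metric.isBounded_ball hG.diffContOnCl (by
        intro z hz
        rw [frontier_ball c hr.ne', mem_sphere_iff_norm] at hz
        exact hK z hz) (z := c) (subset_closure (Metric.mem_ball_self hr))
    simp only [Finset.prod_empty, mul_one, Finset.card_empty, pow_zero]
    linarith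
  | insert i S hi ih =>
    intro G K ε hG hε hK hnear hsep hsmall
    set q := 4 * r / δ + 2 with hq
    have hq1 : 1 ≤ q := by
      have : 0 ≤ 4 * r / δ := by positivity
      linarith
    set α := a i - c with hα
    have hαr : ‖α‖ < r := hnear i (Finset.mem_insert_self _ _)
    -- Approximate Jensen step: subtract G(a_i), divide out its zero and multiply by (r² - ᾱ(w -
    -- c))/r, whose modulus on the circle is |w - a_i|. The circle bound only rises to K + ε, the
    -- centre gains |α|/r, and the other nodes lose at most 4r/δ.
    set G₁ : ℂ → ℂ := fun w =>
      dslope G (a i) w * (((r : ℂ) ^ 2 - (starRingEnd ℂ) α * (w - c)) / r) with hG₁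
    have hr0 : (r : ℂ) ≠ 0 := by exact_mod_cast hr.ne'
    have hd : Differentiable ℂ (dslope G (a i)) := by
      rw [← differentiableOn_univ, Complex.differentiableOn_dslope univ_mem]
      exact hG.differentiableOn
    have hG₁d : Differentiable ℂ G₁ := by
      refine hd.mul ?_
      fun_prop
    have hval : ∀ w, w ≠ a i → ‖G₁ w‖ =
        ‖G w - G (a i)‖ / ‖w - a i‖ * (‖(r : ℂ) ^ 2 - (starRingEnd ℂ) α * (w - c)‖ / r) := by
      intro w hw
      rw [hG₁]
      simp only
      rw [dslope_of_ne _ hw, slope_def_field, norm_mul, norm_div, norm_div, Complex.norm_real,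
        Real.norm_of_nonneg hr.le]
    have hGi : ‖G (a i)‖ ≤ ε := hsmall i (Finset.mem_insert_self _ _)
    have hK₁ : ∀ w, ‖w - c‖ = r → ‖G₁ w‖ ≤ K + ε := by
      intro w hw
      have hne : w ≠ a i := by
        rintro rfl
        exact hαr.ne hw
      have hid : ‖(r : ℂ) ^ 2 - (starRingEnd ℂ) α * (w - c)‖ = r * ‖w - a i‖ := by
        have h1 : (r : ℂ) ^ 2 = (starRingEnd ℂ) (w - c) * (w - c) := by
          rw [mul_comm, Complex.mul_conj, Complex.normSq_eq_norm_sq, hw]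
          push_cast
          rfl
        rw [h1, ← sub_mul, ← map_sub, norm_mul, Complex.norm_conj, hw, mul_comm, hα]
        congr 2
        ring
      rw [hval w hne, hid]
      have hpos : 0 < ‖w - a i‖ := norm_pos_iff.mpr (sub_ne_zero.mpr hne)
      rw [mul_div_cancel_left₀ _ hr.ne', div_mul_cancel₀ _ hpos.ne']
      exact (norm_sub_le _ _).trans (add_le_add (hK w hw) hGi)
    have hsmall₁ : ∀ j ∈ S, ‖G₁ (a j)‖ ≤ ε * (4 * r / δ) := by
      intro j hj
      have hji : j ≠ i := fun h => hi (h ▸ hj)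
      have hs := hsep j (Finset.mem_insert_of_mem hj) i (Finset.mem_insert_self _ _) hji
      have hne : a j ≠ a i := by
        intro h
        rw [h, sub_self, norm_zero] at hs
        linarith
      rw [hval _ hne]
      have h1 : ‖G (a j) - G (a i)‖ ≤ 2 * ε := by
        refine (norm_sub_le _ _).trans ?_
        linarith [hsmall j (Finset.mem_insert_of_mem hj)]
      have h2 : ‖(r : ℂ) ^ 2 - (starRingEnd ℂ) α * (a j - c)‖ ≤ 2 * r ^ 2 := by
        refine (norm_sub_le _ _).trans ?_
        rw [norm_pow, norm_mul, Complex.norm_conj, Complex.norm_real, Real.norm_of_nonneg hr.le]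
        have := mul_le_mul hαr.le (hnear j (Finset.mem_insert_of_mem hj)).le (norm_nonneg _) hr.le
        nlinarith
      calc _ ≤ 2 * ε / δ * (2 * r ^ 2 / r) := by gcongr
        _ = ε * (4 * r / δ) := by field_simp; ring
    have hIH := ih hG₁d (by positivity : 0 ≤ ε * (4 * r / δ)) hK₁
      (fun j hj => hnear j (Finset.mem_insert_of_mem hj))
      (fun j hj k hk => hsep j (Finset.mem_insert_of_mem hj) k (Finset.mem_insert_of_mem hk))
      hsmall₁
    have hP : ∏ j ∈ S, (‖a j - c‖ / r) ≤ 1 := by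
      refine Finset.prod_le_one (fun j _ => by positivity) (fun j hj => ?_)
      rw [div_le_one hr]
      exact (hnear j (Finset.mem_insert_of_mem hj)).le
    have hP0 : 0 ≤ ∏ j ∈ S, (‖a j - c‖ / r) := Finset.prod_nonneg fun j _ => by positivity
    have hαr1 : ‖α‖ / r ≤ 1 := (div_le_one hr).mpr hαr.le
    have hcenter : ‖G c‖ ≤ ‖α‖ / r * ‖G₁ c‖ + ε := by
      rcases eq_or_ne c (a i) with h | h
      · rw [h]
        have : 0 ≤ ‖α‖ / r * ‖G₁ (a i)‖ := by positivity
        linarith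
      · have hα0 : ‖c - a i‖ = ‖α‖ := by rw [hα, norm_sub_rev]
        have hαpos : 0 < ‖α‖ := by
          rw [← hα0]
          exact norm_pos_iff.mpr (sub_ne_zero.mpr h)
        rw [hval c h, sub_self, mul_zero, sub_zero, norm_pow, Complex.norm_real,
          Real.norm_of_nonneg hr.le, hα0]
        have : ‖α‖ / r * (‖G c - G (a i)‖ / ‖α‖ * (r ^ 2 / r)) = ‖G c - G (a i)‖ := by
          field_simp
        rw [this]
        calc ‖G c‖ = ‖(G c - G (a i)) + G (a i)‖ := by rw [sub_add_cancel]
          _ ≤ _ := (norm_add_le _ _).trans (by linarith)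
    rw [Finset.prod_insert hi, Finset.card_insert_of_notMem hi]
    have hqS : 1 ≤ q ^ S.card := one_le_pow₀ hq1
    set P := ∏ j ∈ S, (‖a j - c‖ / r)
    have hα1 : 0 ≤ ‖α‖ / r := by positivity
    calc ‖G c‖ ≤ ‖α‖ / r * ((K + ε) * P + ε * (4 * r / δ) * q ^ S.card) + ε := by
          refine hcenter.trans ?_
          gcongr
      _ = K * (‖α‖ / r * P) + ε * (‖α‖ / r * P) + ‖α‖ / r * (ε * (4 * r / δ) * q ^ S.card) + ε := by
          ring
      _ ≤ K * (‖α‖ / r * P) + ε * (1 * 1) + 1 * (ε * (4 * r / δ) * q ^ S.card) + ε := by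
          gcongr
      _ = K * (‖α‖ / r * P) + ε * (4 * r / δ) * q ^ S.card + (2 * ε) * 1 := by ring
      _ ≤ K * (‖α‖ / r * P) + ε * (4 * r / δ) * q ^ S.card + (2 * ε) * q ^ S.card := by gcongr
      _ = _ := by rw [hq]; ring

lemma gammaDecay_neg (t v : ℝ) : gammaDecay (-t) v = gammaDecay t v := by
  unfold gammaDecay
  rw [neg_div, Real.arctan_neg]
  ring_nf

lemma le_gammaDecay {t v : ℝ} (ht : 5 ≤ t) (hv : 5 / 4 ≤ v) :
    Real.pi / 2 * t - v - v * Real.log t ≤ gammaDecay t v := by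
  have ht0 : 0 < t := by linarith
  have hv0 : 0 < v := by linarith
  unfold gammaDecay
  have h1 : Real.arctan (t / v) = Real.pi / 2 - Real.arctan (v / t) := by
    rw [← inv_div, Real.arctan_inv_of_pos (by positivity)]
  have h2 : t * Real.arctan (v / t) ≤ v := by
    calc _ ≤ t * (v / t) := by
          gcongr
          exact arctan_le_self_of_nonneg (by positivity)
      _ = v := by field_simp
  have h3 : Real.log (1 + t ^ 2 / v ^ 2) ≤ 2 * Real.log t := by
    rw [← Real.log_rpow ht0]
    apply Real.log_le_log (by positivity)
    have : t ^ 2 / v ^ 2 ≤ t ^ 2 / (5 / 4) ^ 2 := by gcongr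
    have h25 : (5 : ℝ) ^ 2 ≤ t ^ 2 := by gcongr
    rw [Real.rpow_two]
    norm_num at this h25
    linarith
  rw [h1]
  nlinarith [mul_le_mul_of_nonneg_left h3 hv0.le]

/-- The strip contains the disc of radius 48 about 3/2 + it, since 48 + 3/2 = 99/2; evenness handles
negative real parts. The power 28 is 2 from ζ plus 26 from Γ, whose argument has real part at most
26. -/
lemma exists_norm_f_strip_le : ∃ C : ℝ, 0 < C ∧ ∀ t : ℝ, 200 ≤ t → ∀ w : ℂ,
    |w.re| ≤ 99 / 2 → |w.im - t| ≤ 48 → ‖f w‖ ≤ C * t ^ 28 * Real.exp (-(Real.pi / 4 * t)) := by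
  obtain ⟨C, hC1, hC⟩ := exists_norm_f_le
  have key : ∃ D : ℝ, 0 < D ∧ ∀ t : ℝ, 200 ≤ t → ∀ w : ℂ, 0 ≤ w.re → w.re ≤ 99 / 2 →
      |(|w.im|) - t| ≤ 48 → ‖f w‖ ≤ D * t ^ 28 * Real.exp (-(Real.pi / 4 * t)) := by
    have hG26 : 0 < Real.Gamma 26 := Real.Gamma_pos_of_pos (by norm_num)
    refine ⟨C * 4 * (1 + Real.Gamma 26) * Real.exp (26 + 12 * Real.pi), by positivity, ?_⟩
    intro t ht w hw0 hw1 hw2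
    rw [abs_le] at hw2
    set v := 5 / 4 + w.re / 2 with hv
    have hv1 : 5 / 4 ≤ v := by linarith
    have hv2 : v ≤ 26 := by linarith
    have hΓ : Real.Gamma v ≤ 1 + Real.Gamma 26 := by
      have := Real.convexOn_Gamma.le_max_of_mem_Icc (x := 1) (y := 26) (z := v) (by simp)
        (by simp) ⟨by linarith, hv2⟩
      rw [Real.Gamma_one] at this
      exact this.trans (max_le (by linarith) (by linarith))
    have hD : gammaDecay (w.im / 2) v = gammaDecay (|w.im| / 2) v := by
      rcases abs_cases w.im with ⟨h, _⟩ | ⟨h, _⟩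
      · rw [h]
      · rw [h, neg_div, gammaDecay_neg]
    have hlo := le_gammaDecay (t := |w.im| / 2) (v := v) (by linarith) hv1
    have hlog : Real.log (|w.im| / 2) ≤ Real.log t :=
      Real.log_le_log (by linarith) (by linarith)
    have hlog0 : 0 ≤ Real.log t := Real.log_nonneg (by linarith)
    have hpi := Real.pi_pos
    have hdec : -gammaDecay (w.im / 2) v ≤
        26 + 12 * Real.pi + 26 * Real.log t - Real.pi / 4 * t := by
      rw [hD]
      have a1 : v * Real.log (|w.im| / 2) ≤ 26 * Real.log t := by
        calc _ ≤ v * Real.log t := by gcongr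
          _ ≤ _ := by gcongr
      have a2 : Real.pi / 2 * ((t - 48) / 2) ≤ Real.pi / 2 * (|w.im| / 2) := by
        gcongr
        linarith
      nlinarith
    have hnorm : 1 + ‖w‖ ≤ 2 * t := by
      have := Complex.norm_le_abs_re_add_abs_im w
      rw [abs_of_nonneg hw0] at this
      linarith
    calc ‖f w‖ ≤ _ := hC w hw0
      _ ≤ C * (2 * t) ^ 2 * ((1 + Real.Gamma 26) *
          Real.exp (26 + 12 * Real.pi + 26 * Real.log t - Real.pi / 4 * t)) := by gcongr
      _ = _ := by
        have : 26 * Real.log t = Real.log (t ^ 26) := by rw [Real.log_pow]; norm_num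
        rw [sub_eq_add_neg, Real.exp_add, Real.exp_add (26 + 12 * Real.pi), this,
          Real.exp_log (by positivity)]
        ring
  obtain ⟨D, hD0, hD⟩ := key
  refine ⟨D, hD0, fun t ht w hre him => ?_⟩
  rw [abs_le] at hre him
  have ha : |w.im| = w.im := abs_of_nonneg (by linarith)
  rcases le_total 0 w.re with h | h
  · exact hD t ht w h hre.2 (by rw [ha, abs_le]; exact him)
  · rw [← f_neg]
    refine hD t ht (-w) (by simpa using h) (by simp; linarith) ?_
    rw [Complex.neg_im, abs_neg, ha, abs_le]
    exact him

/-- Here s = 2 + it, where |ζ| ≥ 1/4; the rest is the lower bound for |Γ(2 + it/2)|. -/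
lemma le_norm_f_center {t : ℝ} (ht : 4 ≤ t) :
    t ^ 2 / 128 * Real.exp (-(Real.pi / 4 * t)) ≤ ‖f (3 / 2 + t * Complex.I)‖ := by
  have ht0 : 0 < t := by linarith
  have hpi := Real.pi_pos
  have hpi4 := Real.pi_le_four
  have hre : ((3 / 2 + t * Complex.I : ℂ)).re = 3 / 2 := by simp
  have es : (1 / 2 + (3 / 2 + t * Complex.I) : ℂ) = 2 + t * Complex.I := by ring
  have eg : (5 / 4 + (3 / 2 + t * Complex.I) / 2 : ℂ) = 2 + (t / 2 : ℝ) * Complex.I := by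
    push_cast; ring
  rw [norm_f_eq (by rw [hre]; norm_num), hre, es, eg]
  have h1 : Real.pi ^ (-(1 / 2 + 3 / 2 : ℝ) / 2) = Real.pi⁻¹ := by
    rw [← Real.rpow_neg_one]; norm_num
  have hre2 : ((2 + (t / 2 : ℝ) * Complex.I : ℂ)).re = 2 := by simp
  have him2 : ((2 + (t / 2 : ℝ) * Complex.I : ℂ)).im = t / 2 := by simp
  have hΓ := le_norm_Gamma (s := 2 + (t / 2 : ℝ) * Complex.I) (by rw [hre2]; norm_num)
  rw [hre2, him2, Real.Gamma_two, one_mul] at hΓ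
  have hnorm : ‖(2 + (t / 2 : ℝ) * Complex.I : ℂ)‖ ≤ t := by
    have := Complex.norm_le_abs_re_add_abs_im (2 + (t / 2 : ℝ) * Complex.I : ℂ)
    rw [hre2, him2, abs_of_pos (by linarith : 0 < t / 2), abs_two] at this
    linarith
  have hnorm0 : 0 < ‖(2 + (t / 2 : ℝ) * Complex.I : ℂ)‖ := by
    refine lt_of_lt_of_le (by norm_num : (0 : ℝ) < 2) ?_
    have := Complex.abs_re_le_norm (2 + (t / 2 : ℝ) * Complex.I : ℂ)
    rwa [hre2, abs_two] at this
  have hdec : Real.exp (-(Real.pi / 4 * t)) * (t ^ 2 / 16) ≤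
      Real.exp (-gammaDecay (t / 2) 2) := by
    have hx : t ^ 2 / 16 = Real.exp (Real.log (t ^ 2 / 16)) := (Real.exp_log (by positivity)).symm
    rw [hx, ← Real.exp_add]
    apply Real.exp_le_exp.mpr
    unfold gammaDecay
    have a1 : t / 2 * Real.arctan (t / 2 / 2) ≤ t / 2 * (Real.pi / 2) := by
      gcongr
      exact (Real.arctan_lt_pi_div_two _).le
    have a2 : Real.log (t ^ 2 / 16) ≤ Real.log (1 + (t / 2) ^ 2 / 2 ^ 2) := by
      apply Real.log_le_log (by positivity)
      nlinarith
    nlinarith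
  have hΓ' : 2 / t * (Real.exp (-(Real.pi / 4 * t)) * (t ^ 2 / 16)) ≤
      ‖Complex.Gamma (2 + (t / 2 : ℝ) * Complex.I)‖ := by
    refine le_trans ?_ hΓ
    gcongr
  have hζ : t * (1 / 4) ≤ ‖riemannZeta₁ (2 + t * Complex.I)‖ := by
    have hne : (2 + t * Complex.I : ℂ) ≠ 1 := by
      intro h
      have := congrArg Complex.re h
      simp at this
    rw [riemannZeta₁_eq_mul hne, norm_mul]
    have a1 : t ≤ ‖(2 + t * Complex.I - 1 : ℂ)‖ := by
      have := Complex.abs_im_le_norm (2 + t * Complex.I - 1 : ℂ)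
      simpa [abs_of_pos ht0] using this
    have a2 : 1 / 4 ≤ ‖riemannZeta (2 + t * Complex.I)‖ := quarter_le_norm_riemannZeta (by simp)
    gcongr
  rw [h1]
  calc t ^ 2 / 128 * Real.exp (-(Real.pi / 4 * t))
      = 4⁻¹ * (2 / t * (Real.exp (-(Real.pi / 4 * t)) * (t ^ 2 / 16))) * (t * (1 / 4)) := by
        field_simp; norm_num
    _ ≤ _ := by gcongr

/-- Between two scales `scaleFun` increases by exactly 2(n' - n). Its slope lies between 0.495 log
and 1000 log, which bounds the gaps on both sides. -/
lemma eventually_scale_pair {lam : ℕ → ℝ} (h : ∀ᶠ n : ℕ in atTop, IsScale n (lam n)) :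
    ∃ N : ℕ, ∀ n ≥ N, 1 ≤ lam n ∧ scaleFun (lam n) = 2 * n ∧ ∀ n', n < n' →
      lam n < lam n' ∧ 495 / 1000 * Real.log (lam n) * (lam n' - lam n) ≤ 2 * ((n' : ℝ) - n) ∧
      lam n' - lam n ≤ 2 * ((n' : ℝ) - n) ∧
      1 ≤ 500 * Real.log (lam n') * (lam n' - lam n) := by
  have hlam := tendsto_of_isScale h
  have hev : ∀ᶠ a : ℝ in atTop, 495 / 1000 * Real.log a ≤ lamSlope a - 1 ∧
      phaseCurv a ≤ 1000 * (a * Real.log a) ∧ 2 ≤ lamSlope a ∧ 2 ≤ a := by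
    filter_upwards [eventually_lamSlope_bounds (k := 497 / 1000) (K := 1) (by norm_num)
      (by norm_num), eventually_exists_phase, tendsto_lamSlope_atTop.eventually_ge_atTop 2,
      eventually_ge_atTop 2, Real.tendsto_log_atTop.eventually_ge_atTop 500] with a h1 h2 h3 h4 h5
    exact ⟨by linarith [h1.1], h2.1, h3, h4⟩
  obtain ⟨X, hX⟩ := eventually_atTop.mp hev
  obtain ⟨N, hN⟩ := eventually_atTop.mp ((eventually_scale_bounds h).and
    (hlam.eventually_ge_atTop X))
  refine ⟨N, fun n hn => ?_⟩
  obtain ⟨⟨hn4, hns, -⟩, hnX⟩ := hN n hn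
  refine ⟨by linarith, hns, fun n' hn' => ?_⟩
  obtain ⟨⟨hn4', hns', -⟩, hnX'⟩ := hN n' (hn.trans hn'.le)
  have hnn : (n : ℝ) + 1 ≤ n' := by exact_mod_cast hn'
  have hlt : lam n < lam n' := by
    by_contra! hle
    have h1 := scaleFun_sub_ge (by linarith : (2 : ℝ) ≤ lam n') hle
    have h2 : 0 ≤ (lam n - lam n') * (lamSlope (lam n') - 1) :=
      mul_nonneg (by linarith) (by linarith [(hX _ hnX').2.2.1])
    linarith
  have hge := scaleFun_sub_ge (by linarith : (2 : ℝ) ≤ lam n) hlt.le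
  have hd0 : 0 ≤ lam n' - lam n := by linarith
  refine ⟨hlt, ?_, ?_, ?_⟩
  · have := mul_le_mul_of_nonneg_left (hX _ hnX).1 hd0
    linarith
  · have := mul_le_mul_of_nonneg_left (hX _ hnX).2.2.1 hd0
    linarith
  · have hder : ∀ x ∈ interior (Set.Icc (lam n) (lam n')),
        deriv scaleFun x ≤ 1000 * Real.log (lam n') := by
      intro x hx
      rw [interior_Icc] at hx
      have hx0 : 0 < x := by linarith [hx.1]
      have h1 := (hX x (hnX.trans hx.1.le)).2.1
      unfold phaseCurv at h1
      have h2 : deriv scaleFun x ≤ 1000 * Real.log x := by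
        refine le_of_mul_le_mul_left ?_ hx0
        linarith
      have h3 : Real.log x ≤ Real.log (lam n') := Real.log_le_log hx0 hx.2.le
      linarith
    have hdiff : ∀ x ∈ Set.Icc (lam n) (lam n'), DifferentiableAt ℝ scaleFun x := fun x hx =>
      (hasDerivAt_scaleFun (by linarith [hx.1])).2.differentiableAt
    have := (convex_Icc (lam n) (lam n')).image_sub_le_mul_sub_of_deriv_le
      (fun x hx => (hdiff x hx).continuousAt.continuousWithinAt)
      (fun x hx => (hdiff x (interior_subset hx)).differentiableWithinAt) hder _
      (Set.left_mem_Icc.mpr hlt.le) _ (Set.right_mem_Icc.mpr hlt.le) hlt.le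
    linarith

/-- Near `m`, the scales are nearly equally spaced with gaps about `4 / log (lam m)`. -/
lemma eventually_scale_gaps {lam : ℕ → ℝ} (h : ∀ᶠ n : ℕ in atTop, IsScale n (lam n)) (N₁ : ℕ) :
    ∀ᶠ m : ℕ in atTop, ∀ L : ℕ, (L : ℝ) ≤ 15 * Real.log (lam m) → L ≤ m ∧
      ∀ n, m ≤ n + L → n ≤ m + L → N₁ ≤ n ∧ 9 / 10 * lam m ≤ lam n ∧
        ∀ n', n < n' → n' ≤ m + L → lam n < lam n' ∧
          495 / 1000 * Real.log (9 / 10 * lam m) * (lam n' - lam n) ≤ 2 * ((n' : ℝ) - n) ∧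
          1 ≤ 500 * Real.log (2 * lam m) * (lam n' - lam n) := by
  obtain ⟨N, hN⟩ := eventually_scale_pair h
  have hlam := tendsto_of_isScale h
  have hlog : ∀ᶠ x : ℝ in atTop, 300 * Real.log x ≤ x := by
    filter_upwards [tendsto_log_div_atTop.eventually (gt_mem_nhds (by norm_num : (0 : ℝ) < 1 / 300)),
      eventually_gt_atTop 0] with x hx hx0
    rw [div_lt_iff₀ hx0] at hx
    linarith
  filter_upwards [eventually_scale_bounds h, eventually_ge_atTop (2 * (N + N₁)),
    hlam.eventually hlog] with m hm hmN hml L hL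
  obtain ⟨hm4, -, -, -, -, hM, -⟩ := hm
  have hl1 : 1 ≤ Real.log (lam m) := by
    rw [Real.le_log_iff_exp_le (by linarith)]
    linarith [Real.exp_one_lt_d9]
  have hLm : 2 * L ≤ m := by
    have : (2 : ℝ) * L ≤ m := by nlinarith
    exact_mod_cast this
  refine ⟨by omega, fun n hn1 hn2 => ?_⟩
  have hnN : N ≤ n := by omega
  have hlow : ∀ k, m ≤ k + L → N ≤ k → 9 / 10 * lam m ≤ lam k := by
    intro k hk hkN
    rcases lt_or_ge k m with hkm | hkm
    · have h1 := ((hN k hkN).2.2 m hkm).2.2.1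
      have h2 : (m : ℝ) ≤ k + L := by exact_mod_cast hk
      linarith
    · rcases hkm.eq_or_lt with rfl | hkm
      · linarith
      · linarith [((hN m (by omega)).2.2 k hkm).1]
  have hup : ∀ k, m ≤ k + L → k ≤ m + L → N ≤ k → lam k ≤ 2 * lam m := by
    intro k hk1 hk hkN
    rcases lt_or_ge m k with hkm | hkm
    · have h1 := ((hN m (by omega)).2.2 k hkm).2.2.1
      have h2 : (k : ℝ) ≤ m + L := by exact_mod_cast hk
      linarith
    · rcases hkm.eq_or_lt with rfl | hkm
      · linarith
      · linarith [((hN k hkN).2.2 m hkm).1]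
  refine ⟨by omega, hlow n hn1 hnN, fun n' hnn hn' => ?_⟩
  obtain ⟨h1, h2, -, h4⟩ := (hN n hnN).2.2 n' hnn
  have hd : 0 ≤ lam n' - lam n := by linarith
  refine ⟨h1, le_trans ?_ h2, h4.trans ?_⟩
  · gcongr
    exact hlow n hn1 hnN
  · have : 0 < lam n' := by linarith [(hN n' (by omega)).1]
    gcongr
    exact hup n' (by omega) hn' (by omega)

lemma eventually_log_fReal_sub_scaleFun :
    ∀ᶠ a : ℝ in atTop, Real.log (fReal a) - scaleFun a ≤ -(49 / 100) * a := by
  have h := tendsto_log_fReal.sub tendsto_scaleFun_div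
  have e : -(1 / 2) * (Real.log (2 * Real.pi) + 1) - -(1 / 2) * Real.log (2 * Real.pi) =
      -(1 / 2) := by ring
  rw [e] at h
  filter_upwards [h.eventually (gt_mem_nhds (by norm_num : -(1 / 2 : ℝ) < -(49 / 100))),
    eventually_gt_atTop 0] with a ha ha0
  have : Real.log (fReal a) / a - 1 / 2 * Real.log a - (scaleFun a / a - 1 / 2 * Real.log a) =
      (Real.log (fReal a) - scaleFun a) / a := by ring
  rw [this, div_lt_iff₀ ha0] at ha
  exact ha.le

/-- The outer window has 30ℓ + 1 nodes and the inner one 14ℓ + 1. Each outer node gives a factor 1/2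
and each inner one a second, so there are at least 44ℓ halvings, and 44 log 2 > 30. -/
lemma prod_nodes_le {m ℓ : ℕ} (hℓ : 15 * ℓ ≤ m) {d : ℕ → ℝ} (h0 : ∀ n, 0 ≤ d n)
    (h1 : ∀ n ∈ Finset.Icc (m - 15 * ℓ) (m + 15 * ℓ), d n ≤ 1 / 2)
    (h2 : ∀ n ∈ Finset.Icc (m - 7 * ℓ) (m + 7 * ℓ), d n ≤ 1 / 4) :
    ∏ n ∈ Finset.Icc (m - 15 * ℓ) (m + 15 * ℓ), d n ≤ Real.exp (-(30 * ℓ)) := by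
  set S := Finset.Icc (m - 15 * ℓ) (m + 15 * ℓ) with hS
  set S' := Finset.Icc (m - 7 * ℓ) (m + 7 * ℓ) with hS'
  have hsub : S' ⊆ S := Finset.Icc_subset_Icc (by omega) (by omega)
  have hle : ∏ n ∈ S, d n ≤ ∏ n ∈ S, ((1 / 2 : ℝ) * if n ∈ S' then 1 / 2 else 1) := by
    refine Finset.prod_le_prod (fun n _ => h0 n) (fun n hn => ?_)
    split_ifs with hn'
    · exact (h2 n hn').trans (by norm_num)
    · exact (h1 n hn).trans (by norm_num)
  have hcard : S.card + S'.card = 44 * ℓ + 2 := by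
    rw [hS, hS', Nat.card_Icc, Nat.card_Icc]
    omega
  refine hle.trans ?_
  rw [Finset.prod_mul_distrib, Finset.prod_const, Finset.prod_ite_mem, Finset.prod_const,
    Finset.inter_eq_right.mpr hsub, ← pow_add, hcard]
  have hl2 := Real.log_two_gt_d9
  calc (1 / 2 : ℝ) ^ (44 * ℓ + 2) ≤ (1 / 2) ^ (44 * ℓ) :=
        pow_le_pow_of_le_one (by norm_num) (by norm_num) (by omega)
    _ = Real.exp (-(Real.log 2 * (44 * ℓ))) := by
        rw [one_div, inv_pow, Real.exp_neg, ← Real.exp_log (pow_pos two_pos (44 * ℓ)),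
          Real.log_pow]
        push_cast
        ring_nf
    _ ≤ _ := by
        apply Real.exp_le_exp.mpr
        have : (0 : ℝ) ≤ ℓ := by positivity
        nlinarith

lemma eventually_exclusion_bounds {y : ℝ} (hy0 : 0 < y) (C : ℝ) :
    ∀ᶠ x : ℝ in atTop, 192 * x + 2 ≤ x ^ 2 ∧ 500 * Real.log (2 * x) ≤ y * x ∧
      1 ≤ Real.log x ∧ 60 * Real.log x ^ 2 + 2 * Real.log x ≤ 14 / 100 * x ∧
      200 ≤ y * x ∧ C * Real.exp 30 ≤ y * x := by
  have hyx : Tendsto (fun x : ℝ => y * x) atTop atTop := tendsto_id.const_mul_atTop hy0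
  filter_upwards [eventually_ge_atTop 200, Real.tendsto_log_atTop.eventually_ge_atTop 1,
    tendsto_log_div_atTop.eventually (gt_mem_nhds (by positivity : 0 < y / 1000)),
    (Real.isLittleO_pow_log_id_atTop (n := 2)).bound (by norm_num : (0 : ℝ) < 1 / 1000),
    hyx.eventually_ge_atTop 200, hyx.eventually_ge_atTop (C * Real.exp 30)] with x h1 h2 h3 h4 h5 h6
  have hx0 : 0 < x := by linarith
  rw [div_lt_iff₀ hx0] at h3
  rw [Real.norm_of_nonneg (by positivity), id, Real.norm_of_nonneg hx0.le] at h4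
  have hl : Real.log (2 * x) = Real.log 2 + Real.log x := Real.log_mul two_ne_zero hx0.ne'
  have hl2 := Real.log_two_lt_d9
  exact ⟨by nlinarith, by rw [hl]; linarith, h2, by nlinarith, h5, h6⟩

lemma nodes_pow_le {x : ℝ} {ℓ : ℕ} (hx0 : 0 < x) (hx1 : 192 * x + 2 ≤ x ^ 2)
    (hℓ : (ℓ : ℝ) ≤ Real.log x) (hx4 : 60 * Real.log x ^ 2 + 2 * Real.log x ≤ 14 / 100 * x) :
    (192 * x + 2) ^ (30 * ℓ + 1) ≤ Real.exp (14 / 100 * x) := by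
  have hl : 0 ≤ Real.log x := (Nat.cast_nonneg ℓ).trans hℓ
  calc (192 * x + 2) ^ (30 * ℓ + 1) ≤ (x ^ 2) ^ (30 * ℓ + 1) := by gcongr
    _ = Real.exp ((30 * ℓ + 1) * (2 * Real.log x)) := by
        rw [← Real.exp_log (pow_pos (pow_pos hx0 2) (30 * ℓ + 1)), Real.log_pow, Real.log_pow]
        push_cast
        ring_nf
    _ ≤ _ := by
        apply Real.exp_le_exp.mpr
        have : (30 * ℓ + 1) * (2 * Real.log x) ≤ (30 * Real.log x + 1) * (2 * Real.log x) := by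
          gcongr
        linarith

/-- The 30 powers of t gained beat the 28 lost. The smallness at the nodes wins because 0.441 - 0.14
= 0.301 exceeds (π/4)·0.368 < 0.29. -/
lemma interpolation_bound_lt {C t x : ℝ} (hC0 : 0 < C) (ht : 200 ≤ t) (htx : t ≤ 0.368 * x)
    (hCt : C * Real.exp 30 ≤ t) :
    C * t ^ 28 * Real.exp (-(Real.pi / 4 * t)) * (Real.exp 30 / t ^ 30) +
      Real.exp (-(441 / 1000 * x)) * Real.exp (14 / 100 * x) <
      t ^ 2 / 128 * Real.exp (-(Real.pi / 4 * t)) := by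
  have ht0 : 0 < t := by linarith
  have hpi := Real.pi_lt_d2
  have h1 : C * t ^ 28 * Real.exp (-(Real.pi / 4 * t)) * (Real.exp 30 / t ^ 30) ≤
      1 * Real.exp (-(Real.pi / 4 * t)) := by
    have : C * t ^ 28 * Real.exp (-(Real.pi / 4 * t)) * (Real.exp 30 / t ^ 30) =
      (C * Real.exp 30 / t ^ 2) * Real.exp (-(Real.pi / 4 * t)) := by
      field_simp
    rw [this]
    gcongr
    rw [div_le_one (by positivity)]
    nlinarith
  have h2 : Real.exp (-(441 / 1000 * x)) * Real.exp (14 / 100 * x) ≤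
      1 * Real.exp (-(Real.pi / 4 * t)) := by
    rw [one_mul, ← Real.exp_add]
    apply Real.exp_le_exp.mpr
    have : Real.pi / 4 * t ≤ 3.15 / 4 * (0.368 * x) := by gcongr
    have hx0 : 0 < x := by linarith
    linarith
  have h3 : 2 * Real.exp (-(Real.pi / 4 * t)) < t ^ 2 / 128 * Real.exp (-(Real.pi / 4 * t)) := by
    gcongr
    nlinarith
  linarith

/-- On the imaginary axis close to the origin the phase cannot stay below one. -/
theorem not_eventually_norm_f_imag_le {lam : ℕ → ℝ}
    (h : ∀ᶠ n : ℕ in atTop, IsScale n (lam n)) {y : ℝ} (hy0 : 0 < y) (hy1 : Real.log y ≤ -1) :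
    ¬ ∀ᶠ n : ℕ in atTop, ‖f (lam n * (y * Complex.I))‖ ≤ y ^ (2 * n) * fReal (lam n) := by
  intro hyp
  have hlam := tendsto_of_isScale h
  obtain ⟨C, hC0, hC⟩ := exists_norm_f_strip_le
  have hye : y ≤ 0.368 := by
    have := (Real.log_le_iff_le_exp hy0).mp hy1
    linarith [Real.exp_neg_one_lt_d9]
  obtain ⟨N, hN⟩ := eventually_scale_pair h
  obtain ⟨N₁, hN₁⟩ := eventually_atTop.mp
    ((hyp.and (hlam.eventually eventually_log_fReal_sub_scaleFun)).and (eventually_ge_atTop N))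
  have hsmall : ∀ n ≥ N₁, ‖f (lam n * (y * Complex.I))‖ ≤ Real.exp (-(49 / 100) * lam n) := by
    intro n hn
    obtain ⟨⟨h1, h2⟩, h3⟩ := hN₁ n hn
    obtain ⟨h4, h5, -⟩ := hN n h3
    refine h1.trans ?_
    have hF := fReal_pos (by linarith : 1 / 2 < lam n)
    rw [← Real.exp_log hF, ← Real.exp_log (pow_pos hy0 (2 * n)), ← Real.exp_add, Real.log_pow]
    apply Real.exp_le_exp.mpr
    push_cast
    have : 2 * (n : ℝ) * Real.log y ≤ 2 * n * (-1) := by gcongr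
    linarith
  have hxev : ∀ᶠ x : ℝ in atTop, 192 * x + 2 ≤ x ^ 2 ∧ 500 * Real.log (2 * x) ≤ y * x ∧
      1 ≤ Real.log x ∧ 60 * Real.log x ^ 2 + 2 * Real.log x ≤ 14 / 100 * x ∧
      200 ≤ y * x ∧ C * Real.exp 30 ≤ y * x := eventually_exclusion_bounds hy0 C
  obtain ⟨m, hgap, hx1, hx2, hx3, hx4, hx5, hx6⟩ :=
    ((eventually_scale_gaps h N₁).and (hlam.eventually hxev)).exists
  set x := lam m with hxdef
  set t := y * x with ht
  have ht0 : 0 < t := by linarith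
  have hx0 : 0 < x := (pos_iff_pos_of_mul_pos ht0).mp hy0
  have htx : t ≤ 0.368 * x := by rw [ht]; gcongr
  set ℓ := ⌊Real.log t⌋₊ with hℓ
  have hlogt : 1 ≤ Real.log t := by
    rw [Real.le_log_iff_exp_le ht0]
    linarith [Real.exp_one_lt_d9]
  have hℓ1 : (ℓ : ℝ) ≤ Real.log t := Nat.floor_le (by linarith)
  have hℓ2 : Real.log t < ℓ + 1 := Nat.lt_floor_add_one _
  have hℓpos : 1 ≤ ℓ := Nat.one_le_floor_iff _ |>.mpr hlogt
  have hℓpos' : (1 : ℝ) ≤ ℓ := by exact_mod_cast hℓpos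
  have hlog9 : Real.log t ≤ Real.log (9 / 10 * x) := Real.log_le_log ht0 (by linarith)
  have hlogx : Real.log t ≤ Real.log x := Real.log_le_log ht0 (by linarith)
  obtain ⟨hLm, hnode⟩ := hgap (15 * ℓ) (by push_cast; linarith)
  set S := Finset.Icc (m - 15 * ℓ) (m + 15 * ℓ) with hS
  have hmemS : ∀ n, n ∈ S ↔ m ≤ n + 15 * ℓ ∧ n ≤ m + 15 * ℓ := by
    intro n
    rw [hS, Finset.mem_Icc]
    omega
  set c : ℂ := 3 / 2 + t * Complex.I with hc
  set a : ℕ → ℂ := fun n => lam n * (y * Complex.I) with ha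
  -- The constant 1.49 bounds 0.368 · 2/0.495, so k = 15 and k = 7 keep the nodes within 24 and 12
  -- of the centre, one half and one quarter of the radius 48.
  have hpair : ∀ n n' : ℕ, n ∈ S → n' ∈ S → n < n' → ∀ k : ℝ, (n' : ℝ) - n ≤ k * ℓ →
      y * (lam n' - lam n) ≤ 1.49 * k := by
    intro n n' hn hn' hnn k hk
    rw [hmemS] at hn hn'
    obtain ⟨h1, h2, -⟩ := (hnode n hn.1 hn.2).2.2 n' hnn hn'.2
    have hd : 0 ≤ lam n' - lam n := by linarith
    have h3 : 495 / 1000 * ℓ * (lam n' - lam n) ≤ 2 * (k * ℓ) := by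
      calc _ ≤ 495 / 1000 * Real.log (9 / 10 * x) * (lam n' - lam n) := by
            gcongr
            linarith
        _ ≤ _ := h2
        _ ≤ _ := by gcongr
    have h4 : 495 / 1000 * (lam n' - lam n) ≤ 2 * k := by
      refine le_of_mul_le_mul_left ?_ (by linarith : (0 : ℝ) < ℓ)
      linarith
    have h5 : y * (lam n' - lam n) ≤ 0.368 * (lam n' - lam n) := by gcongr
    nlinarith
  have hmS : m ∈ S := by rw [hmemS]; omega
  have hdist : ∀ n ∈ S, ∀ k : ℝ, 0 ≤ k → |(n : ℝ) - m| ≤ k * ℓ → ‖a n - c‖ ≤ 3 / 2 + 1.49 * k := by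
    intro n hn k hk0 hk
    rw [abs_le] at hk
    have e : a n - c = -(3 / 2 : ℝ) + (y * (lam n - lam m) : ℝ) * Complex.I := by
      rw [ha, hc, ht, ← hxdef]
      push_cast
      ring
    have habs : |y * (lam n - lam m)| ≤ 1.49 * k := by
      rcases lt_trichotomy n m with hnm | hnm | hnm
      · have := hpair n m hn hmS hnm k (by linarith)
        have h1 : lam n < lam m := by
          rw [hmemS] at hn
          exact ((hnode n hn.1 hn.2).2.2 m hnm (by omega)).1
        rw [abs_of_nonpos (by nlinarith)]
        linarith
      · rw [hnm, sub_self, mul_zero, abs_zero]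
        positivity
      · have := hpair m n hmS hn hnm k (by linarith)
        have h1 : lam m < lam n := by
          rw [hmemS] at hn
          exact ((hnode m (by omega) (by omega)).2.2 n hnm hn.2).1
        rwa [abs_of_nonneg (by nlinarith)]
    rw [e]
    refine (norm_add_le _ _).trans ?_
    rw [norm_neg, norm_mul, Complex.norm_I, mul_one, Complex.norm_real, Complex.norm_real,
      Real.norm_eq_abs, Real.norm_eq_abs, abs_of_pos (by norm_num : (0 : ℝ) < 3 / 2)]
    linarith
  have hd15 : ∀ n ∈ S, ‖a n - c‖ ≤ 24 := by
    intro n hn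
    have h1 := hdist n hn 15 (by norm_num) (by
      rw [hmemS] at hn
      have h1 : (m : ℝ) ≤ n + 15 * ℓ := by exact_mod_cast hn.1
      have h2 : (n : ℝ) ≤ m + 15 * ℓ := by exact_mod_cast hn.2
      rw [abs_le]
      constructor <;> linarith)
    linarith
  have hd7 : ∀ n ∈ Finset.Icc (m - 7 * ℓ) (m + 7 * ℓ), ‖a n - c‖ ≤ 12 := by
    intro n hn
    rw [Finset.mem_Icc] at hn
    have h1 := hdist n (by rw [hmemS]; omega) 7 (by norm_num) (by
      have h1 : (m : ℝ) ≤ n + 7 * ℓ := by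
        have : m ≤ n + 7 * ℓ := by omega
        exact_mod_cast this
      have h2 : (n : ℝ) ≤ m + 7 * ℓ := by exact_mod_cast hn.2
      rw [abs_le]
      constructor <;> linarith)
    linarith
  have hsep : ∀ n ∈ S, ∀ n' ∈ S, n ≠ n' → 1 / x ≤ ‖a n - a n'‖ := by
    have key : ∀ n ∈ S, ∀ n' ∈ S, n < n' → 1 / x ≤ ‖a n - a n'‖ := by
      intro n hn n' hn' hnn
      rw [hmemS] at hn hn'
      obtain ⟨h1, -, h3⟩ := (hnode n hn.1 hn.2).2.2 n' hnn hn'.2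
      have e : a n - a n' = -(((y * (lam n' - lam n) : ℝ) : ℂ) * Complex.I) := by
        rw [ha]
        push_cast
        ring
      rw [e, norm_neg, norm_mul, Complex.norm_I, mul_one, Complex.norm_real,
        Real.norm_of_nonneg (by nlinarith), div_le_iff₀ hx0]
      refine h3.trans ?_
      have : 500 * Real.log (2 * x) * (lam n' - lam n) ≤ y * x * (lam n' - lam n) := by
        have : 0 ≤ lam n' - lam n := by linarith
        gcongr
      linarith
    intro n hn n' hn' hne
    rcases hne.lt_or_gt with hlt | hlt
    · exact key n hn n' hn' hlt
    · rw [norm_sub_rev]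
      exact key n' hn' n hn hlt
  -- The node bound 0.441 x is 0.49 · 0.9 x, since every scale in the window is at least 0.9 x.
  have hmain := norm_center_le_of_nodes (c := c) (r := 48) (δ := 1 / x) (by norm_num)
    (by positivity) a S (G := f) (K := C * t ^ 28 * Real.exp (-(Real.pi / 4 * t)))
    (ε := Real.exp (-(441 / 1000 * x))) differentiable_f (Real.exp_pos _).le (by
      intro w hw
      have h1 := Complex.abs_re_le_norm (w - c)
      have h2 := Complex.abs_im_le_norm (w - c)
      rw [hw] at h1 h2
      refine hC t hx5 w ?_ ?_
      · simp [hc] at h1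
        rw [abs_le] at h1 ⊢
        constructor <;> linarith
      · simpa [hc] using h2) (fun n hn => by linarith [hd15 n hn]) hsep (by
      intro n hn
      rw [hmemS] at hn
      obtain ⟨h1, h2, -⟩ := hnode n hn.1 hn.2
      refine (hsmall n h1).trans (Real.exp_le_exp.mpr ?_)
      linarith)
  have hprod : ∏ n ∈ S, (‖a n - c‖ / 48) ≤ Real.exp 30 / t ^ 30 := by
    refine (prod_nodes_le hLm (fun n => by positivity) (fun n hn => ?_) (fun n hn => ?_)).trans ?_
    · linarith [hd15 n hn]
    · linarith [hd7 n hn]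
    · have : t ^ 30 = Real.exp (30 * Real.log t) := by
        rw [← Real.exp_log (pow_pos ht0 30), Real.log_pow]
        norm_num
      rw [this, ← Real.exp_sub]
      apply Real.exp_le_exp.mpr
      linarith
  have hcard : S.card = 30 * ℓ + 1 := by
    rw [hS, Nat.card_Icc]
    omega
  have hq : (4 * 48 / (1 / x) + 2) ^ S.card ≤ Real.exp (14 / 100 * x) := by
    have e : 4 * 48 / (1 / x) + 2 = 192 * x + 2 := by
      rw [div_div_eq_mul_div, div_one]
      ring
    rw [hcard, e]
    exact nodes_pow_le hx0 hx1 (hℓ1.trans hlogx) hx4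
  have hcen := le_norm_f_center (by linarith : 4 ≤ t)
  rw [← hc] at hcen
  have hK0 : 0 ≤ C * t ^ 28 * Real.exp (-(Real.pi / 4 * t)) := by positivity
  have h1 := mul_le_mul_of_nonneg_left hprod hK0
  have h2 := mul_le_mul_of_nonneg_left hq (Real.exp_pos (-(441 / 1000 * x))).le
  exact absurd (hcen.trans (hmain.trans (add_le_add h1 h2)))
    (interpolation_bound_lt hC0 hx5 htx hx6).not_ge

/-! ### Nonvanishing of f at the origin. -/

lemma norm_zetaTerm_half_le (n : ℕ) :
    ‖zetaTerm n (1 / 2)‖ ≤ 1 / 2 * (1 / √(n + 1 : ℝ) - 1 / √((n + 1 : ℕ) + 1 : ℝ)) := by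
  set p := √(n + 1 : ℝ) with hp
  set q := √((n + 1 : ℕ) + 1 : ℝ) with hq
  have hp0 : 0 < p := Real.sqrt_pos.mpr (by positivity)
  have hpq : p ≤ q := Real.sqrt_le_sqrt (by push_cast; linarith)
  have hq0 : 0 < q := hp0.trans_le hpq
  have hp2 : p ^ 2 = n + 1 := Real.sq_sqrt (by positivity)
  have hq2 : q ^ 2 = p ^ 2 + 1 := by
    rw [hq, Real.sq_sqrt (by positivity), hp2]
    push_cast
    ring
  have e : zetaTerm n (1 / 2) = ((-(1 / 2) * p⁻¹ - p + q : ℝ) : ℂ) := by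
    unfold zetaTerm
    have h1 : ((n + 1 : ℝ) : ℂ) ^ (1 - 1 / 2 : ℂ) = (p : ℂ) := by
      rw [hp, Real.sqrt_eq_rpow, Complex.ofReal_cpow (by positivity)]
      norm_num
    have h2 : ((n + 2 : ℝ) : ℂ) ^ (1 - 1 / 2 : ℂ) = (q : ℂ) := by
      have : ((n + 1 : ℕ) + 1 : ℝ) = n + 2 := by push_cast; ring
      rw [hq, this, Real.sqrt_eq_rpow, Complex.ofReal_cpow (by positivity)]
      norm_num
    have h3 : ((n + 1 : ℝ) : ℂ) ^ (-(1 / 2) : ℂ) = ((p⁻¹ : ℝ) : ℂ) := by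
      rw [hp, Real.sqrt_eq_rpow, ← Real.rpow_neg (by positivity),
        Complex.ofReal_cpow (by positivity)]
      norm_num
    rw [h1, h2, h3]
    push_cast
    ring
  have hqp : q - p = 1 / (p + q) := by
    rw [eq_div_iff (by positivity)]
    linarith
  have e1 : -(1 / 2) * p⁻¹ - p + q = 1 / (p + q) - 1 / (2 * p) := by
    rw [← hqp]
    field_simp
    ring
  rw [e, Complex.norm_real, e1, Real.norm_eq_abs, abs_le]
  have h1 : 1 / (p + q) ≤ 1 / (2 * p) := one_div_le_one_div_of_le (by positivity) (by linarith)
  have h2 : 1 / (2 * q) ≤ 1 / (p + q) := one_div_le_one_div_of_le (by positivity) (by linarith)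
  have h3 : 1 / q ≤ 1 / p := one_div_le_one_div_of_le hp0 hpq
  have e2 : 1 / (2 * p) = 1 / 2 * (1 / p) := by field_simp
  have e3 : 1 / (2 * q) = 1 / 2 * (1 / q) := by field_simp
  constructor <;> linarith

/-- The telescoping majorant of the series at 1/2 sums to 1/2 < 1, so the leading 1 cannot be
cancelled. -/
lemma riemannZeta₁_half_ne_zero : riemannZeta₁ (1 / 2) ≠ 0 := by
  rw [riemannZeta₁_eq_tsum (by norm_num)]
  have hsum : HasSum (fun n : ℕ => 1 / 2 * (1 / √(n + 1 : ℝ) - 1 / √((n + 1 : ℕ) + 1 : ℝ)))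
      (1 / 2 * (1 - 0)) := by
    refine HasSum.mul_left _ ?_
    rw [hasSum_iff_tendsto_nat_of_nonneg]
    · have h (N : ℕ) := Finset.sum_range_sub' (fun n : ℕ => 1 / √(n + 1 : ℝ)) N
      simp_rw [h]
      refine Tendsto.sub (by simp) ?_
      simp_rw [one_div]
      exact tendsto_inv_atTop_zero.comp (Real.tendsto_sqrt_atTop.comp
        (tendsto_atTop_add_const_right _ _ tendsto_natCast_atTop_atTop))
    · intro n
      rw [sub_nonneg]
      refine one_div_le_one_div_of_le (Real.sqrt_pos.mpr (by positivity)) ?_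
      exact Real.sqrt_le_sqrt (by push_cast; linarith)
  have hle := tsum_of_norm_bounded hsum norm_zetaTerm_half_le
  intro h
  rw [add_eq_zero_iff_eq_neg'] at h
  rw [h, norm_neg, norm_one] at hle
  norm_num at hle

lemma f_zero_ne_zero : f 0 ≠ 0 := by
  rw [← norm_ne_zero_iff, norm_f_eq (by norm_num)]
  have h1 : Complex.Gamma (5 / 4 + 0 / 2) ≠ 0 :=
    Complex.Gamma_ne_zero_of_re_pos (by norm_num)
  have h2 : riemannZeta₁ (1 / 2 + 0) ≠ 0 := by
    rw [add_zero]
    exact riemannZeta₁_half_ne_zero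
  have h3 : (0 : ℝ) < Real.pi ^ (-(1 / 2 + (0 : ℂ).re) / 2) := Real.rpow_pos_of_pos Real.pi_pos _
  exact mul_ne_zero (mul_ne_zero h3.ne' (norm_ne_zero_iff.mpr h1)) (norm_ne_zero_iff.mpr h2)

/-! ### Limits in Ω and ℧₋. -/

lemma lt_norm_f_of_expPhase_lt_one {n : ℕ} (hn : 0 < n) {a : ℝ} (ha : 1 / 2 < a) {z : ℂ}
    (h : expPhase n a z < 1) : ‖z‖ ^ (2 * n) * fReal a < ‖f (a * z)‖ := by
  have hbase : ‖z ^ (2 * n) * f a‖ₑ / ‖f (a * z)‖ₑ < 1 := by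
    by_contra! hle
    exact absurd h (ENNReal.one_le_rpow hle (by positivity)).not_gt
  have hF := fReal_pos ha
  have hlt : ‖z ^ (2 * n) * f a‖ₑ < ‖f (a * z)‖ₑ := by
    have hne : ‖f (a * z)‖ₑ ≠ 0 := by
      intro h0
      rw [h0] at hbase
      -- At z = 0 the numerator vanishes, and 0/0 = 0 in `ℝ≥0∞` would satisfy the hypothesis; hence
      -- the need for f(0) ≠ 0.
      rcases eq_or_ne z 0 with rfl | hz
      · rw [mul_zero, enorm_eq_zero] at h0
        exact f_zero_ne_zero h0
      · have : ‖z ^ (2 * n) * f a‖ₑ ≠ 0 := by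
          rw [enorm_ne_zero, f_ofReal ha]
          exact mul_ne_zero (pow_ne_zero _ hz) (by exact_mod_cast hF.ne')
        rw [ENNReal.div_zero this] at hbase
        exact absurd hbase (by simp)
    rwa [ENNReal.div_lt_iff (Or.inl hne) (Or.inl enorm_ne_top), one_mul] at hbase
  rw [← ofReal_norm, ← ofReal_norm, ENNReal.ofReal_lt_ofReal_iff_of_nonneg
    (norm_nonneg _), norm_mul, norm_pow, norm_f_ofReal ha] at hlt
  exact hlt

lemma norm_f_lt_of_one_lt_expPhase {n : ℕ} {a : ℝ} (ha : 1 / 2 < a) {z : ℂ}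
    (h : 1 < expPhase n a z) : ‖f (a * z)‖ < ‖z‖ ^ (2 * n) * fReal a := by
  have hbase : 1 < ‖z ^ (2 * n) * f a‖ₑ / ‖f (a * z)‖ₑ := by
    by_contra! hle
    exact absurd h (ENNReal.rpow_le_one hle (by positivity)).not_gt
  have hlt : ‖f (a * z)‖ₑ < ‖z ^ (2 * n) * f a‖ₑ := by
    by_contra! hle
    exact absurd hbase (ENNReal.div_le_of_le_mul (by rwa [one_mul])).not_gt
  rw [← ofReal_norm, ← ofReal_norm, ENNReal.ofReal_lt_ofReal_iff_of_nonneg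
    (norm_nonneg _), norm_mul, norm_pow, norm_f_ofReal ha] at hlt
  exact hlt

lemma tendsto_phaseCurv_scale {lam : ℕ → ℝ} (h : ∀ᶠ n : ℕ in atTop, IsScale n (lam n)) :
    Tendsto (fun n => √(phaseCurv (lam n))) atTop atTop := by
  refine Real.tendsto_sqrt_atTop.comp (tendsto_atTop_mono' _ ?_
    ((tendsto_of_isScale h).atTop_div_const (by norm_num : (0 : ℝ) < 4)))
  filter_upwards [eventually_scale_bounds h] with n hn
  linarith [hn.2.2.1, hn.2.2.2.2.2.2]

lemma tendsto_norm_remainderRatio {lam : ℕ → ℝ} (h : ∀ᶠ n : ℕ in atTop, IsScale n (lam n)) {z : ℂ}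
    (hz : z ^ 2 ≠ 1) : Tendsto (fun n : ℕ => ‖remainderRatio z n (lam n)‖) atTop (𝓝 0) := by
  have h1 := (tendsto_remainderRatio h hz).norm
  have h2 := (tendsto_inv_atTop_zero.comp (tendsto_phaseCurv_scale h)).mul h1
  rw [zero_mul] at h2
  refine h2.congr' ?_
  filter_upwards [(tendsto_phaseCurv_scale h).eventually_gt_atTop 0] with n hn
  simp only [Function.comp]
  rw [norm_mul, Complex.norm_real, Real.norm_of_nonneg hn.le, inv_mul_cancel_left₀ hn.ne']

/-- With |Re z| < 1 the cone estimate, after reflection if Re z < 0, gives |f(λz)| ≤ f(λ)e^{-λ}.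
This contradicts |f(λz)| > |z|^{2n} f(λ) when |z| ≥ 1. -/
lemma norm_lt_one_of_mem_Omega {lam : ℕ → ℝ} (h : ∀ᶠ n : ℕ in atTop, IsScale n (lam n)) {z : ℂ}
    (hz : ∀ᶠ n : ℕ in atTop, z ∈ Omega n (lam n)) : ‖z‖ < 1 := by
  by_contra! hz1
  obtain ⟨n₀, hn₀⟩ := hz.exists
  have hre : |z.re| < 1 := hn₀.1
  have key : ∀ᶠ n : ℕ in atTop, ‖f (lam n * z)‖ ≤ fReal (lam n) * Real.exp (-lam n) := by
    have hU := (tendsto_of_isScale h).eventually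
      (eventually_norm_f_le_of_re_le (abs_nonneg z.re) hre ‖z‖)
    filter_upwards [hU, eventually_scale_bounds h] with n hn hb
    have hl : 0 < lam n := by linarith [hb.1]
    have hnorm : ‖(lam n : ℂ) * z‖ ≤ ‖z‖ * lam n := by
      rw [norm_mul, Complex.norm_real, Real.norm_of_nonneg hl.le, mul_comm]
    rcases le_total 0 z.re with h0 | h0
    · refine hn _ ?_ ?_ hnorm
      · rw [Complex.re_ofReal_mul]; positivity
      · rw [Complex.re_ofReal_mul, abs_of_nonneg h0, mul_comm]
    · rw [← f_neg]
      refine hn _ ?_ ?_ (by rwa [norm_neg])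
      · rw [Complex.neg_re, Complex.re_ofReal_mul]; nlinarith
      · rw [Complex.neg_re, Complex.re_ofReal_mul, abs_of_nonpos h0]; linarith
  obtain ⟨n, ⟨hn1, hn2⟩, hn3, hn4⟩ := ((hz.and key).and ((eventually_scale_bounds h).and
    (eventually_gt_atTop 0))).exists
  have hl : 1 / 2 < lam n := by linarith [hn3.1]
  have h1 := lt_norm_f_of_expPhase_lt_one hn4 hl hn1.2
  have hF := fReal_pos hl
  have h2 : fReal (lam n) * Real.exp (-lam n) ≤ fReal (lam n) * 1 := by
    gcongr
    rw [Real.exp_le_one_iff]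
    linarith
  have h3 : 1 * fReal (lam n) ≤ ‖z‖ ^ (2 * n) * fReal (lam n) := by
    gcongr
    exact one_le_pow₀ hz1
  linarith

lemma norm_remainder_div_le {n : ℕ} (hn : 0 < n) {a : ℝ} (ha : 1 / 2 < a) {z : ℂ}
    (h : expPhase n a z < 1) (J : ℂ) : ‖z ^ (2 * n) * f a * J / f (a * z)‖ ≤ ‖J‖ := by
  have h1 := lt_norm_f_of_expPhase_lt_one hn ha h
  have hF := fReal_pos ha
  have h2 : 0 < ‖f (a * z)‖ := lt_of_le_of_lt (by positivity) h1
  rw [norm_div, norm_mul, norm_mul, norm_pow, norm_f_ofReal ha, div_le_iff₀ h2, mul_comm ‖J‖]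
  gcongr

theorem tendsto_of_mem_Omega {lam : ℕ → ℝ} (h : ∀ᶠ n : ℕ in atTop, IsScale n (lam n)) {z : ℂ}
    (hz : ∀ᶠ n : ℕ in atTop, z ∈ Omega n (lam n)) :
    Tendsto (fun n : ℕ => ‖T (2 * n) (lam n * z) / f (lam n * z) - 1‖) atTop (𝓝 0) := by
  have hz1 := norm_lt_one_of_mem_Omega h hz
  have hz2 : z ^ 2 ≠ 1 := by
    intro h2
    have := congrArg norm h2
    rw [norm_pow, norm_one] at this
    nlinarith [norm_nonneg z]
  refine squeeze_zero' (Eventually.of_forall fun _ => norm_nonneg _) ?_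
    (tendsto_norm_remainderRatio h hz2)
  filter_upwards [eventually_T_eq h z, hz, h, eventually_gt_atTop 0] with n hn hzn hsc hn0
  have hne : f (lam n * z) ≠ 0 := by
    rw [← norm_pos_iff]
    have hF := fReal_pos hsc.1
    exact lt_of_le_of_lt (by positivity) (lt_norm_f_of_expPhase_lt_one hn0 hsc.1 hzn.2)
  rw [hn, if_pos hz1, add_div, div_self hne, add_sub_cancel_left]
  exact norm_remainder_div_le hn0 hsc.1 hzn.2 _

theorem tendsto_of_mem_MhoMinus {lam : ℕ → ℝ} (h : ∀ᶠ n : ℕ in atTop, IsScale n (lam n)) {z : ℂ}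
    (hz : ∀ᶠ n : ℕ in atTop, z ∈ MhoMinus n (lam n)) :
    Tendsto (fun n : ℕ => ‖T (2 * n) (lam n * z) / f (lam n * z)‖) atTop (𝓝 0) := by
  obtain ⟨n₀, hn₀⟩ := hz.exists
  have hz1 : 1 < ‖z‖ := lt_of_lt_of_le hn₀.1 (Complex.abs_re_le_norm z)
  have hz2 : z ^ 2 ≠ 1 := by
    intro h2
    have := congrArg norm h2
    rw [norm_pow, norm_one] at this
    nlinarith
  refine squeeze_zero' (Eventually.of_forall fun _ => norm_nonneg _) ?_
    (tendsto_norm_remainderRatio h hz2)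
  filter_upwards [eventually_T_eq h z, hz, h, eventually_gt_atTop 0] with n hn hzn hsc hn0
  rw [hn, if_neg hz1.not_gt, zero_add]
  exact norm_remainder_div_le hn0 hsc.1 hzn.2 _

/-! ### Divergence in ℧₊. -/

/-- Exponential dominance of `z^(2n) f(lam)` over `f(lam z)` makes the ratio blow up. -/
theorem tendsto_top_of_growth {lam : ℕ → ℝ} (h : ∀ᶠ n : ℕ in atTop, IsScale n (lam n)) {z : ℂ}
    (hz0 : z ≠ 0) (hz : z ^ 2 ≠ 1) {c : ℝ} (hc : 0 < c)
    (hg : ∀ᶠ n : ℕ in atTop,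
      ‖f (lam n * z)‖ * Real.exp (c * lam n) ≤ ‖z‖ ^ (2 * n) * fReal (lam n)) :
    Tendsto (fun n : ℕ => ‖T (2 * n) (lam n * z)‖ₑ / ‖f (lam n * z)‖ₑ) atTop (𝓝 (⊤ : ℝ≥0∞)) := by
  have hlam := tendsto_of_isScale h
  have hlim := (tendsto_remainderRatio h hz).norm
  set d := ‖(-(1 / (2 * Real.pi)) * (√(2 * Real.pi) * kernel z 0) : ℂ)‖ with hd
  have hd0 : 0 < d := by
    have hpi := Real.pi_pos
    have h1 : (√(2 * Real.pi) : ℂ) ≠ 0 := by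
      exact_mod_cast (Real.sqrt_pos.mpr (by positivity : 0 < 2 * Real.pi)).ne'
    have h2 : (Real.pi : ℂ) ≠ 0 := by exact_mod_cast hpi.ne'
    have h3 : kernel z 0 ≠ 0 := by
      unfold kernel
      have : Complex.exp (2 * 0) - z ^ 2 ≠ 0 := by
        rw [mul_zero, Complex.exp_zero]
        exact sub_ne_zero.mpr hz.symm
      exact div_ne_zero (mul_ne_zero two_ne_zero (pow_ne_zero _ hz0)) this
    rw [hd, norm_pos_iff]
    refine mul_ne_zero (neg_ne_zero.mpr (one_div_ne_zero (mul_ne_zero two_ne_zero h2)))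
      (mul_ne_zero h1 h3)
  rw [ENNReal.tendsto_nhds_top_iff_nat]
  intro k
  -- The factor 1000 x² bounds √W, the polynomial loss in J_n. The extra 1 in k + 1 pays for the
  -- term f(λz) present when |z| < 1.
  have hexp : ∀ᶠ x : ℝ in atTop, (k + 1) * (1000 * x ^ 2) < d / 2 * Real.exp (c * x) := by
    have h1 := Real.tendsto_pow_mul_exp_neg_atTop_nhds_zero 2
    have h2 := (h1.comp (tendsto_id.const_mul_atTop hc : Tendsto (fun x : ℝ => c * x) atTop atTop))
    have hpos : 0 < d / 2 * c ^ 2 / ((k + 1) * 1000) := by positivity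
    filter_upwards [h2.eventually (gt_mem_nhds hpos)] with x hx
    simp only [Function.comp] at hx
    rw [Real.exp_neg, ← div_eq_mul_inv, div_lt_iff₀ (Real.exp_pos _), div_mul_eq_mul_div,
      lt_div_iff₀ (by positivity), mul_pow] at hx
    have hc2 : 0 < c ^ 2 := by positivity
    refine lt_of_mul_lt_mul_left ?_ hc2.le
    linarith
  filter_upwards [eventually_T_eq h z, hg, h, eventually_scale_bounds h,
    hlim.eventually (lt_mem_nhds (half_lt_self hd0)), hlam.eventually hexp,
    (tendsto_phaseCurv_scale h).eventually_gt_atTop 0] with n hT hgn hsc hb hJ hx hW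
  have hF := fReal_pos hsc.1
  set g := ‖z‖ ^ (2 * n) * fReal (lam n) with hgdef
  have hg0 : 0 < g := by
    have : 0 < ‖z‖ := norm_pos_iff.mpr hz0
    positivity
  set J := remainderRatio z n (lam n) with hJdef
  rw [norm_mul, Complex.norm_real, Real.norm_of_nonneg hW.le] at hJ
  have hl1 : 1 ≤ lam n := by linarith [hb.1]
  have hWle : √(phaseCurv (lam n)) ≤ 1000 * lam n ^ 2 := by
    rw [Real.sqrt_le_left (by positivity)]
    refine hb.2.2.2.1.trans ?_
    have h1 : Real.log (lam n) ≤ lam n := Real.log_le_self (by linarith)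
    have h2 : lam n * Real.log (lam n) ≤ lam n * lam n := by gcongr
    have h3 : (1 : ℝ) ≤ lam n ^ 2 := one_le_pow₀ hl1
    nlinarith
  have hJlow : d / 2 ≤ 1000 * lam n ^ 2 * ‖J‖ := by
    refine hJ.le.trans ?_
    gcongr
  have hTlow : g * ‖J‖ - ‖f (lam n * z)‖ ≤ ‖T (2 * n) (lam n * z)‖ := by
    have e : ‖z ^ (2 * n) * f (lam n) * J‖ = g * ‖J‖ := by
      rw [norm_mul, norm_mul, norm_pow, norm_f_ofReal hsc.1]
    have h1 : z ^ (2 * n) * f (lam n) * J =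
        T (2 * n) (lam n * z) - (if ‖z‖ < 1 then f (lam n * z) else 0) := by
      rw [hT]; ring
    rw [← e, h1]
    have h2 := norm_sub_le (T (2 * n) (lam n * z)) (if ‖z‖ < 1 then f (lam n * z) else 0)
    have h3 : ‖(if ‖z‖ < 1 then f (lam n * z) else 0)‖ ≤ ‖f (lam n * z)‖ := by
      split_ifs
      · exact le_rfl
      · simp
    linarith
  have hkey : (k + 1) * ‖f (lam n * z)‖ < g * ‖J‖ := by
    set E := Real.exp (c * lam n) with hE
    have hE0 : 0 < E := Real.exp_pos _
    have h2 : 0 < 1000 * lam n ^ 2 := by positivity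
    have h3 : (k + 1) * (1000 * lam n ^ 2) < 1000 * lam n ^ 2 * ‖J‖ * E := by
      refine hx.trans_le ?_
      gcongr
    have h4 : (k + 1) < ‖J‖ * E := by
      refine lt_of_mul_lt_mul_left ?_ h2.le
      linarith
    have hf : ‖f (lam n * z)‖ ≤ g / E := by rwa [le_div_iff₀ hE0]
    calc (k + 1) * ‖f (lam n * z)‖ ≤ (k + 1) * (g / E) := by gcongr
      _ < ‖J‖ * E * (g / E) := by gcongr
      _ = g * ‖J‖ := by field_simp
  have hlt : k * ‖f (lam n * z)‖ < ‖T (2 * n) (lam n * z)‖ := by linarith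
  have hT0 : ‖T (2 * n) (lam n * z)‖ₑ ≠ 0 := by
    rw [enorm_ne_zero, ← norm_pos_iff]
    exact lt_of_le_of_lt (by positivity) hlt
  rw [ENNReal.lt_div_iff_mul_lt (Or.inr (by simp)) (Or.inl enorm_ne_top)]
  rw [← ofReal_norm, ← ofReal_norm, ← ENNReal.ofReal_natCast,
    ← ENNReal.ofReal_mul (by positivity)]
  exact ENNReal.ofReal_lt_ofReal_iff_of_nonneg (by positivity) |>.mpr hlt

lemma cubic_le_exp {v : ℝ} (hv : 0 ≤ v) : 1 + v + v ^ 2 / 2 + v ^ 3 / 6 ≤ Real.exp v := by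
  have := Real.sum_le_exp_of_nonneg hv 4
  simp [Finset.sum_range_succ, Nat.factorial] at this
  linarith

/-- Half-angle formulas reduce this to θ/2 ≤ tan(θ/2). -/
lemma mul_sin_le_two_mul_one_sub_cos {θ : ℝ} (h0 : 0 ≤ θ) (h1 : θ < Real.pi / 2) :
    θ * Real.sin θ ≤ 2 * (1 - Real.cos θ) := by
  have hpi := Real.pi_pos
  have hs : Real.sin θ = 2 * Real.sin (θ / 2) * Real.cos (θ / 2) := by
    rw [← Real.sin_two_mul]; ring_nf
  have hc : Real.cos θ = 1 - 2 * Real.sin (θ / 2) ^ 2 := by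
    have : Real.cos θ = Real.cos (2 * (θ / 2)) := by ring_nf
    rw [this, Real.cos_two_mul, Real.cos_sq']
    ring
  have hcpos : 0 < Real.cos (θ / 2) := Real.cos_pos_of_mem_Ioo ⟨by linarith, by linarith⟩
  have hsin0 : 0 ≤ Real.sin (θ / 2) := Real.sin_nonneg_of_nonneg_of_le_pi (by linarith) (by linarith)
  have htan := Real.le_tan (by linarith : 0 ≤ θ / 2) (by linarith)
  rw [Real.tan_eq_sin_div_cos, le_div_iff₀ hcpos] at htan
  rw [hs, hc]
  nlinarith [mul_le_mul_of_nonneg_right htan hsin0]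

/-- The degenerate direction of the phase occurs only at `1`. -/
lemma eq_one_of_phase_eq_zero {z : ℂ} (hx : 0 < z.re) (h1 : Real.log ‖z‖ = z.re - 1)
    (h2 : z.im * Real.arctan (z.im / z.re) = (z.re - 1) ^ 2) : z = 1 := by
  wlog hy : 0 ≤ z.im generalizing z
  · have := this (z := (starRingEnd ℂ) z) (by simpa using hx) (by simpa using h1) (by
      simp only [Complex.conj_im, Complex.conj_re, neg_div, Real.arctan_neg]
      linarith) (by simp; linarith)
    rw [← Complex.conj_conj z, this, map_one]
  set x := z.re with hxd
  set y := z.im with hyd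
  set R := ‖z‖ with hRd
  have hz0 : z ≠ 0 := by
    rintro rfl
    simp [hxd] at hx
  have hR0 : 0 < R := norm_pos_iff.mpr hz0
  have hR2 : R ^ 2 = x ^ 2 + y ^ 2 := by
    rw [hRd, ← Complex.normSq_eq_norm_sq, Complex.normSq_apply]
    ring
  set θ := Real.arctan (y / x) with hθ
  have hθ0 : 0 ≤ θ := Real.arctan_nonneg.mpr (by positivity)
  have hθ1 : θ < Real.pi / 2 := Real.arctan_lt_pi_div_two _
  have hcos : 0 < Real.cos θ := Real.cos_arctan_pos _
  have htan : Real.sin θ * x = y * Real.cos θ := by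
    have := Real.tan_arctan (y / x)
    rw [Real.tan_eq_sin_div_cos, div_eq_div_iff hcos.ne' hx.ne'] at this
    exact this
  have hRcos : R * Real.cos θ = x := by
    have h3 : (R * Real.cos θ) ^ 2 = x ^ 2 := by
      have h4 := Real.sin_sq_add_cos_sq θ
      have h5 : (Real.sin θ * x) ^ 2 = (y * Real.cos θ) ^ 2 := by rw [htan]
      rw [mul_pow, hR2]
      nlinarith
    exact (pow_left_inj₀ (by positivity) hx.le two_ne_zero).mp h3
  have hRsin : R * Real.sin θ = y := by
    have : R * Real.sin θ * x = y * x := by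
      calc _ = R * (Real.sin θ * x) := by ring
        _ = y * (R * Real.cos θ) := by rw [htan]; ring
        _ = y * x := by rw [hRcos]
    exact mul_right_cancel₀ hx.ne' this
  have hRexp : R = Real.exp (x - 1) := by rw [← h1, Real.exp_log hR0]
  rcases lt_trichotomy x 1 with hx1 | hx1 | hx1
  -- With v = 1 - x, the second equation and θ sin θ ≤ 2(1 - cos θ) give R ≥ 1 - v + v²/2, too large
  -- for R e^v = 1.
  · exfalso
    have hv : 0 < 1 - x := by linarith
    have h3 := mul_sin_le_two_mul_one_sub_cos hθ0 hθ1
    have h4 : (x - 1) ^ 2 ≤ 2 * (R - x) := by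
      calc (x - 1) ^ 2 = R * (θ * Real.sin θ) := by rw [← h2, ← hRsin]; ring
        _ ≤ R * (2 * (1 - Real.cos θ)) := by gcongr
        _ = 2 * (R - R * Real.cos θ) := by ring
        _ = _ := by rw [hRcos]
    have h5 := cubic_le_exp hv.le
    have h6 : R * Real.exp (1 - x) = 1 := by
      rw [hRexp, ← Real.exp_add]
      ring_nf
      exact Real.exp_zero
    set v := 1 - x with hvd
    have hxv : x = 1 - v := by rw [hvd]; ring
    rw [hxv] at h4
    have h7 : 1 - v + v ^ 2 / 2 ≤ R := by nlinarith
    have h8 : 0 < 1 - v + v ^ 2 / 2 := by nlinarith [sq_nonneg (v - 1)]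
    have h9 : (1 - v + v ^ 2 / 2) * (1 + v + v ^ 2 / 2 + v ^ 3 / 6) ≤ R * Real.exp v := by
      gcongr
    have h10 : (1 - v + v ^ 2 / 2) * (1 + v + v ^ 2 / 2 + v ^ 3 / 6) =
        1 + (v ^ 3 / 6 + v ^ 4 / 12 + v ^ 5 / 12) := by ring
    have h11 : 0 < v ^ 3 / 6 + v ^ 4 / 12 + v ^ 5 / 12 := by positivity
    linarith
  · have h3 : y = 0 := by
      have : R = 1 := by rw [hRexp, hx1, sub_self, Real.exp_zero]
      rw [this, hx1] at hR2
      nlinarith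
    exact Complex.ext (by rw [← hxd, hx1, Complex.one_re]) (by rw [← hyd, h3, Complex.one_im])
  -- With u = x - 1, sin θ ≤ θ gives R(R - u²) ≤ (1 + u)². The Taylor lower bound p for R = e^u
  -- makes the left side strictly larger.
  · exfalso
    have hu : 0 < x - 1 := by linarith
    have h3 : Real.sin θ ≤ θ := Real.sin_le hθ0
    have h4 : y ^ 2 ≤ R * (x - 1) ^ 2 := by
      calc y ^ 2 = R * (y * Real.sin θ) := by rw [← hRsin]; ring
        _ ≤ R * (y * θ) := by gcongr
        _ = _ := by rw [h2]
    have h5 := cubic_le_exp hu.le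
    rw [← hRexp] at h5
    set u := x - 1 with hud
    have hxu : x = 1 + u := by rw [hud]; ring
    have h6 : y ^ 2 = R ^ 2 - (1 + u) ^ 2 := by rw [hR2, hxu]; ring
    set p := 1 + u + u ^ 2 / 2 + u ^ 3 / 6 with hp
    have h7 : p * (p - u ^ 2) = (1 + u) ^ 2 + (u ^ 3 / 3 + u ^ 4 / 12 + u ^ 6 / 36) := by
      rw [hp]; ring
    have h8 : 0 < u ^ 3 / 3 + u ^ 4 / 12 + u ^ 6 / 36 := by positivity
    have hp0 : 0 < p := by positivity
    have h9 : 0 < p - u ^ 2 := by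
      refine pos_of_mul_pos_right ?_ hp0.le
      rw [h7]; positivity
    have h10 : p * (p - u ^ 2) ≤ R * (R - u ^ 2) := by
      gcongr
    nlinarith

/-- Off the imaginary axis, a phase above one is exponentially above one. -/
lemma exists_growth_of_re_pos {lam : ℕ → ℝ} (h : ∀ᶠ n : ℕ in atTop, IsScale n (lam n)) {z : ℂ}
    (hx : 0 < z.re) (hz1 : z ≠ 1)
    (hlt : ∀ᶠ n : ℕ in atTop, ‖f (lam n * z)‖ < ‖z‖ ^ (2 * n) * fReal (lam n)) :
    ∃ c : ℝ, 0 < c ∧ ∀ᶠ n : ℕ in atTop,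
      ‖f (lam n * z)‖ * Real.exp (c * lam n) ≤ ‖z‖ ^ (2 * n) * fReal (lam n) := by
  have hlam := tendsto_of_isScale h
  have hz0 : z ≠ 0 := by
    rintro rfl
    simp at hx
  have hR0 : 0 < ‖z‖ := norm_pos_iff.mpr hz0
  set A := Real.log ‖z‖ + 1 - z.re with hA
  -- At a = λ_n this is (1/λ) log|e^{nφ}|, because `scaleFun (lam n) = 2 * n`; it behaves like (A/2)
  -- log a + B.
  set q : ℝ → ℝ := fun a =>
    (scaleFun a * Real.log ‖z‖ + Real.log (fReal a) - Real.log ‖f (a * z)‖) / a with hq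
  set B := -(1 / 2) * Real.log (2 * Real.pi) * A + (1 / 2) * (z.re - 1 - z.re * Real.log ‖z‖ +
    z.im * Real.arctan (z.im / z.re)) with hB
  have hqlim : Tendsto (fun a => q a - A / 2 * Real.log a) atTop (𝓝 B) := by
    have := ((tendsto_scaleFun_div.const_mul (Real.log ‖z‖)).add tendsto_log_fReal).sub
      (tendsto_log_norm_f hx)
    convert! this using 1
    · funext a
      rw [hq, hA]
      ring
    · congr 1
      rw [hB, hA]
      ring
  have hne : ∀ᶠ n : ℕ in atTop, f (lam n * z) ≠ 0 := by
    filter_upwards [(hlam.atTop_mul_const hx).eventually_ge_atTop (1 / 2)] with n hn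
    exact f_ne_zero (by rwa [Complex.re_ofReal_mul])
  have hform : ∀ᶠ n : ℕ in atTop, 0 < ‖f (lam n * z)‖ ∧ 0 < lam n ∧
      ‖z‖ ^ (2 * n) * fReal (lam n) = ‖f (lam n * z)‖ * Real.exp (q (lam n) * lam n) := by
    filter_upwards [hne, eventually_scale_bounds h, h] with n hn hb hsc
    have hl : 0 < lam n := by linarith [hb.1]
    have hf0 : 0 < ‖f (lam n * z)‖ := norm_pos_iff.mpr hn
    refine ⟨hf0, hl, ?_⟩
    rw [hq]
    simp only
    rw [div_mul_cancel₀ _ hl.ne', Real.exp_sub, Real.exp_add, Real.exp_log hf0,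
      Real.exp_log (fReal_pos hsc.1), hb.2.1, mul_div_cancel₀ _ hf0.ne']
    congr 1
    rw [← Real.exp_log (pow_pos hR0 (2 * n)), Real.log_pow]
    push_cast
    rfl
  have hqpos : ∀ᶠ n : ℕ in atTop, 0 < q (lam n) := by
    filter_upwards [hform, hlt] with n ⟨h1, h2, h3⟩ h4
    rw [h3] at h4
    have h5 : 1 < Real.exp (q (lam n) * lam n) := by
      refine lt_of_mul_lt_mul_left ?_ h1.le
      linarith
    rw [Real.one_lt_exp_iff] at h5
    exact pos_of_mul_pos_left h5 h2.le
  have hconcl : ∀ c : ℝ, (∀ᶠ a in atTop, c ≤ q a) → ∀ᶠ n : ℕ in atTop,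
      ‖f (lam n * z)‖ * Real.exp (c * lam n) ≤ ‖z‖ ^ (2 * n) * fReal (lam n) := by
    intro c hc
    filter_upwards [hform, hlam.eventually hc] with n ⟨h1, h2, h3⟩ h4
    rw [h3]
    gcongr
  rcases lt_trichotomy A 0 with hA0 | hA0 | hA0
  · exfalso
    have h1 : Tendsto q atTop atBot := by
      have := hqlim.add_atBot (Real.tendsto_log_atTop.const_mul_atTop_of_neg
        (by linarith : A / 2 < 0))
      refine this.congr (fun a => ?_)
      ring
    obtain ⟨n, hn1, hn2⟩ := (hqpos.and ((h1.comp hlam).eventually_lt_atBot 0)).exists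
    exact absurd hn1 (not_lt.mpr hn2.le)
  · have hlim : Tendsto q atTop (𝓝 B) := by
      refine hqlim.congr (fun a => ?_)
      rw [hA0]
      ring
    have hlogz : Real.log ‖z‖ = z.re - 1 := by linarith
    have hB' : B = 1 / 2 * (z.im * Real.arctan (z.im / z.re) - (z.re - 1) ^ 2) := by
      rw [hB, hA0, hlogz]
      ring
    have hB0 : 0 ≤ B := ge_of_tendsto (hlim.comp hlam) (hqpos.mono fun n hn => hn.le)
    have hBne : B ≠ 0 := by
      intro hB0
      refine hz1 (eq_one_of_phase_eq_zero hx hlogz ?_)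
      linarith
    have hBpos : 0 < B := lt_of_le_of_ne hB0 hBne.symm
    refine ⟨B / 2, by positivity, hconcl _ ?_⟩
    filter_upwards [hlim.eventually (lt_mem_nhds (half_lt_self hBpos))] with a ha
    exact ha.le
  · have h1 : Tendsto q atTop atTop := by
      have := hqlim.add_atTop (Real.tendsto_log_atTop.const_mul_atTop
        (by linarith : 0 < A / 2))
      refine this.congr (fun a => ?_)
      ring
    exact ⟨1, one_pos, hconcl _ (h1.eventually_ge_atTop 1)⟩

/-- On the imaginary axis, a phase above one is exponentially above one. -/
lemma exists_growth_of_imag {lam : ℕ → ℝ} (h : ∀ᶠ n : ℕ in atTop, IsScale n (lam n)) {y : ℝ}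
    (hy : 0 < y)
    (hlt : ∀ᶠ n : ℕ in atTop,
      ‖f (lam n * (y * Complex.I))‖ < y ^ (2 * n) * fReal (lam n)) :
    ∀ᶠ n : ℕ in atTop,
      ‖f (lam n * (y * Complex.I))‖ * Real.exp (1 * lam n) ≤ y ^ (2 * n) * fReal (lam n) := by
  have hlam := tendsto_of_isScale h
  have hlogy : -1 < Real.log y := by
    by_contra! hle
    exact not_eventually_norm_f_imag_le h hy hle (hlt.mono fun n hn => hn.le)
  -- Both 2n and log f(λ) are asymptotic to (1/2) λ log λ, so a margin η in log y > -1 leaves an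
  -- exponent of order η λ log λ, while f on the imaginary axis is at most e^λ here.
  obtain ⟨η, hη0, hη1, hη⟩ : ∃ η : ℝ, 0 < η ∧ η ≤ 1 ∧ -(1 - η) ≤ Real.log y :=
    ⟨min 1 (1 + Real.log y), lt_min one_pos (by linarith), min_le_left _ _,
      by linarith [min_le_right 1 (1 + Real.log y)]⟩
  obtain ⟨C, hC1, hC⟩ := exists_norm_f_le_exp
  have hpoly : ∀ᶠ a : ℝ in atTop, C * (2 + a * y) ^ 6 ≤ Real.exp a := by
    have h1 := (Real.tendsto_pow_mul_exp_neg_atTop_nhds_zero 6).const_mul (C * (2 + y) ^ 6)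
    rw [mul_zero] at h1
    filter_upwards [h1.eventually (gt_mem_nhds one_pos), eventually_ge_atTop 1] with a ha ha1
    rw [Real.exp_neg, ← mul_assoc, ← div_eq_mul_inv, div_lt_one (Real.exp_pos _)] at ha
    refine le_trans ?_ ha.le
    rw [mul_assoc, ← mul_pow]
    have : 2 + a * y ≤ (2 + y) * a := by nlinarith
    gcongr
  filter_upwards [eventually_scale_bounds h, h, hlam.eventually hpoly,
    hlam.eventually (eventually_scaleFun_bounds (k := 0) (K := 1 / 2 + η / 8) (by norm_num)
      (by linarith)),
    hlam.eventually (eventually_log_fReal_bounds (k := 1 / 2 - η / 8) (K := 1) (by linarith)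
      (by norm_num)),
    (Real.tendsto_log_atTop.comp hlam).eventually_ge_atTop (8 / η)] with n hb hsc hp hs hF hl
  simp only [Function.comp] at hl
  have hl0 : 0 < lam n := by linarith [hb.1]
  have hf : ‖f (lam n * (y * Complex.I))‖ ≤ Real.exp (lam n) := by
    have hre : ((lam n : ℂ) * (y * Complex.I)).re = 0 := by simp
    have h1 := hC (lam n * (y * Complex.I)) hre.ge
    rw [hre, zero_div, zero_mul, Real.exp_zero, mul_one, norm_mul, norm_mul, Complex.norm_I,
      mul_one, Complex.norm_real, Complex.norm_real, Real.norm_of_nonneg hl0.le,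
      Real.norm_of_nonneg hy.le] at h1
    exact h1.trans hp
  have hF0 := fReal_pos hsc.1
  have hg : y ^ (2 * n) * fReal (lam n) =
      Real.exp (scaleFun (lam n) * Real.log y + Real.log (fReal (lam n))) := by
    rw [Real.exp_add, Real.exp_log hF0, hb.2.1]
    congr 1
    rw [← Real.exp_log (pow_pos hy (2 * n)), Real.log_pow]
    push_cast
    rfl
  rw [hg]
  calc _ ≤ Real.exp (lam n) * Real.exp (1 * lam n) := by gcongr
    _ = Real.exp (2 * lam n) := by rw [← Real.exp_add]; ring_nf
    _ ≤ _ := by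
      apply Real.exp_le_exp.mpr
      set P := lam n * Real.log (lam n) with hP
      have hs0 : 0 ≤ scaleFun (lam n) := by
        rw [hb.2.1]
        positivity
      have h1 : scaleFun (lam n) * (-(1 - η)) ≤ scaleFun (lam n) * Real.log y := by gcongr
      have h2 : scaleFun (lam n) * (1 - η) ≤ (1 / 2 + η / 8) * P * (1 - η) := by
        have : 0 ≤ 1 - η := by linarith
        gcongr
        exact hs.2
      have h3 : lam n * (8 / η) ≤ P := by rw [hP]; gcongr
      have h4 : 2 * lam n ≤ η / 4 * P := by
        calc 2 * lam n = η / 4 * (lam n * (8 / η)) := by field_simp; norm_num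
          _ ≤ _ := by gcongr
      have hP0 : 0 ≤ P := le_trans (by positivity) h3
      have h5 : (1 / 2 - η / 8) * P - (1 / 2 + η / 8) * P * (1 - η) =
          η / 4 * P + η ^ 2 / 8 * P := by ring
      have h6 : 0 ≤ η ^ 2 / 8 * P := by positivity
      linarith [hF.1]

theorem exists_growth {lam : ℕ → ℝ} (h : ∀ᶠ n : ℕ in atTop, IsScale n (lam n)) {z : ℂ}
    (hz0 : z ≠ 0) (hz1 : z ^ 2 ≠ 1)
    (hlt : ∀ᶠ n : ℕ in atTop, ‖f (lam n * z)‖ < ‖z‖ ^ (2 * n) * fReal (lam n)) :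
    ∃ c : ℝ, 0 < c ∧ ∀ᶠ n : ℕ in atTop,
      ‖f (lam n * z)‖ * Real.exp (c * lam n) ≤ ‖z‖ ^ (2 * n) * fReal (lam n) := by
  have hneg : ∀ n, ‖f (lam n * -z)‖ = ‖f (lam n * z)‖ := fun n => by rw [mul_neg, f_neg]
  have hpos : ∀ w : ℂ, 0 < w.re → w ^ 2 ≠ 1 → w ≠ 1 := by
    rintro w - hw rfl
    exact hw (one_pow 2)
  have himag : ∀ y : ℝ, 0 < y → ‖(y * Complex.I : ℂ)‖ = y := fun y hy => by
    rw [norm_mul, Complex.norm_I, mul_one, Complex.norm_real, Real.norm_of_nonneg hy.le]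
  rcases lt_trichotomy z.re 0 with hx | hx | hx
  · have := exists_growth_of_re_pos h (z := -z) (by simpa using hx)
      (hpos _ (by simpa using hx) (by rwa [neg_sq])) (by simpa only [hneg, norm_neg] using hlt)
    simpa only [hneg, norm_neg] using this
  · have hzI : z = z.im * Complex.I := Complex.ext (by simp [hx]) (by simp)
    rcases lt_trichotomy z.im 0 with hy | hy | hy
    · have e : -z = ((-z.im : ℝ) : ℂ) * Complex.I := by
        conv_lhs => rw [hzI]
        push_cast
        ring
      have hy' : 0 < -z.im := by linarith
      have hn : ‖z‖ = -z.im := by rw [← norm_neg, e, himag _ hy']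
      refine ⟨1, one_pos, ?_⟩
      have := exists_growth_of_imag h hy' (by
        rw [← e]
        simpa only [hneg, ← hn] using hlt)
      rw [← e] at this
      simpa only [hneg, ← hn] using this
    · exact absurd (Complex.ext hx hy) hz0
    · have hn : ‖z‖ = z.im := by conv_lhs => rw [hzI, himag _ hy]
      refine ⟨1, one_pos, ?_⟩
      have := exists_growth_of_imag h hy (by
        rw [← hzI]
        simpa only [← hn] using hlt)
      rw [← hzI] at this
      simpa only [← hn] using this
  · exact exists_growth_of_re_pos h hx (hpos _ hx hz1) hlt

theorem tendsto_of_mem_MhoPlus {lam : ℕ → ℝ} (h : ∀ᶠ n : ℕ in atTop, IsScale n (lam n)) {z : ℂ}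
    (hz : ∀ᶠ n : ℕ in atTop, z ∈ MhoPlus n (lam n)) :
    Tendsto (fun n : ℕ => ‖T (2 * n) (lam n * z)‖ₑ / ‖f (lam n * z)‖ₑ) atTop (𝓝 (⊤ : ℝ≥0∞)) := by
  have hlt : ∀ᶠ n : ℕ in atTop, ‖f (lam n * z)‖ < ‖z‖ ^ (2 * n) * fReal (lam n) := by
    filter_upwards [hz, h] with n hn hsc
    exact norm_f_lt_of_one_lt_expPhase hsc.1 hn
  have hz0 : z ≠ 0 := by
    rintro rfl
    obtain ⟨n, hn, hn0⟩ := (hlt.and (eventually_gt_atTop 0)).exists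
    rw [norm_zero, zero_pow (by omega), zero_mul] at hn
    exact absurd hn (norm_nonneg _).not_gt
  have hz1 : z ^ 2 ≠ 1 := by
    intro h1
    obtain ⟨n, hn, hsc⟩ := (hlt.and h).exists
    rcases (by simpa using h1 : z = 1 ∨ z = -1) with rfl | rfl
    · rw [mul_one, norm_one, one_pow, one_mul, norm_f_ofReal hsc.1] at hn
      exact lt_irrefl _ hn
    · rw [mul_neg, mul_one, f_neg, norm_neg, norm_one, one_pow, one_mul, norm_f_ofReal hsc.1] at hn
      exact lt_irrefl _ hn
  obtain ⟨c, hc, hg⟩ := exists_growth h hz0 hz1 hlt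
  exact tendsto_top_of_growth h hz0 hz1 hc hg

end XiTaylor

theorem corollary3p2 :
    (∀ᶠ n : ℕ in atTop, ∃! lam : ℝ, XiTaylor.IsScale n lam) ∧
    ∀ lam : ℕ → ℝ, (∀ᶠ n : ℕ in atTop, XiTaylor.IsScale n (lam n)) →
      Tendsto lam atTop atTop ∧
      (∀ z : ℂ, (∀ᶠ n : ℕ in atTop, z ∈ XiTaylor.Omega n (lam n)) →
        Tendsto
          (fun n : ℕ =>
            ‖XiTaylor.T (2 * n) ((lam n : ℂ) * z) / XiTaylor.xi (1 / 2 + (lam n : ℂ) * z) - 1‖)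
          atTop (𝓝 0)) ∧
      (∀ z : ℂ, (∀ᶠ n : ℕ in atTop, z ∈ XiTaylor.MhoMinus n (lam n)) →
        Tendsto
          (fun n : ℕ =>
            ‖XiTaylor.T (2 * n) ((lam n : ℂ) * z) / XiTaylor.xi (1 / 2 + (lam n : ℂ) * z)‖)
          atTop (𝓝 0)) ∧
      (∀ z : ℂ, (∀ᶠ n : ℕ in atTop, z ∈ XiTaylor.MhoPlus n (lam n)) →
        Tendsto
          (fun n : ℕ =>
            ‖XiTaylor.T (2 * n) ((lam n : ℂ) * z)‖ₑ /
              ‖XiTaylor.xi (1 / 2 + (lam n : ℂ) * z)‖ₑ)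
          atTop (𝓝 (⊤ : ℝ≥0∞))) := by
  refine ⟨XiTaylor.eventually_existsUnique_isScale, fun lam h => ⟨XiTaylor.tendsto_of_isScale h,
    fun z hz => XiTaylor.tendsto_of_mem_Omega h hz,
    fun z hz => XiTaylor.tendsto_of_mem_MhoMinus h hz,
    fun z hz => XiTaylor.tendsto_of_mem_MhoPlus h hz⟩⟩
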